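/- Let $\mathbb T^3=\mathbb R^3/2\pi\mathbb Z^3$, let $\nu>0$, and consider the vector-valued Burgers equations $u_t+(u\cdot\nabla)u-\nu\Delta u=0$ on $\mathbb T^3$ with $u(0)=u_0$, where $u$ takes values in $\mathbb R^3$. For $T>0$, a function $u\in C^0([0,T];H^{1/2})\cap L^2(0,T;H^{3/2})$ with distributional time derivative $u_t\in L^2(0,T;H^{-1/2})$ is called a strong solution on $[0,T]$ if for every $\phi\in C^\infty(\mathbb T^3;\mathbb R^3)$ $$\langle u_t,\phi\rangle+((u\cdot\nabla)u,\phi)_{L^2}+\nu(\nabla u,\nabla\phi)_{L^2}=0\quad\text{for almost every }t\in[0,T],$$ where $\langle\cdot,\cdot\rangle$ is the duality pairing of $H^{-1/2}$ with $H^{1/2}$. A global strong solution is a function on $[0,\infty)$ that is a strong solution on $[0,T]$ for every $T>0$. **Theorem.** For every $u_0\in H^1(\mathbb T^3;\mathbb R^3)$ there is a global strong solution $u$ of the Burgers equations with $u(0)=u_0$, and it is unique among all global strong solutions with this initial value. It satisfies $u\in C^0([0,\infty);H^1)$ and $u\in L^2(0,T;H^2)$ for every $T>0$. Moreover, for $t>0$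 it is (after modification on null sets in $x$) a classical solution: $u\in C^1((0,\infty);C^0(\mathbb T^3))\cap C^0((0,\infty);C^2(\mathbb T^3))$ and the equations hold at every point of $(0,\infty)\times\mathbb T^3$. -/

import Mathlib

open MeasureTheory Filter Topology Set
open scoped ContDiff

noncomputable section

namespace Burgers

/-! ### The torus and function spaces on it -/

instance factTwoPiPos : Fact ((0 : ℝ) < 2 * Real.pi) := ⟨Real.two_pi_pos⟩

/-- The torus `ℝ³ / 2πℤ³`; its `volume` is Lebesgue measure, of total mass `(2π)³`. -/
abbrev T3 : Type := Fin 3 → AddCircle (2 * Real.pi)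

/-- Euclidean `ℝ³`, in which the vector fields take their values. -/
abbrev V3 : Type := EuclideanSpace ℝ (Fin 3)

/-- The space `L²(𝕋³; ℝ³)`. -/
abbrev L2 : Type := Lp V3 2 (volume : Measure T3)

/-- A vector field on the torus, seen as a `2π`-periodic function on `ℝ³`. -/
def periodicLift (f : T3 → V3) (y : Fin 3 → ℝ) : V3 :=
  f (fun i => (y i : AddCircle (2 * Real.pi)))

/-- `f ∈ Cⁿ(𝕋³; ℝ³)`. -/
def IsCn (n : WithTop ℕ∞) (f : T3 → V3) : Prop := ContDiff ℝ n (periodicLift f)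

/-- The classical partial derivative `∂f/∂x_j` on the torus. -/
def partialD (j : Fin 3) (f : T3 → V3) (x : T3) : V3 :=
  deriv (fun h : ℝ => f (x + Pi.single j (h : AddCircle (2 * Real.pi)))) 0

/-- `g` is the weak partial derivative `∂f/∂x_j`. -/
def IsWeakPartial (j : Fin 3) (f g : L2) : Prop :=
  ∀ φ : T3 → V3, IsCn ∞ φ →
    ∫ x, inner ℝ (f x) (partialD j φ x) = - ∫ x, inner ℝ (g x) (φ x)

/-! ### Fourier coefficients and Sobolev norms -/

/-- A family of Fourier coefficients, indexed by `ℤ³`, with values in `ℂ³`. Such families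
describe the periodic distributions, in particular the elements of `H^s` for every real `s`. -/
abbrev Coeffs : Type := (Fin 3 → ℤ) → EuclideanSpace ℂ (Fin 3)

/-- The character `x ↦ e^{i k·x}` on the torus. -/
def character (k : Fin 3 → ℤ) (x : T3) : ℂ := ∏ i, fourier (k i) (x i)

/-- The Fourier coefficients `(2π)⁻³ ∫ f(x) e^{-i k·x} dx` of a vector field. -/
def fourierCoeffs (f : T3 → V3) : Coeffs := fun k =>
  WithLp.toLp 2 fun i =>
    (((2 * Real.pi) ^ 3 : ℝ) : ℂ)⁻¹ * ∫ x, character (-k) x * ((f x i : ℝ) : ℂ)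

/-- The square of the `H^s` norm, `∑ₖ (1 + |k|²)^s |cₖ|²`, with value `∞` off `H^s`. -/
def sobolevSq (s : ℝ) (c : Coeffs) : ENNReal :=
  ∑' k : Fin 3 → ℤ, ENNReal.ofReal ((1 + ∑ i, (k i : ℝ) ^ 2) ^ s) * ‖c k‖ₑ ^ 2

/-- `f ∈ H^s(𝕋³; ℝ³)`, for `s ≥ 0`. -/
def MemH (s : ℝ) (f : L2) : Prop := sobolevSq s (fourierCoeffs f) < ⊤

/-- `u ∈ C⁰(I; H^s)`. -/
def ContIntoH (s : ℝ) (I : Set ℝ) (u : ℝ → L2) : Prop :=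
  (∀ t ∈ I, MemH s (u t)) ∧
  ∀ t ∈ I, Tendsto (fun r => sobolevSq s (fourierCoeffs (u r) - fourierCoeffs (u t)))
    (𝓝[I] t) (𝓝 0)

/-- `c ∈ L²(0, T; H^s)`. As `H^s` is a separable Hilbert space, in which the finite linear
combinations of the coefficient functionals are dense in the dual, strong measurability in time
is the measurability of every Fourier coefficient. -/
def MemL2H (s T : ℝ) (c : ℝ → Coeffs) : Prop :=
  (∀ k, AEStronglyMeasurable (fun t => c t k) (volume.restrict (Ioo 0 T))) ∧
  ∫⁻ t in Ioo 0 T, sobolevSq s (c t) < ⊤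

/-- The pairing `⟨c, φ⟩` of `H^{-s}` with `H^s` that extends the inner product of `L²`. -/
def dualPairing (c : Coeffs) (φ : T3 → V3) : ℂ :=
  (((2 * Real.pi) ^ 3 : ℝ) : ℂ) *
    ∑' k : Fin 3 → ℤ, ∑ i, c k i * (starRingEnd ℂ) (fourierCoeffs φ k i)

/-- `u_t = g` on `(0, T)` in the sense of distributions in time. -/
def IsTimeDeriv (T : ℝ) (u : ℝ → L2) (g : ℝ → Coeffs) : Prop :=
  ∀ ψ : ℝ → ℝ, ContDiff ℝ ∞ ψ → HasCompactSupport ψ → tsupport ψ ⊆ Ioo 0 T →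
    ∀ k, ∫ t in Ioo 0 T, deriv ψ t • fourierCoeffs (u t) k = - ∫ t in Ioo 0 T, ψ t • g t k

/-! ### Solutions of `u_t + (u·∇)u - νΔu = 0` -/

/-- The weak form of the equation at one time, tested with `φ`; here `ut` is `u_t` and `u` is
the solution at that time:
`⟨u_t, φ⟩ + ((u·∇)u, φ) + ν (∇u, ∇φ) = 0`. -/
def WeakEquation (ν : ℝ) (u : L2) (ut : Coeffs) (φ : T3 → V3) : Prop :=
  ∃ G : Fin 3 → L2, (∀ j, IsWeakPartial j u (G j)) ∧
    dualPairing ut φ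
      + ((∫ x, inner ℝ (∑ j, u x j • G j x) (φ x) : ℝ) : ℂ)
      + ((ν * ∑ j, ∫ x, inner ℝ (G j x) (partialD j φ x) : ℝ) : ℂ) = 0

/-- Strong solutions on `[0, T]`: `u ∈ C⁰([0,T]; H^{1/2}) ∩ L²(0,T; H^{3/2})` with
`u_t ∈ L²(0,T; H^{-1/2})`, and for every smooth `φ` the weak form holds at almost every time. -/
def IsStrongSolutionOn (ν T : ℝ) (u : ℝ → L2) : Prop :=
  ContIntoH (1 / 2) (Icc 0 T) u ∧
  MemL2H (3 / 2) T (fun t => fourierCoeffs (u t)) ∧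
  ∃ ut : ℝ → Coeffs, MemL2H (-(1 / 2)) T ut ∧ IsTimeDeriv T u ut ∧
    ∀ φ : T3 → V3, IsCn ∞ φ →
      ∀ᵐ t ∂(volume.restrict (Ioo 0 T)), WeakEquation ν (u t) (ut t) φ

/-- Global strong solutions with initial data `u₀`. Only the values at times `t ≥ 0` matter. -/
def IsGlobalStrongSolution (ν : ℝ) (u₀ : L2) (u : ℝ → L2) : Prop :=
  u 0 = u₀ ∧ ∀ T : ℝ, 0 < T → IsStrongSolutionOn ν T u

/-- `w ∈ C⁰((0,∞); C²(𝕋³; ℝ³))`. -/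
def ContIntoC2 (w : ℝ → C(T3, V3)) : Prop :=
  (∀ t, 0 < t → IsCn 2 (w t)) ∧
  ContinuousOn w (Ioi 0) ∧
  (∀ j, ∀ t, 0 < t → TendstoUniformly (fun r => partialD j (w r)) (partialD j (w t)) (𝓝 t)) ∧
  (∀ i j, ∀ t, 0 < t → TendstoUniformly (fun r => partialD i (partialD j (w r)))
    (partialD i (partialD j (w t))) (𝓝 t))

/-- `w ∈ C¹((0,∞); C⁰) ∩ C⁰((0,∞); C²)` satisfies the equation at every `(t, x)`, `t > 0`. -/
def IsClassicalSolution (ν : ℝ) (w : ℝ → C(T3, V3)) : Prop :=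
  ContDiffOn ℝ 1 w (Ioi 0) ∧ ContIntoC2 w ∧
  ∀ t, 0 < t → ∀ x : T3,
    deriv w t x + ∑ j, w t x j • partialD j (w t) x
      - ν • ∑ j, partialD j (partialD j (w t)) x = 0

end Burgers

end

noncomputable section

namespace Burgers

/-! ### Lattice sums and convolution estimates -/

/-! The proof lives on the Fourier side. A vector field is its family of coefficients, the equation
is the system c_k' = -ν|k|²c_k - N_k(c) (`rhs`), where N is a convolution over ℤ³ (`nonlin`), and
all norms are weighted sums with values in [0,∞], so that sums and integrals can be exchanged
freely. The nonlinear estimates for general data rest on one lattice sum, `lattice_sum_shift_le`: ∑ₖ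
1/(wt(k-m)(R²+wt k)) ≤ 432/R for R ≥ 1. The parameter R replaces interpolation inequalities: a large
R makes the top-order part of a nonlinear term as small as desired, at the price of a lower-order
part with factor R².

Local existence (`exists_local_solution`) is a contraction for the coefficients multiplied by √(wt
k)·exp(ν t|k|_∞/2), in the ℓ² space of continuous functions of time. The exponential weight is
harmless in a convolution by the triangle inequality, and half of the viscosity pays for it. The
existence time depends only on ν and the H¹ norm of the data, and the modes decay exponentially at
positive times. Restarting shortly before any given time turns this into uniform rapid decay away
from the initial time (`IsCoeffSolution.exists_isRapid`), so the field is smooth there and satisfies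
the equation pointwise (`IsRapid.synth_rhs`).

Global existence comes from the maximum principle. At a spatial maximum of |u|² the transport term
u·(u·∇)u = ½u·∇|u|² vanishes and u·Δu ≤ 0, so the supremum of |u| does not increase
(`IsCoeffSolution.norm_synth_le`). With |u| ≤ K, testing with -Δu gives d/dt‖∇u‖² ≤ K²/(2ν)‖∇u‖²:
the dissipation is used up, and Grönwall bounds the H¹ norm on bounded time intervals
(`IsCoeffSolution.sobolevSq_one_le`). Hence one step length serves to reach any time T
(`exists_solution_on`). The argument concerns real fields; reality is propagated by uniqueness
(`IsCoeffSolution.isReal`).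

Uniqueness is proved in the larger class L^∞(L²) ∩ L⁴(H¹) of solutions of the integrated coefficient
equations (`IsWeakCoeffSolution.unique`): the L² energy of a difference satisfies a Grönwall
inequality whose rate is quadratic in the squared H¹ norms. A strong solution belongs to this class
because ‖u‖²_{H¹} ≤ ‖u‖_{H^{1/2}}‖u‖_{H^{3/2}} and because testing with cosines and sines recovers
the system mode by mode (`IsStrongSolutionOn.isWeakCoeffSolution`). The energy identity is needed
for single modes only, where it is the product rule for absolutely continuous functions.

Up to the initial time, continuity in H¹ follows from a time-independent H¹ majorant of the modes,
and the L²(H²) bound from an H¹ energy estimate on [a', T] that is uniform as a' tends to 0. -/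

/-- The weight `1 + |k|²`. -/
def wt (k : Fin 3 → ℤ) : ℝ := 1 + ∑ i, (k i : ℝ) ^ 2

lemma one_le_wt (k : Fin 3 → ℤ) : 1 ≤ wt k :=
  le_add_of_nonneg_right (Finset.sum_nonneg fun _ _ => sq_nonneg _)

lemma wt_pos (k : Fin 3 → ℤ) : 0 < wt k := zero_lt_one.trans_le (one_le_wt k)

lemma wt_neg (k : Fin 3 → ℤ) : wt (-k) = wt k := by simp [wt]

lemma wt_sub_comm (k l : Fin 3 → ℤ) : wt (k - l) = wt (l - k) := by rw [← wt_neg, neg_sub]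

/-- The maximum norm on the lattice, as a natural number. -/
def maxNorm (k : Fin 3 → ℤ) : ℕ := Finset.univ.sup fun i => (k i).natAbs

lemma natAbs_le_maxNorm (k : Fin 3 → ℤ) (i : Fin 3) : (k i).natAbs ≤ maxNorm k :=
  Finset.le_sup (f := fun i => (k i).natAbs) (Finset.mem_univ i)

lemma exists_natAbs_eq_maxNorm (k : Fin 3 → ℤ) : ∃ i, (k i).natAbs = maxNorm k := by
  obtain ⟨i, -, hi⟩ := Finset.exists_mem_eq_sup (Finset.univ : Finset (Fin 3))
    Finset.univ_nonempty fun i => (k i).natAbs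
  exact ⟨i, hi.symm⟩

lemma maxNorm_sq_add_one_le_wt (k : Fin 3 → ℤ) : 1 + (maxNorm k : ℝ) ^ 2 ≤ wt k := by
  obtain ⟨i, hi⟩ := exists_natAbs_eq_maxNorm k
  have h : ((maxNorm k : ℕ) : ℝ) ^ 2 = (k i : ℝ) ^ 2 := by
    rw [← hi, Nat.cast_natAbs, Int.cast_abs, sq_abs]
  rw [h, wt]
  gcongr
  exact Finset.single_le_sum (f := fun i => (k i : ℝ) ^ 2) (fun _ _ => sq_nonneg _)
    (Finset.mem_univ i)

lemma maxNorm_add_le (k l : Fin 3 → ℤ) : maxNorm (k + l) ≤ maxNorm k + maxNorm l :=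
  Finset.sup_le fun i _ => (Int.natAbs_add_le _ _).trans
    (add_le_add (natAbs_le_maxNorm k i) (natAbs_le_maxNorm l i))

/-- Integrality of the wave numbers is used here: a natural number is at most its square. It lets
the viscosity dominate the linear weight |k|_∞ at low frequencies as well, see `half_le_decay`. -/
lemma maxNorm_le_sum_sq (k : Fin 3 → ℤ) : (maxNorm k : ℝ) ≤ ∑ i, (k i : ℝ) ^ 2 := by
  have h := maxNorm_sq_add_one_le_wt k
  rw [wt] at h
  have h2 : (maxNorm k : ℝ) ≤ (maxNorm k : ℝ) ^ 2 := by
    exact_mod_cast Nat.le_self_pow two_ne_zero _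
  linarith

/-- The lattice points of maximum norm `n`, or a superset of them of size at most `54(1+n²)`. -/
def shell (n : ℕ) : Finset (Fin 3 → ℤ) :=
  Finset.univ.biUnion fun i : Fin 3 => Fintype.piFinset fun j =>
    if j = i then {(n : ℤ), -(n : ℤ)} else Finset.Icc (-(n : ℤ)) n

lemma mem_shell (k : Fin 3 → ℤ) : k ∈ shell (maxNorm k) := by
  obtain ⟨i, hi⟩ := exists_natAbs_eq_maxNorm k
  rw [shell, Finset.mem_biUnion]
  refine ⟨i, Finset.mem_univ _, Fintype.mem_piFinset.2 fun j => ?_⟩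
  have := natAbs_le_maxNorm k j
  split_ifs with h
  · subst h
    simp only [Finset.mem_insert, Finset.mem_singleton]
    omega
  · rw [Finset.mem_Icc]
    omega

lemma card_shell_le (n : ℕ) : ((shell n).card : ℝ) ≤ 54 * (1 + (n : ℝ) ^ 2) := by
  have h1 : (shell n).card ≤ ∑ _i : Fin 3, 2 * (2 * n + 1) ^ 2 := by
    refine Finset.card_biUnion_le.trans (Finset.sum_le_sum fun i _ => ?_)
    rw [Fintype.card_piFinset]
    have hI : (Finset.Icc (-(n : ℤ)) n).card = 2 * n + 1 := by
      rw [Int.card_Icc]; omega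
    have hp : ({(n : ℤ), -(n : ℤ)} : Finset ℤ).card ≤ 2 := Finset.card_le_two
    fin_cases i <;> simp [Fin.prod_univ_three, hI] <;> nlinarith [Nat.zero_le ((2 * n + 1) ^ 2)]
  have h2 : ((shell n).card : ℝ) ≤ 6 * (2 * n + 1) ^ 2 := by
    have : (shell n).card ≤ 6 * (2 * n + 1) ^ 2 := by
      simp at h1; linarith
    exact_mod_cast this
  nlinarith [sq_nonneg ((n : ℝ) - 1)]

/-- Charging each lattice point to its own shell reduces a three-dimensional sum to a radial series
in one variable. -/
lemma tsum_le_tsum_shell (f : (Fin 3 → ℤ) → ENNReal) (g : ℕ → ENNReal)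
    (h : ∀ k, f k ≤ g (maxNorm k)) :
    ∑' k, f k ≤ ∑' n : ℕ, ENNReal.ofReal (54 * (1 + (n : ℝ) ^ 2)) * g n := by
  have h1 : ∀ k, f k ≤ ∑' n : ℕ, if k ∈ shell n then g n else 0 := fun k => by
    refine (h k).trans ?_
    refine le_trans ?_ (ENNReal.le_tsum (maxNorm k))
    rw [if_pos (mem_shell k)]
  refine (ENNReal.tsum_le_tsum h1).trans ?_
  rw [ENNReal.tsum_comm]
  refine ENNReal.tsum_le_tsum fun n => ?_
  rw [tsum_eq_sum (s := shell n) (fun k hk => if_neg hk), Finset.sum_ite_mem, Finset.inter_self,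
    Finset.sum_const, nsmul_eq_mul]
  gcongr
  rw [← ENNReal.ofReal_natCast]
  exact ENNReal.ofReal_le_ofReal (card_shell_le n)

/-- The cardinality 54(1+n²) of a shell cancels one weight and leaves 54∑1/(R²+n²). Since
(R+n)(R+n+1) ≤ 4(R²+n²) for R ≥ 1, this is dominated by a telescoping series with sum 216/R. The
decay in R is the source of smallness in all later estimates. -/
lemma lattice_sum_le {R : ℝ} (hR : 1 ≤ R) :
    ∑' k, ENNReal.ofReal ((wt k * (R ^ 2 + wt k))⁻¹) ≤ ENNReal.ofReal (216 / R) := by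
  have hR0 : 0 < R := by linarith
  refine (tsum_le_tsum_shell _
    (fun n => ENNReal.ofReal (((1 + (n : ℝ) ^ 2) * (R ^ 2 + n ^ 2))⁻¹)) fun k => ?_).trans ?_
  · apply ENNReal.ofReal_le_ofReal
    have := maxNorm_sq_add_one_le_wt k
    have hp := (wt_pos k).le
    gcongr
    linarith
  have h1 : ∀ n : ℕ, ENNReal.ofReal (54 * (1 + (n : ℝ) ^ 2)) *
      ENNReal.ofReal (((1 + (n : ℝ) ^ 2) * (R ^ 2 + n ^ 2))⁻¹) ≤
      ENNReal.ofReal (216 * ((R + n)⁻¹ - (R + (n + 1 : ℕ))⁻¹)) := fun n => by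
    rw [← ENNReal.ofReal_mul (by positivity)]
    apply ENNReal.ofReal_le_ofReal
    have hn : (0 : ℝ) ≤ n := n.cast_nonneg
    push_cast
    have e1 : 54 * (1 + (n : ℝ) ^ 2) * (((1 + (n : ℝ) ^ 2) * (R ^ 2 + n ^ 2))⁻¹)
        = 54 / (R ^ 2 + n ^ 2) := by field_simp
    have e2 : 216 * ((R + n)⁻¹ - (R + (n + 1))⁻¹) = 216 / ((R + n) * (R + (n + 1))) := by
      field_simp; ring
    rw [e1, e2, div_le_div_iff₀ (by positivity) (by positivity)]
    nlinarith [sq_nonneg (R - n)]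
  refine (ENNReal.tsum_le_tsum h1).trans ?_
  refine ENNReal.tsum_le_of_sum_range_le fun N => ?_
  rw [← ENNReal.ofReal_sum_of_nonneg]
  · apply ENNReal.ofReal_le_ofReal
    rw [← Finset.mul_sum, Finset.sum_range_sub' (fun n : ℕ => (R + n)⁻¹)]
    have : 0 ≤ (R + (N : ℝ))⁻¹ := by positivity
    simp only [Nat.cast_zero, add_zero, div_eq_mul_inv]
    linarith
  · intro n _
    have : (R + ((n + 1 : ℕ) : ℝ))⁻¹ ≤ (R + (n : ℝ))⁻¹ := by
      apply inv_anti₀ (by positivity); push_cast; linarith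
    linarith

/-- Replacing the larger of wt k and wt(k-m) by the smaller one bounds each term by a term of one of
two unshifted sums; hence twice 216. -/
lemma lattice_sum_shift_le {R : ℝ} (hR : 1 ≤ R) (m : Fin 3 → ℤ) :
    ∑' k, ENNReal.ofReal ((wt (k - m) * (R ^ 2 + wt k))⁻¹) ≤ ENNReal.ofReal (432 / R) := by
  set h : (Fin 3 → ℤ) → ENNReal := fun k => ENNReal.ofReal ((wt k * (R ^ 2 + wt k))⁻¹)
  have h1 : ∀ k, ENNReal.ofReal ((wt (k - m) * (R ^ 2 + wt k))⁻¹) ≤ h k + h (k - m) := fun k => by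
    have p := wt_pos k
    have q := wt_pos (k - m)
    rcases le_total (wt k) (wt (k - m)) with hk | hk
    · refine le_trans (ENNReal.ofReal_le_ofReal ?_) le_self_add
      gcongr
    · refine le_trans (ENNReal.ofReal_le_ofReal ?_) le_add_self
      gcongr
  refine (ENNReal.tsum_le_tsum h1).trans ?_
  rw [ENNReal.tsum_add, show ∑' k, h (k - m) = ∑' k, h k from (Equiv.subRight m).tsum_eq h]
  refine (add_le_add (lattice_sum_le hR) (lattice_sum_le hR)).trans_eq ?_
  rw [← ENNReal.ofReal_add (by positivity) (by positivity)]
  congr 1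
  ring

/-- The Cauchy–Schwarz inequality for series in `[0, ∞]`. -/
lemma tsum_mul_sq_le {ι : Type*} (f g : ι → ENNReal) :
    (∑' i, f i * g i) ^ 2 ≤ (∑' i, f i ^ 2) * ∑' i, g i ^ 2 := by
  let _ : MeasurableSpace ι := ⊤
  have h := ENNReal.lintegral_mul_le_Lp_mul_Lq (Measure.count : Measure ι)
    (Real.HolderConjugate.two_two) (f := f) (g := g) measurable_from_top.aemeasurable
    measurable_from_top.aemeasurable
  simp only [lintegral_count' measurable_from_top, Pi.mul_apply, ENNReal.rpow_ofNat] at h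
  calc (∑' i, f i * g i) ^ 2
      ≤ ((∑' i, f i ^ 2) ^ (1 / 2 : ℝ) * (∑' i, g i ^ 2) ^ (1 / 2 : ℝ)) ^ 2 := by gcongr
    _ = _ := by
        rw [mul_pow, ← ENNReal.rpow_natCast, ← ENNReal.rpow_mul, ← ENNReal.rpow_natCast,
          ← ENNReal.rpow_mul]
        norm_num

/-- The convolution of nonnegative sequences. -/
def conv (a b : (Fin 3 → ℤ) → ENNReal) (k : Fin 3 → ℤ) : ENNReal := ∑' l, a l * b (k - l)

/-- `∑ₖ (1 + |k|²) aₖ²`. -/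
def energy (a : (Fin 3 → ℤ) → ENNReal) : ENNReal := ∑' k, ENNReal.ofReal (wt k) * a k ^ 2

lemma ofReal_mul_ofReal_inv {x : ℝ} (hx : 0 < x) :
    ENNReal.ofReal x * ENNReal.ofReal x⁻¹ = 1 := by
  rw [← ENNReal.ofReal_mul hx.le, mul_inv_cancel₀ hx.ne', ENNReal.ofReal_one]

lemma ofReal_sqrt_sq {x : ℝ} (hx : 0 ≤ x) : ENNReal.ofReal (√x) ^ 2 = ENNReal.ofReal x := by
  rw [← ENNReal.ofReal_pow (Real.sqrt_nonneg _), Real.sq_sqrt hx]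

/-- The Cauchy–Schwarz inequality with a positive weight. -/
lemma tsum_sq_le_weighted {ι : Type*} (f : ι → ENNReal) (p : ι → ℝ) (hp : ∀ i, 0 < p i) :
    (∑' i, f i) ^ 2 ≤ (∑' i, ENNReal.ofReal (p i) * f i ^ 2) * ∑' i, ENNReal.ofReal (p i)⁻¹ := by
  have h := tsum_mul_sq_le (fun i => ENNReal.ofReal (√(p i)) * f i)
    fun i => ENNReal.ofReal (√(p i)⁻¹)
  have e1 : ∀ i, ENNReal.ofReal (√(p i)) * f i * ENNReal.ofReal (√(p i)⁻¹) = f i := fun i => by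
    rw [mul_right_comm, Real.sqrt_inv, ofReal_mul_ofReal_inv (Real.sqrt_pos.2 (hp i)), one_mul]
  simp only [e1, mul_pow, ofReal_sqrt_sq (hp _).le, ofReal_sqrt_sq (inv_pos.2 (hp _)).le] at h
  exact h

/-- Cauchy–Schwarz with weight wt l extracts the whole H¹ energy of `a`. After exchanging sums, each
`b m ^ 2` is multiplied by exactly the shifted lattice sum. This is a bound H¹·L² → H⁻¹ with a gain
1/R. -/
lemma tsum_conv_sq_div_le {R : ℝ} (hR : 1 ≤ R) (a b : (Fin 3 → ℤ) → ENNReal) :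
    ∑' k, ENNReal.ofReal (R ^ 2 + wt k)⁻¹ * conv a b k ^ 2 ≤
      ENNReal.ofReal (432 / R) * (energy a * ∑' k, b k ^ 2) := by
  have h1 : ∀ k, conv a b k ^ 2 ≤ energy a * ∑' l, ENNReal.ofReal (wt l)⁻¹ * b (k - l) ^ 2 :=
    fun k => by
      have h := tsum_mul_sq_le (fun l => ENNReal.ofReal (√(wt l)) * a l)
        fun l => ENNReal.ofReal (√(wt l)⁻¹) * b (k - l)
      have e1 : ∀ l, ENNReal.ofReal (√(wt l)) * a l * (ENNReal.ofReal (√(wt l)⁻¹) * b (k - l))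
          = a l * b (k - l) := fun l => by
        rw [mul_mul_mul_comm, Real.sqrt_inv,
          ofReal_mul_ofReal_inv (Real.sqrt_pos.2 (wt_pos l)), one_mul]
      simp only [e1, mul_pow, ofReal_sqrt_sq (wt_pos _).le,
        ofReal_sqrt_sq (inv_pos.2 (wt_pos _)).le] at h
      exact h
  calc ∑' k, ENNReal.ofReal (R ^ 2 + wt k)⁻¹ * conv a b k ^ 2
      ≤ ∑' k, ENNReal.ofReal (R ^ 2 + wt k)⁻¹ *
          (energy a * ∑' l, ENNReal.ofReal (wt l)⁻¹ * b (k - l) ^ 2) := by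
        gcongr with k; exact h1 k
    _ = energy a * ∑' k, ∑' m, ENNReal.ofReal (R ^ 2 + wt k)⁻¹ *
          (ENNReal.ofReal (wt (k - m))⁻¹ * b m ^ 2) := by
        rw [← ENNReal.tsum_mul_left]
        refine tsum_congr fun k => ?_
        rw [mul_left_comm, ← ENNReal.tsum_mul_left, ← (Equiv.subLeft k).tsum_eq]
        simp
    _ = energy a * ∑' m, b m ^ 2 *
          ∑' k, ENNReal.ofReal ((wt (k - m) * (R ^ 2 + wt k))⁻¹) := by
        rw [ENNReal.tsum_comm]
        congr 1
        refine tsum_congr fun m => ?_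
        rw [← ENNReal.tsum_mul_left]
        refine tsum_congr fun k => ?_
        rw [mul_inv, ENNReal.ofReal_mul (inv_nonneg.2 (wt_pos _).le)]
        ring
    _ ≤ energy a * ∑' m, b m ^ 2 * ENNReal.ofReal (432 / R) := by
        gcongr with m; exact lattice_sum_shift_le hR m
    _ = _ := by rw [ENNReal.tsum_mul_right]; ring

/-- Companion estimate with values in L² at the cost of one derivative on `b`: Cauchy–Schwarz with
the product weight wt l·(R²+wt(k-l)), whose inverse is again summed by the shifted lattice sum. -/
lemma tsum_conv_sq_le {R : ℝ} (hR : 1 ≤ R) (a b : (Fin 3 → ℤ) → ENNReal) :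
    ∑' k, conv a b k ^ 2 ≤
      ENNReal.ofReal (432 / R) * (energy a * ∑' k, ENNReal.ofReal (R ^ 2 + wt k) * b k ^ 2) := by
  have h1 : ∀ k, conv a b k ^ 2 ≤ (∑' l, ENNReal.ofReal (wt l) * a l ^ 2 *
      (ENNReal.ofReal (R ^ 2 + wt (k - l)) * b (k - l) ^ 2)) * ENNReal.ofReal (432 / R) :=
    fun k => by
      have hp : ∀ l, 0 < wt l * (R ^ 2 + wt (k - l)) := fun l =>
        mul_pos (wt_pos l) (add_pos_of_nonneg_of_pos (sq_nonneg R) (wt_pos _))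
      refine (tsum_sq_le_weighted _ _ hp).trans (mul_le_mul' (le_of_eq ?_) ?_)
      · refine tsum_congr fun l => ?_
        rw [ENNReal.ofReal_mul (wt_pos l).le]
        ring
      · rw [← (Equiv.subLeft k).tsum_eq]
        refine le_trans (le_of_eq (tsum_congr fun l => ?_)) (lattice_sum_shift_le hR k)
        simp [wt_sub_comm k l]
  refine (ENNReal.tsum_le_tsum h1).trans_eq ?_
  rw [ENNReal.tsum_mul_right, mul_comm, ENNReal.tsum_comm]
  congr 1
  simp only [ENNReal.tsum_mul_left]
  rw [energy, ← ENNReal.tsum_mul_right]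
  refine tsum_congr fun l => ?_
  congr 1
  exact (Equiv.subRight l).tsum_eq fun k => ENNReal.ofReal (R ^ 2 + wt k) * b k ^ 2

end Burgers

end


noncomputable section

namespace Burgers

/-! ### The nonlinearity on the Fourier side -/

/-- The wave number squared. -/
def sqNorm (k : Fin 3 → ℤ) : ℝ := ∑ i, (k i : ℝ) ^ 2

lemma sqNorm_nonneg (k : Fin 3 → ℤ) : 0 ≤ sqNorm k := Finset.sum_nonneg fun _ _ => sq_nonneg _

lemma wt_eq (k : Fin 3 → ℤ) : wt k = 1 + sqNorm k := rfl

/-- The interaction of two Fourier modes in the nonlinearity. -/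
def modeProduct (m : Fin 3 → ℤ) (a b : EuclideanSpace ℂ (Fin 3)) : EuclideanSpace ℂ (Fin 3) :=
  (∑ j, a j * (Complex.I * (m j : ℂ))) • b

/-- The Fourier coefficients of `(a·∇)b`. -/
def nonlin (a b : Coeffs) (k : Fin 3 → ℤ) : EuclideanSpace ℂ (Fin 3) :=
  ∑' l, modeProduct (k - l) (a l) (b (k - l))

/-- The Fourier coefficients of `νΔc - (c·∇)c`. -/
def rhs (ν : ℝ) (c : Coeffs) (k : Fin 3 → ℤ) : EuclideanSpace ℂ (Fin 3) :=
  -((ν * sqNorm k) • c k) - nonlin c c k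

lemma norm_modeProduct_le (m : Fin 3 → ℤ) (a b : EuclideanSpace ℂ (Fin 3)) :
    ‖modeProduct m a b‖ ≤ ‖a‖ * (√(wt m) * ‖b‖) := by
  rw [modeProduct, norm_smul, ← mul_assoc]
  gcongr
  refine (norm_sum_le _ _).trans ?_
  have h : ∀ j, ‖a j * (Complex.I * (m j : ℂ))‖ = ‖a j‖ * |(m j : ℝ)| := fun j => by
    rw [norm_mul, norm_mul, Complex.norm_I, one_mul, Complex.norm_intCast]
  simp only [h]
  refine (Real.sum_mul_le_sqrt_mul_sqrt _ _ _).trans ?_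
  rw [EuclideanSpace.norm_eq]
  gcongr
  simp only [sq_abs, wt]
  linarith

lemma modeProduct_sub_left (m : Fin 3 → ℤ) (a a' b : EuclideanSpace ℂ (Fin 3)) :
    modeProduct m (a - a') b = modeProduct m a b - modeProduct m a' b := by
  simp [modeProduct, sub_mul, Finset.sum_sub_distrib, sub_smul]

lemma modeProduct_sub_right (m : Fin 3 → ℤ) (a b b' : EuclideanSpace ℂ (Fin 3)) :
    modeProduct m a (b - b') = modeProduct m a b - modeProduct m a b' := by
  simp [modeProduct, smul_sub]

lemma _root_.ContinuousOn.modeProduct {X : Type*} [TopologicalSpace X] {s : Set X}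
    {f g : X → EuclideanSpace ℂ (Fin 3)} (hf : ContinuousOn f s) (hg : ContinuousOn g s)
    (m : Fin 3 → ℤ) : ContinuousOn (fun x => modeProduct m (f x) (g x)) s := by
  unfold Burgers.modeProduct
  fun_prop

/-- The absolute values of a family of Fourier coefficients. -/
def absCoeffs (c : Coeffs) (k : Fin 3 → ℤ) : ENNReal := ‖c k‖ₑ

/-- The absolute values of the Fourier coefficients of the gradient, up to lower order. -/
def absGrad (c : Coeffs) (k : Fin 3 → ℤ) : ENNReal := ENNReal.ofReal √(wt k) * ‖c k‖ₑ

lemma enorm_modeProduct_le (m : Fin 3 → ℤ) (a b : EuclideanSpace ℂ (Fin 3)) :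
    ‖modeProduct m a b‖ₑ ≤ ‖a‖ₑ * (ENNReal.ofReal √(wt m) * ‖b‖ₑ) := by
  rw [← ofReal_norm, ← ofReal_norm, ← ofReal_norm, ← ENNReal.ofReal_mul (Real.sqrt_nonneg _),
    ← ENNReal.ofReal_mul (norm_nonneg _)]
  exact ENNReal.ofReal_le_ofReal (norm_modeProduct_le m a b)

lemma enorm_nonlin_le (a b : Coeffs) (k : Fin 3 → ℤ) :
    ‖nonlin a b k‖ₑ ≤ conv (absCoeffs a) (absGrad b) k := by
  by_cases hs : Summable fun l => modeProduct (k - l) (a l) (b (k - l))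
  · exact enorm_tsum_le_tsum_enorm.trans (ENNReal.tsum_le_tsum fun l => enorm_modeProduct_le _ _ _)
  -- A divergent series has the default sum 0, so the bound needs no assumption on `a` and `b`.
  · rw [nonlin, tsum_eq_zero_of_not_summable hs]
    simp

lemma sobolevSq_zero (c : Coeffs) : sobolevSq 0 c = ∑' k, ‖c k‖ₑ ^ 2 := by
  simp [sobolevSq]

lemma sobolevSq_one (c : Coeffs) :
    sobolevSq 1 c = ∑' k, ENNReal.ofReal (wt k) * ‖c k‖ₑ ^ 2 := by
  simp [sobolevSq, wt]

lemma sobolevSq_two (c : Coeffs) :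
    sobolevSq 2 c = ∑' k, ENNReal.ofReal (wt k) ^ 2 * ‖c k‖ₑ ^ 2 := by
  refine tsum_congr fun k => ?_
  rw [← ENNReal.ofReal_pow (wt_pos k).le, Real.rpow_two]
  rfl

lemma energy_absCoeffs (c : Coeffs) : energy (absCoeffs c) = sobolevSq 1 c :=
  (sobolevSq_one c).symm

lemma tsum_absGrad_sq (c : Coeffs) : ∑' k, absGrad c k ^ 2 = sobolevSq 1 c := by
  rw [sobolevSq_one]
  refine tsum_congr fun k => ?_
  rw [absGrad, mul_pow, ofReal_sqrt_sq (wt_pos k).le]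

lemma sobolevSq_mono {s t : ℝ} (h : s ≤ t) (c : Coeffs) : sobolevSq s c ≤ sobolevSq t c :=
  ENNReal.tsum_le_tsum fun k => by
    gcongr
    exact one_le_wt k

lemma enorm_sub_sq_le {E : Type*} [SeminormedAddCommGroup E] (a b : E) :
    ‖a - b‖ₑ ^ 2 ≤ 2 * ‖a‖ₑ ^ 2 + 2 * ‖b‖ₑ ^ 2 := by
  have h : ‖a - b‖ ^ 2 ≤ 2 * ‖a‖ ^ 2 + 2 * ‖b‖ ^ 2 := by
    nlinarith [norm_sub_le a b, norm_nonneg (a - b), sq_nonneg (‖a‖ - ‖b‖), norm_nonneg a,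
      norm_nonneg b]
  simp only [← ofReal_norm]
  rw [← ENNReal.ofReal_pow (norm_nonneg _), ← ENNReal.ofReal_pow (norm_nonneg _),
    ← ENNReal.ofReal_pow (norm_nonneg _), show (2 : ENNReal) = ENNReal.ofReal 2 by simp,
    ← ENNReal.ofReal_mul zero_le_two, ← ENNReal.ofReal_mul zero_le_two,
    ← ENNReal.ofReal_add (by positivity) (by positivity)]
  exact ENNReal.ofReal_le_ofReal h

lemma enorm_add_sq_le {E : Type*} [SeminormedAddCommGroup E] (a b : E) :
    ‖a + b‖ₑ ^ 2 ≤ 2 * ‖a‖ₑ ^ 2 + 2 * ‖b‖ₑ ^ 2 := by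
  simpa using enorm_sub_sq_le a (-b)

lemma sobolevSq_sub_le (s : ℝ) (c d : Coeffs) :
    sobolevSq s (c - d) ≤ 2 * sobolevSq s c + 2 * sobolevSq s d := by
  simp only [sobolevSq, ← ENNReal.tsum_mul_left, ← ENNReal.tsum_add]
  refine ENNReal.tsum_le_tsum fun k => ?_
  refine (mul_le_mul_right (enorm_sub_sq_le (c k) (d k)) _).trans_eq ?_
  ring

lemma summable_of_tsum_enorm_lt_top {ι E : Type*} [NormedAddCommGroup E] [CompleteSpace E]
    {f : ι → E} (h : ∑' i, ‖f i‖ₑ < ⊤) : Summable f := by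
  refine Summable.of_norm ?_
  have := ENNReal.summable_toReal h.ne
  simpa [toReal_enorm] using this

lemma conv_lt_top {a b : Coeffs} (ha : sobolevSq 1 a < ⊤) (hb : sobolevSq 1 b < ⊤)
    (k : Fin 3 → ℤ) : conv (absCoeffs a) (absGrad b) k < ⊤ := by
  have h := tsum_mul_sq_le (absCoeffs a) fun l => absGrad b (k - l)
  have e : ∑' l, absGrad b (k - l) ^ 2 = sobolevSq 1 b := by
    rw [← tsum_absGrad_sq]
    exact (Equiv.subLeft k).tsum_eq fun l => absGrad b l ^ 2
  have e' : ∑' l, absCoeffs a l ^ 2 < ⊤ := by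
    refine lt_of_le_of_lt ?_ ((sobolevSq_mono zero_le_one a).trans_lt ha)
    rw [sobolevSq_zero]
    rfl
  have h2 : conv (absCoeffs a) (absGrad b) k ^ 2 < ⊤ := by
    refine lt_of_le_of_lt h ?_
    rw [e]
    exact ENNReal.mul_lt_top e' hb
  exact (ENNReal.pow_lt_top_iff.1 h2).resolve_right two_ne_zero

lemma summable_modeProduct {a b : Coeffs} (ha : sobolevSq 1 a < ⊤) (hb : sobolevSq 1 b < ⊤)
    (k : Fin 3 → ℤ) : Summable fun l => modeProduct (k - l) (a l) (b (k - l)) :=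
  summable_of_tsum_enorm_lt_top <| lt_of_le_of_lt
    (ENNReal.tsum_le_tsum fun _ => enorm_modeProduct_le _ _ _) (conv_lt_top ha hb k)

lemma nonlin_sub_nonlin {u v : Coeffs} (hu : sobolevSq 1 u < ⊤) (hv : sobolevSq 1 v < ⊤)
    (k : Fin 3 → ℤ) :
    nonlin u u k - nonlin v v k = nonlin (u - v) u k + nonlin v (u - v) k := by
  have hw : sobolevSq 1 (u - v) < ⊤ := (sobolevSq_sub_le 1 u v).trans_lt (by finiteness)
  rw [nonlin, nonlin, nonlin, nonlin, ← (summable_modeProduct hu hu k).tsum_sub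
    (summable_modeProduct hv hv k), ← (summable_modeProduct hw hu k).tsum_add
    (summable_modeProduct hv hw k)]
  refine tsum_congr fun l => ?_
  simp [modeProduct_sub_left, modeProduct_sub_right]

lemma tsum_nonlin_sq_div_le {R : ℝ} (hR : 1 ≤ R) (a b : Coeffs) :
    ∑' k, ENNReal.ofReal (R ^ 2 + wt k)⁻¹ * ‖nonlin a b k‖ₑ ^ 2 ≤
      ENNReal.ofReal (432 / R) * (sobolevSq 1 a * sobolevSq 1 b) := by
  rw [← energy_absCoeffs a, ← tsum_absGrad_sq b]
  refine le_trans ?_ (tsum_conv_sq_div_le hR _ _)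
  gcongr with k
  exact enorm_nonlin_le a b k

/-- The estimate behind the L²(H²) regularity: the H² norm of `b` enters with the factor 432/R,
hence can be absorbed by the dissipation when R is large compared with the H¹ norm of `a`. -/
lemma tsum_nonlin_sq_le {R : ℝ} (hR : 1 ≤ R) (a b : Coeffs) :
    ∑' k, ‖nonlin a b k‖ₑ ^ 2 ≤
      ENNReal.ofReal (432 / R) *
        (sobolevSq 1 a * (ENNReal.ofReal (R ^ 2) * sobolevSq 1 b + sobolevSq 2 b)) := by
  have h : ∑' k, ENNReal.ofReal (R ^ 2 + wt k) * absGrad b k ^ 2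
      = ENNReal.ofReal (R ^ 2) * sobolevSq 1 b + sobolevSq 2 b := by
    rw [sobolevSq_one, sobolevSq_two, ← ENNReal.tsum_mul_left, ← ENNReal.tsum_add]
    refine tsum_congr fun k => ?_
    rw [absGrad, mul_pow, ofReal_sqrt_sq (wt_pos k).le,
      ENNReal.ofReal_add (sq_nonneg R) (wt_pos k).le]
    ring
  rw [← energy_absCoeffs a, ← h]
  refine le_trans ?_ (tsum_conv_sq_le hR _ _)
  gcongr with k
  exact enorm_nonlin_le a b k

/-! ### Dominated families of coefficients -/

/-- `m` is a square summable majorant in `H¹`. -/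
def IsMajorant (m : (Fin 3 → ℤ) → ℝ) : Prop :=
  (∀ k, 0 ≤ m k) ∧ Summable fun k => wt k * m k ^ 2

lemma sobolevSq_one_le_of_norm_le {m : (Fin 3 → ℤ) → ℝ} (hm : IsMajorant m) {c : Coeffs}
    (h : ∀ k, ‖c k‖ ≤ m k) : sobolevSq 1 c ≤ ENNReal.ofReal (∑' k, wt k * m k ^ 2) := by
  rw [sobolevSq_one, ENNReal.ofReal_tsum_of_nonneg
    (fun k => mul_nonneg (wt_pos k).le (sq_nonneg _)) hm.2]
  refine ENNReal.tsum_le_tsum fun k => ?_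
  rw [ENNReal.ofReal_mul (wt_pos k).le, ← ofReal_norm, ← ENNReal.ofReal_pow (norm_nonneg _)]
  gcongr
  exact h k

/-- By xy ≤ x²+y² the convolution terms are dominated by two summable families. The result is the
time-independent Weierstrass majorant for the nonlinearity. -/
lemma IsMajorant.summable_conv {m : (Fin 3 → ℤ) → ℝ} (hm : IsMajorant m) (k : Fin 3 → ℤ) :
    Summable fun l => m l * (√(wt (k - l)) * m (k - l)) := by
  have h1 : Summable fun l => m l ^ 2 := Summable.of_nonneg_of_le (fun _ => sq_nonneg _)
    (fun l => le_mul_of_one_le_left (sq_nonneg _) (one_le_wt l)) hm.2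
  have h2 : Summable fun l => wt (k - l) * m (k - l) ^ 2 :=
    (Equiv.subLeft k).summable_iff.2 hm.2
  refine Summable.of_nonneg_of_le (fun l => mul_nonneg (hm.1 l)
    (mul_nonneg (Real.sqrt_nonneg _) (hm.1 _))) (fun l => ?_) (h1.add h2)
  have := Real.sq_sqrt (wt_pos (k - l)).le
  nlinarith [sq_nonneg (m l - √(wt (k - l)) * m (k - l)), sq_nonneg (m l),
    sq_nonneg (√(wt (k - l)) * m (k - l))]

lemma continuousOn_nonlin {m : (Fin 3 → ℤ) → ℝ} (hm : IsMajorant m) {s : Set ℝ}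
    {c : ℝ → Coeffs} (hc : ∀ k, ContinuousOn (fun t => c t k) s)
    (hb : ∀ t ∈ s, ∀ k, ‖c t k‖ ≤ m k) (k : Fin 3 → ℤ) :
    ContinuousOn (fun t => nonlin (c t) (c t) k) s := by
  have h1 : ∀ l, ContinuousOn (fun t => modeProduct (k - l) (c t l) (c t (k - l))) s := fun l =>
    (hc l).modeProduct (hc (k - l)) (k - l)
  unfold nonlin
  refine continuousOn_tsum h1 (hm.summable_conv k) fun l t ht => ?_
  · refine (norm_modeProduct_le _ _ _).trans ?_
    gcongr
    · exact hm.1 l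
    · exact hb t ht l
    · exact hb t ht _

/-- Solutions of the equation for the Fourier coefficients, continuous with values in `H¹` in
the sense that they have a majorant in `H¹`. -/
structure IsCoeffSolution (ν a b : ℝ) (c : ℝ → Coeffs) : Prop where
  continuousOn : ∀ k, ContinuousOn (fun t => c t k) (Icc a b)
  exists_majorant : ∃ m, IsMajorant m ∧ ∀ t ∈ Icc a b, ∀ k, ‖c t k‖ ≤ m k
  eq : ∀ t ∈ Icc a b, ∀ k, c t k = c a k + ∫ s in a..t, rhs ν (c s) k

lemma IsCoeffSolution.continuousOn_nonlin {ν a b : ℝ} {c : ℝ → Coeffs}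
    (h : IsCoeffSolution ν a b c) (k : Fin 3 → ℤ) :
    ContinuousOn (fun t => nonlin (c t) (c t) k) (Icc a b) := by
  obtain ⟨m, hm, hb⟩ := h.exists_majorant
  exact Burgers.continuousOn_nonlin hm h.continuousOn hb k

lemma IsCoeffSolution.continuousOn_rhs {ν a b : ℝ} {c : ℝ → Coeffs}
    (h : IsCoeffSolution ν a b c) (k : Fin 3 → ℤ) :
    ContinuousOn (fun t => rhs ν (c t) k) (Icc a b) :=
  ((h.continuousOn k).const_smul (ν * sqNorm k)).neg.sub (h.continuousOn_nonlin k)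

end Burgers

end


noncomputable section

namespace Burgers

/-! ### Energy inequalities -/

/-- A primitive of an integrable function is absolutely continuous with derivative `F` almost
everywhere, so the product rule for absolutely continuous functions applies. Continuity of `F`
cannot be asked for: for strong solutions the right-hand side is only integrable in time. -/
lemma intervalIntegral_two_mul_eq_sq_sub {f F : ℝ → ℝ} {a b : ℝ} (hab : a ≤ b)
    (hF : IntervalIntegrable F volume a b) (h : ∀ t ∈ Icc a b, f t = f a + ∫ s in a..t, F s) :
    ∫ s in a..b, 2 * (f s * F s) = f b ^ 2 - f a ^ 2 := by
  set g : ℝ → ℝ := fun t => f a + ∫ s in a..t, F s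
  have hc : AbsolutelyContinuousOnInterval (fun _ : ℝ => f a) a b :=
    ((LipschitzWith.const (f a)).lipschitzOnWith).absolutelyContinuousOnInterval
  have hg : AbsolutelyContinuousOnInterval g a b :=
    hc.add (hF.absolutelyContinuousOnInterval_intervalIntegral left_mem_uIcc)
  have h1 := hg.integral_deriv_mul_eq_sub hg
  have hfg : ∀ t ∈ Icc a b, f t = g t := h
  rw [hfg b (right_mem_Icc.2 hab), hfg a (left_mem_Icc.2 hab), sq, sq, ← h1]
  refine intervalIntegral.integral_congr_ae ?_
  filter_upwards [hF.ae_hasDerivAt_integral] with x hx hxm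
  rw [uIoc_of_le hab] at hxm
  have hx' : HasDerivAt g (F x) x :=
    (hx (by rw [uIcc_of_le hab]; exact Ioc_subset_Icc_self hxm) a left_mem_uIcc).const_add _
  rw [hx'.deriv, hfg x (Ioc_subset_Icc_self hxm)]
  ring

/-- The real part of the Hermitian product is the sum of the products of the six real coordinates,
to each of which the scalar identity applies. -/
lemma integral_two_re_inner_eq {f F : ℝ → EuclideanSpace ℂ (Fin 3)} {a b : ℝ} (hab : a ≤ b)
    (hF : IntervalIntegrable F volume a b) (h : ∀ t ∈ Icc a b, f t = f a + ∫ s in a..t, F s) :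
    ∫ s in a..b, 2 * (inner ℂ (f s) (F s)).re = ‖f b‖ ^ 2 - ‖f a‖ ^ 2 := by
  have key : ∀ L : EuclideanSpace ℂ (Fin 3) →L[ℝ] ℝ,
      IntervalIntegrable (fun s => 2 * (L (f s) * L (F s))) volume a b ∧
      ∫ s in a..b, 2 * (L (f s) * L (F s)) = L (f b) ^ 2 - L (f a) ^ 2 := fun L => by
    have hLF : IntervalIntegrable (fun s => L (F s)) volume a b :=
      ⟨L.integrable_comp hF.1, L.integrable_comp hF.2⟩
    have hL : ∀ t ∈ Icc a b, L (f t) = L (f a) + ∫ s in a..t, L (F s) := fun t ht => by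
      rw [h t ht, map_add, L.intervalIntegral_comp_comm]
      exact hF.mono_set (by rw [uIcc_of_le hab, uIcc_of_le ht.1]; exact Icc_subset_Icc_right ht.2)
    refine ⟨?_, intervalIntegral_two_mul_eq_sq_sub hab hLF hL⟩
    refine (IntervalIntegrable.continuousOn_mul hLF ?_).const_mul 2
    rw [uIcc_of_le hab]
    have := (intervalIntegral.continuousOn_primitive_interval' hLF left_mem_uIcc).const_add (L (f a))
    rw [uIcc_of_le hab] at this
    exact this.congr hL
  set Lr : Fin 3 → EuclideanSpace ℂ (Fin 3) →L[ℝ] ℝ := fun i =>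
    Complex.reCLM.comp ((EuclideanSpace.proj (𝕜 := ℂ) i).restrictScalars ℝ)
  set Li : Fin 3 → EuclideanSpace ℂ (Fin 3) →L[ℝ] ℝ := fun i =>
    Complex.imCLM.comp ((EuclideanSpace.proj (𝕜 := ℂ) i).restrictScalars ℝ)
  have e1 : ∀ x y : EuclideanSpace ℂ (Fin 3), 2 * (inner ℂ x y).re =
      ∑ i, (2 * (Lr i x * Lr i y) + 2 * (Li i x * Li i y)) := fun x y => by
    simp only [PiLp.inner_apply, RCLike.inner_apply, Complex.re_sum, Finset.mul_sum]
    refine Finset.sum_congr rfl fun i _ => ?_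
    simp [Lr, Li]
    ring
  have e2 : ∀ x : EuclideanSpace ℂ (Fin 3), ‖x‖ ^ 2 = ∑ i, (Lr i x ^ 2 + Li i x ^ 2) := fun x => by
    rw [EuclideanSpace.norm_sq_eq]
    refine Finset.sum_congr rfl fun i _ => ?_
    rw [← Complex.normSq_eq_norm_sq, Complex.normSq_apply]
    simp [Lr, Li, sq]
  simp only [e1, e2]
  rw [intervalIntegral.integral_finsetSum fun i _ => (key (Lr i)).1.add (key (Li i)).1,
    ← Finset.sum_sub_distrib]
  refine Finset.sum_congr rfl fun i _ => ?_
  rw [intervalIntegral.integral_add (key (Lr i)).1 (key (Li i)).1, (key (Lr i)).2, (key (Li i)).2]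
  ring

lemma continuousOn_of_eq_add_integral {E : Type*} [NormedAddCommGroup E] [NormedSpace ℝ E]
    {f F : ℝ → E} {a b : ℝ} (hab : a ≤ b)
    (hF : IntervalIntegrable F volume a b) (h : ∀ t ∈ Icc a b, f t = f a + ∫ s in a..t, F s) :
    ContinuousOn f (Icc a b) := by
  have := (intervalIntegral.continuousOn_primitive_interval' hF left_mem_uIcc).const_add (f a)
  rw [uIcc_of_le hab] at this
  exact this.congr h

/-- The energy inequality for one Fourier mode of `f' = -λ f - N`. -/
lemma mode_energy_le {f N : ℝ → EuclideanSpace ℂ (Fin 3)} {a b lam : ℝ} (hab : a ≤ b)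
    (hlam : 0 ≤ lam) (hN : IntervalIntegrable N volume a b)
    (hf : ContinuousOn f (Icc a b))
    (h : ∀ t ∈ Icc a b, f t = f a + ∫ s in a..t, (-(lam • f s) - N s)) :
    ‖f b‖ₑ ^ 2 + ∫⁻ s in Ioc a b, ENNReal.ofReal (2 * lam) * ‖f s‖ₑ ^ 2 ≤
      ‖f a‖ₑ ^ 2 + ∫⁻ s in Ioc a b, 2 * (‖f s‖ₑ * ‖N s‖ₑ) := by
  have hf' : ContinuousOn f (uIcc a b) := by rwa [uIcc_of_le hab]
  have hF : IntervalIntegrable (fun s => -(lam • f s) - N s) volume a b :=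
    (hf'.const_smul lam).neg.intervalIntegrable.sub hN
  have h1 := integral_two_re_inner_eq hab hF h
  have e1 : ∀ s, 2 * (inner ℂ (f s) (-(lam • f s) - N s)).re =
      -(2 * lam * ‖f s‖ ^ 2) - 2 * (inner ℂ (f s) (N s)).re := fun s => by
    rw [inner_sub_right, inner_neg_right, ← Complex.coe_smul, inner_smul_right,
      inner_self_eq_norm_sq_to_K]
    simp only [Complex.sub_re, Complex.neg_re, Complex.re_ofReal_mul, Complex.coe_algebraMap]
    rw [← Complex.ofReal_pow, Complex.ofReal_re]
    ring
  have hi1 : IntervalIntegrable (fun s => 2 * lam * ‖f s‖ ^ 2) volume a b :=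
    (continuousOn_const.mul (hf'.norm.pow 2)).intervalIntegrable
  have hi2 : IntervalIntegrable (fun s => 2 * (‖f s‖ * ‖N s‖)) volume a b :=
    (hN.norm.continuousOn_mul hf'.norm).const_mul 2
  have hi3 : IntervalIntegrable (fun s => 2 * (inner ℂ (f s) (N s)).re) volume a b := by
    refine hi2.mono_fun ?_ ?_
    · rw [uIoc_of_le hab]
      have m1 : AEStronglyMeasurable f (volume.restrict (Ioc a b)) :=
        (hf.mono Ioc_subset_Icc_self).aestronglyMeasurable measurableSet_Ioc
      exact (Complex.continuous_re.comp_aestronglyMeasurable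
        (m1.inner hN.1.aestronglyMeasurable)).const_mul 2
    · refine Eventually.of_forall fun s => ?_
      beta_reduce
      rw [Real.norm_eq_abs, Real.norm_eq_abs, abs_mul, abs_mul, abs_mul, abs_norm, abs_norm]
      gcongr
      exact (Complex.abs_re_le_norm _).trans (norm_inner_le_norm _ _)
  simp only [e1] at h1
  rw [intervalIntegral.integral_sub (f := fun s => -(2 * lam * ‖f s‖ ^ 2)) hi1.neg hi3, intervalIntegral.integral_neg] at h1
  have h2 : -∫ s in a..b, 2 * (inner ℂ (f s) (N s)).re ≤ ∫ s in a..b, 2 * (‖f s‖ * ‖N s‖) := by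
    rw [← intervalIntegral.integral_neg]
    refine intervalIntegral.integral_mono_on hab hi3.neg hi2 fun s _ => ?_
    have := (Complex.abs_re_le_norm (inner ℂ (f s) (N s))).trans (norm_inner_le_norm _ _)
    have := neg_abs_le (inner ℂ (f s) (N s)).re
    linarith
  have h3 : ‖f b‖ ^ 2 + ∫ s in Ioc a b, 2 * lam * ‖f s‖ ^ 2 ≤
      ‖f a‖ ^ 2 + ∫ s in Ioc a b, 2 * (‖f s‖ * ‖N s‖) := by
    rw [← intervalIntegral.integral_of_le hab, ← intervalIntegral.integral_of_le hab]
    linarith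
  have p1 : ∀ s, 0 ≤ 2 * lam * ‖f s‖ ^ 2 := fun s => by positivity
  have p2 : ∀ s, 0 ≤ 2 * (‖f s‖ * ‖N s‖) := fun s => by positivity
  -- From here on in [0,∞], so that the inequality can be summed over all modes without a finiteness
  -- condition.
  have h4 := ENNReal.ofReal_le_ofReal h3
  rw [ENNReal.ofReal_add (sq_nonneg _) (integral_nonneg p1),
    ENNReal.ofReal_add (sq_nonneg _) (integral_nonneg p2),
    ofReal_integral_eq_lintegral_ofReal hi1.1 (Eventually.of_forall p1),
    ofReal_integral_eq_lintegral_ofReal hi2.1 (Eventually.of_forall p2)] at h4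
  simp only [ENNReal.ofReal_mul (show 0 ≤ 2 * lam by positivity), ENNReal.ofReal_pow (norm_nonneg _),
    ENNReal.ofReal_mul zero_le_two, ENNReal.ofReal_mul (norm_nonneg _), ofReal_norm] at h4 ⊢
  simpa using h4

/-- The energy inequality summed over all Fourier modes, with nonnegative weights. -/
lemma weighted_energy_le {f N : ℝ → Coeffs} {a b : ℝ} {lam w : (Fin 3 → ℤ) → ℝ} (hab : a ≤ b)
    (hlam : ∀ k, 0 ≤ lam k) (hN : ∀ k, IntervalIntegrable (fun t => N t k) volume a b)
    (hf : ∀ k, ContinuousOn (fun t => f t k) (Icc a b))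
    (h : ∀ t ∈ Icc a b, ∀ k, f t k = f a k + ∫ s in a..t, (-(lam k • f s k) - N s k)) :
    (∑' k, ENNReal.ofReal (w k) * ‖f b k‖ₑ ^ 2) + ∫⁻ s in Ioc a b,
        ∑' k, ENNReal.ofReal (w k) * (ENNReal.ofReal (2 * lam k) * ‖f s k‖ₑ ^ 2) ≤
      (∑' k, ENNReal.ofReal (w k) * ‖f a k‖ₑ ^ 2) + ∫⁻ s in Ioc a b,
        ∑' k, ENNReal.ofReal (w k) * (2 * (‖f s k‖ₑ * ‖N s k‖ₑ)) := by
  have m1 : ∀ k, AEMeasurable (fun s => ‖f s k‖ₑ) (volume.restrict (Ioc a b)) := fun k =>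
    ((hf k).mono Ioc_subset_Icc_self).aestronglyMeasurable measurableSet_Ioc |>.enorm
  have m2 : ∀ k, AEMeasurable (fun s => ‖N s k‖ₑ) (volume.restrict (Ioc a b)) := fun k =>
    (hN k).1.aestronglyMeasurable.enorm
  -- Tonelli on both sides; afterwards the claim is the one-mode inequality multiplied by the
  -- weight.
  rw [lintegral_tsum (f := fun k s => ENNReal.ofReal (w k) *
      (ENNReal.ofReal (2 * lam k) * ‖f s k‖ₑ ^ 2)) fun k => (((m1 k).pow_const 2).const_mul _).const_mul _,
    lintegral_tsum (f := fun k s => ENNReal.ofReal (w k) * (2 * (‖f s k‖ₑ * ‖N s k‖ₑ)))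
      fun k => (((m1 k).mul (m2 k)).const_mul _).const_mul _,
    ← ENNReal.tsum_add, ← ENNReal.tsum_add]
  refine ENNReal.tsum_le_tsum fun k => ?_
  have e : ∀ φ : ℝ → ENNReal, ∫⁻ s in Ioc a b, ENNReal.ofReal (w k) * φ s =
      ENNReal.ofReal (w k) * ∫⁻ s in Ioc a b, φ s := fun φ =>
    lintegral_const_mul' _ φ ENNReal.ofReal_ne_top
  rw [e fun s => ENNReal.ofReal (2 * lam k) * ‖f s k‖ₑ ^ 2, e fun s => 2 * (‖f s k‖ₑ * ‖N s k‖ₑ),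
    ← mul_add, ← mul_add]
  refine mul_le_mul_right ?_ _
  exact mode_energy_le (f := fun t => f t k) (N := fun t => N t k) hab (hlam k) (hN k) (hf k) fun t ht => h t ht k

/-- Grönwall's inequality in integral form, with an integrable rate and zero initial value. -/
lemma eq_zero_of_le_lintegral_mul {y g : ℝ → ENNReal} {T : ℝ} {B : ENNReal} (hB : B < ⊤)
    (hyB : ∀ t ∈ Icc 0 T, y t ≤ B) (hg : ∫⁻ s in Ioc 0 T, g s < ⊤)
    (hy : ∀ t ∈ Icc 0 T, y t ≤ ∫⁻ s in Ioc 0 t, g s * y s) : ∀ t ∈ Icc 0 T, y t = 0 := by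
  by_contra! hne
  obtain ⟨t₁, ht₁, hyt₁⟩ := hne
  have hT : 0 ≤ T := ht₁.1.trans ht₁.2
  -- The times up to which `y` vanishes. The supremum of this set is shown to lie in it and then to
  -- be exceeded.
  set A : Set ℝ := {t | t ∈ Icc 0 T ∧ ∀ s ∈ Icc 0 t, y s = 0}
  have h0A : (0 : ℝ) ∈ A := by
    refine ⟨left_mem_Icc.2 hT, fun s hs => ?_⟩
    have hs0 : s = 0 := le_antisymm hs.2 hs.1
    subst hs0
    simpa using hy 0 (left_mem_Icc.2 hT)
  have hbdd : BddAbove A := ⟨T, fun t ht => ht.1.2⟩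
  set τ := sSup A
  have hτ0 : 0 ≤ τ := le_csSup hbdd h0A
  have hτt : τ ≤ t₁ := by
    refine csSup_le ⟨0, h0A⟩ fun t ht => ?_
    by_contra! hlt
    exact hyt₁ (ht.2 t₁ ⟨ht₁.1, hlt.le⟩)
  have hlt : ∀ s ∈ Ico 0 τ, y s = 0 := fun s hs => by
    obtain ⟨t, htA, hst⟩ := exists_lt_of_lt_csSup ⟨0, h0A⟩ hs.2
    exact htA.2 s ⟨hs.1, hst.le⟩
  -- At the endpoint τ the hypothesis itself gives y τ = 0, since {τ} is a null set for the
  -- integral.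
  have hle : ∀ s ∈ Icc 0 τ, y s = 0 := fun s hs => by
    rcases hs.2.lt_or_eq with h | h
    · exact hlt s ⟨hs.1, h⟩
    · subst h
      have h1 := hy _ ⟨hs.1, hτt.trans ht₁.2⟩
      have h2 : ∫⁻ s in Ioc 0 τ, g s * y s = ∫⁻ s in Ioo 0 τ, g s * y s :=
        setLIntegral_congr Ioo_ae_eq_Ioc.symm
      rw [h2, setLIntegral_congr_fun measurableSet_Ioo (g := fun _ => 0)
        fun s hs => by simp [hlt s ⟨hs.1.le, hs.2⟩]] at h1
      simpa using h1
  have hτlt : τ < t₁ := hτt.lt_of_ne fun h => hyt₁ (hle _ ⟨ht₁.1, h.symm.le⟩)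
  -- a short interval after `τ` on which the rate has small integral
  obtain ⟨σ, hσ, hσt, hσg⟩ : ∃ σ, τ < σ ∧ σ ≤ t₁ ∧ ∫⁻ s in Ioc τ σ, g s ≤ 2⁻¹ := by
    -- The measure g dt on (0, T] is finite and the half-open intervals (τ, τ + (t₁-τ)/(n+1)] shrink
    -- to the empty set, so their measures tend to 0.
    set μ : Measure ℝ := (volume.restrict (Ioc 0 T)).withDensity g
    have hμ : IsFiniteMeasure μ := isFiniteMeasure_withDensity hg.ne
    have ht : Tendsto (fun n : ℕ => μ (Ioc τ (τ + (t₁ - τ) / (n + 1)))) atTop (𝓝 0) := by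
      have hI : ⋂ n : ℕ, Ioc τ (τ + (t₁ - τ) / ((n : ℝ) + 1)) = ∅ := by
        rw [eq_empty_iff_forall_notMem]
        intro x hx
        rw [mem_iInter] at hx
        have hx0 : 0 < x - τ := sub_pos.2 (hx 0).1
        obtain ⟨n, hn⟩ := exists_nat_gt ((t₁ - τ) / (x - τ))
        have h1 := (hx n).2
        rw [div_lt_iff₀ hx0] at hn
        have h2 : x - τ ≤ (t₁ - τ) / ((n : ℝ) + 1) := by linarith
        rw [le_div_iff₀ (by positivity)] at h2
        nlinarith
      have := tendsto_measure_iInter_atTop (μ := μ)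
        (s := fun n : ℕ => Ioc τ (τ + (t₁ - τ) / ((n : ℝ) + 1)))
        (fun n => measurableSet_Ioc.nullMeasurableSet) (fun m n hmn => by
          refine Ioc_subset_Ioc_right ?_
          have : 0 ≤ t₁ - τ := by linarith
          have : (m : ℝ) ≤ n := by exact_mod_cast hmn
          gcongr) ⟨0, measure_ne_top _ _⟩
      rwa [hI, measure_empty] at this
    obtain ⟨n, hn⟩ := (ht.eventually_lt_const (show (0 : ENNReal) < 2⁻¹ by simp)).exists
    have hpos : 0 < (t₁ - τ) / ((n : ℝ) + 1) := div_pos (by linarith) (by positivity)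
    have hle' : (t₁ - τ) / ((n : ℝ) + 1) ≤ t₁ - τ :=
      div_le_self (by linarith) (by linarith [n.cast_nonneg (α := ℝ)])
    refine ⟨τ + (t₁ - τ) / (n + 1), by linarith, by linarith, ?_⟩
    rw [withDensity_apply _ measurableSet_Ioc, Measure.restrict_restrict measurableSet_Ioc,
      inter_eq_left.2] at hn
    · exact hn.le
    · refine Ioc_subset_Ioc hτ0 ?_
      linarith [ht₁.2]
  -- `y` need not be measurable, so its supremum on the short interval is used. It is finite by the
  -- bound `B` and satisfies S ≤ S/2, hence vanishes.
  set S : ENNReal := ⨆ s ∈ Ioc τ σ, y s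
  have hSB : S ≤ B := iSup₂_le fun s hs => hyB s ⟨hτ0.trans hs.1.le, hs.2.trans (hσt.trans ht₁.2)⟩
  have hS : S ≤ 2⁻¹ * S := by
    refine iSup₂_le fun t ht => ?_
    have ht0 : 0 ≤ t := hτ0.trans ht.1.le
    refine (hy t ⟨ht0, ht.2.trans (hσt.trans ht₁.2)⟩).trans ?_
    rw [← Ioc_union_Ioc_eq_Ioc hτ0 ht.1.le,
      lintegral_union measurableSet_Ioc (Ioc_disjoint_Ioc_of_le le_rfl),
      setLIntegral_congr_fun measurableSet_Ioc (g := fun _ => 0)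
        fun s hs => by simp [hle s ⟨hs.1.le, hs.2⟩], lintegral_zero, zero_add]
    calc ∫⁻ s in Ioc τ t, g s * y s ≤ ∫⁻ s in Ioc τ t, g s * S :=
          setLIntegral_mono' measurableSet_Ioc fun s hs => by
            gcongr
            exact le_iSup₂ (f := fun s (_ : s ∈ Ioc τ σ) => y s) s ⟨hs.1, hs.2.trans ht.2⟩
      _ = (∫⁻ s in Ioc τ t, g s) * S := lintegral_mul_const' _ _ (hSB.trans_lt hB).ne
      _ ≤ 2⁻¹ * S := by
          gcongr
          exact (lintegral_mono_set (Ioc_subset_Ioc_right ht.2)).trans hσg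
  have hS0 : S = 0 := by
    by_contra h
    have h2 : 2⁻¹ * S < 1 * S :=
      ENNReal.mul_lt_mul_left h (hSB.trans_lt hB).ne (by simp [ENNReal.inv_lt_one])
    rw [one_mul] at h2
    exact absurd hS (not_le.2 h2)
  have hσA : σ ∈ A := by
    refine ⟨⟨hτ0.trans hσ.le, hσt.trans ht₁.2⟩, fun s hs => ?_⟩
    rcases le_or_gt s τ with h | h
    · exact hle s ⟨hs.1, h⟩
    · have : y s ≤ S := le_iSup₂ (f := fun s (_ : s ∈ Ioc τ σ) => y s) s ⟨h, hs.2⟩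
      rw [hS0] at this
      exact le_antisymm this bot_le
  exact absurd (le_csSup hbdd hσA) (not_le.2 hσ)

end Burgers

end


noncomputable section

namespace Burgers

/-! ### Uniqueness for the Fourier coefficients -/

lemma two_mul_enorm_mul_le {E F : Type*} [SeminormedAddCommGroup E] [SeminormedAddCommGroup F]
    {q : ℝ} (hq : 0 < q) (x : E) (y : F) :
    2 * (‖x‖ₑ * ‖y‖ₑ) ≤ ENNReal.ofReal q * ‖x‖ₑ ^ 2 + ENNReal.ofReal q⁻¹ * ‖y‖ₑ ^ 2 := by
  have h : 2 * (‖x‖ * ‖y‖) ≤ q * ‖x‖ ^ 2 + q⁻¹ * ‖y‖ ^ 2 := by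
    have e : q * ‖x‖ ^ 2 + q⁻¹ * ‖y‖ ^ 2 - 2 * (‖x‖ * ‖y‖) = q⁻¹ * (q * ‖x‖ - ‖y‖) ^ 2 := by
      field_simp; ring
    have : 0 ≤ q⁻¹ * (q * ‖x‖ - ‖y‖) ^ 2 := by positivity
    linarith
  have h' := ENNReal.ofReal_le_ofReal h
  rw [ENNReal.ofReal_add (by positivity) (by positivity), ENNReal.ofReal_mul zero_le_two,
    ENNReal.ofReal_mul (norm_nonneg _), ENNReal.ofReal_mul hq.le,
    ENNReal.ofReal_mul (inv_nonneg.2 hq.le), ENNReal.ofReal_pow (norm_nonneg _),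
    ENNReal.ofReal_pow (norm_nonneg _), ofReal_norm, ofReal_norm] at h'
  simpa using h'

/-- The inverse length scale at which the nonlinear terms are split in the `L²` estimate for the
difference of two solutions with total `H¹` energy `V`. -/
def splitScale (ν : ℝ) (V : ENNReal) : ℝ := 1 + 3456 * V.toReal / ν ^ 2

/-- Young's inequality in each mode with weight (ν/2)(R²+wt k) yields (ν/2)(R²‖w‖²+‖w‖²_{H¹}) plus
the nonlinear difference in the dual norm. That difference is nonlin(w,u) + nonlin(v,w), so
`tsum_nonlin_sq_div_le` bounds the dual term by another (ν/2)‖w‖²_{H¹} once R is proportional to the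
total H¹ energy V. The remaining factor R² then grows like V², which is why L⁴ in time with values
in H¹ is the right class. -/
lemma tsum_difference_le {ν : ℝ} (hν : 0 < ν) {u v : Coeffs} (hu : sobolevSq 1 u < ⊤)
    (hv : sobolevSq 1 v < ⊤) :
    ∑' k, 2 * (‖(u - v) k‖ₑ * ‖nonlin u u k - nonlin v v k‖ₑ) ≤
      ENNReal.ofReal ν * sobolevSq 1 (u - v) +
        ENNReal.ofReal (ν / 2 * splitScale ν (sobolevSq 1 u + sobolevSq 1 v) ^ 2) *
          sobolevSq 0 (u - v) := by
  set w := u - v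
  set V := sobolevSq 1 u + sobolevSq 1 v
  set R := splitScale ν V
  have hV : V < ⊤ := ENNReal.add_lt_top.2 ⟨hu, hv⟩
  have hR : 1 ≤ R := le_add_of_nonneg_right (by positivity)
  have hRk : ∀ k, 0 < R ^ 2 + wt k := fun k => add_pos_of_nonneg_of_pos (sq_nonneg R) (wt_pos k)
  have hN : ∑' k, ENNReal.ofReal (ν / 2 * (R ^ 2 + wt k))⁻¹ *
      ‖nonlin u u k - nonlin v v k‖ₑ ^ 2 ≤ ENNReal.ofReal (ν / 2) * sobolevSq 1 w := by
    calc _ ≤ ∑' k, ENNReal.ofReal (2 / ν) * (2 * (ENNReal.ofReal (R ^ 2 + wt k)⁻¹ *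
            ‖nonlin w u k‖ₑ ^ 2) + 2 * (ENNReal.ofReal (R ^ 2 + wt k)⁻¹ *
            ‖nonlin v w k‖ₑ ^ 2)) := by
          refine ENNReal.tsum_le_tsum fun k => ?_
          rw [mul_inv, inv_div, ENNReal.ofReal_mul (by positivity), nonlin_sub_nonlin hu hv,
            mul_assoc]
          refine mul_le_mul_right ?_ _
          refine (mul_le_mul_right (enorm_add_sq_le _ _) _).trans_eq ?_
          ring
      _ = ENNReal.ofReal (2 / ν) * (2 * (∑' k, ENNReal.ofReal (R ^ 2 + wt k)⁻¹ *
            ‖nonlin w u k‖ₑ ^ 2) + 2 * (∑' k, ENNReal.ofReal (R ^ 2 + wt k)⁻¹ *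
            ‖nonlin v w k‖ₑ ^ 2)) := by
          rw [ENNReal.tsum_mul_left, ENNReal.tsum_add, ENNReal.tsum_mul_left,
            ENNReal.tsum_mul_left]
      _ ≤ ENNReal.ofReal (2 / ν) * (2 * (ENNReal.ofReal (432 / R) *
            (sobolevSq 1 w * sobolevSq 1 u)) + 2 * (ENNReal.ofReal (432 / R) *
            (sobolevSq 1 v * sobolevSq 1 w))) := by
          gcongr
          · exact tsum_nonlin_sq_div_le hR w u
          · exact tsum_nonlin_sq_div_le hR v w
      _ = ENNReal.ofReal (2 / ν) * 2 * ENNReal.ofReal (432 / R) * V * sobolevSq 1 w := by ring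
      _ ≤ ENNReal.ofReal (ν / 2) * sobolevSq 1 w := by
          refine mul_le_mul_left ?_ _
          rw [← ENNReal.ofReal_toReal hV.ne, show (2 : ENNReal) = ENNReal.ofReal 2 by simp,
            ← ENNReal.ofReal_mul (by positivity), ← ENNReal.ofReal_mul (by positivity),
            ← ENNReal.ofReal_mul (by positivity)]
          apply ENNReal.ofReal_le_ofReal
          -- The requirement is (2/ν)·2·(432/R)·V ≤ ν/2, that is Rν² ≥ 2·1728·V; this determines the
          -- constant in `splitScale`.
          have h : 3456 * V.toReal ≤ R * ν ^ 2 := by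
            have : R * ν ^ 2 = ν ^ 2 + 3456 * V.toReal := by
              simp only [R, splitScale]; field_simp
            nlinarith [sq_nonneg ν]
          have hR0 : 0 < R := by linarith
          have e : 2 / ν * 2 * (432 / R) * V.toReal = 1728 * V.toReal / (ν * R) := by
            field_simp; ring
          rw [e, div_le_div_iff₀ (by positivity) (by positivity)]
          nlinarith
  calc _ ≤ ∑' k, (ENNReal.ofReal (ν / 2 * (R ^ 2 + wt k)) * ‖w k‖ₑ ^ 2 +
        ENNReal.ofReal (ν / 2 * (R ^ 2 + wt k))⁻¹ * ‖nonlin u u k - nonlin v v k‖ₑ ^ 2) :=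
        ENNReal.tsum_le_tsum fun k => two_mul_enorm_mul_le (mul_pos (by positivity) (hRk k)) _ _
    _ ≤ (ENNReal.ofReal (ν / 2 * R ^ 2) * sobolevSq 0 w + ENNReal.ofReal (ν / 2) * sobolevSq 1 w)
        + ENNReal.ofReal (ν / 2) * sobolevSq 1 w := by
        rw [ENNReal.tsum_add]
        refine add_le_add (le_of_eq ?_) hN
        rw [sobolevSq_zero, sobolevSq_one, ← ENNReal.tsum_mul_left, ← ENNReal.tsum_mul_left,
          ← ENNReal.tsum_add]
        refine tsum_congr fun k => ?_
        rw [mul_add, ENNReal.ofReal_add (by positivity) (mul_nonneg (by positivity) (wt_pos k).le),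
          ENNReal.ofReal_mul (q := wt k) (by positivity)]
        ring
    _ = _ := by
        rw [add_assoc, ← add_mul, ← ENNReal.ofReal_add (by positivity) (by positivity), add_halves,
          add_comm]

/-- Solutions of the equation for the Fourier coefficients in the class
`L^∞(0,T;L²) ∩ L⁴(0,T;H¹)`. -/
structure IsWeakCoeffSolution (ν T : ℝ) (c : ℝ → Coeffs) : Prop where
  integrable : ∀ k, IntervalIntegrable (fun s => rhs ν (c s) k) volume 0 T
  eq : ∀ t ∈ Icc 0 T, ∀ k, c t k = c 0 k + ∫ s in 0..t, rhs ν (c s) k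
  bounded : ∃ B < (⊤ : ENNReal), ∀ t ∈ Icc 0 T, sobolevSq 0 (c t) ≤ B
  lintegral_lt_top : ∫⁻ s in Ioc 0 T, sobolevSq 1 (c s) ^ 2 < ⊤

lemma IsWeakCoeffSolution.continuousOn {ν T : ℝ} {c : ℝ → Coeffs} (h : IsWeakCoeffSolution ν T c)
    (k : Fin 3 → ℤ) : ContinuousOn (fun t => c t k) (Icc 0 T) := by
  rcases le_or_gt 0 T with hT | hT
  · exact continuousOn_of_eq_add_integral hT (h.integrable k) fun t ht => h.eq t ht k
  · simp [Icc_eq_empty_of_lt hT]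

lemma aemeasurable_sobolevSq {s : ℝ} {c : ℝ → Coeffs} {μ : Measure ℝ}
    (h : ∀ k, AEStronglyMeasurable (fun t => c t k) μ) :
    AEMeasurable (fun t => sobolevSq s (c t)) μ :=
  AEMeasurable.tsum fun k => ((h k).enorm.pow_const 2).const_mul _

lemma IsWeakCoeffSolution.aestronglyMeasurable {ν T : ℝ} {c : ℝ → Coeffs}
    (h : IsWeakCoeffSolution ν T c) (k : Fin 3 → ℤ) :
    AEStronglyMeasurable (fun t => c t k) (volume.restrict (Ioc 0 T)) :=
  ((h.continuousOn k).mono Ioc_subset_Icc_self).aestronglyMeasurable measurableSet_Ioc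

lemma IsWeakCoeffSolution.mono {ν T T' : ℝ} {c : ℝ → Coeffs} (h : IsWeakCoeffSolution ν T c)
    (hT' : 0 ≤ T') (hT : T' ≤ T) : IsWeakCoeffSolution ν T' c where
  integrable k := (h.integrable k).mono_set (by
    rw [uIcc_of_le hT', uIcc_of_le (hT'.trans hT)]; exact Icc_subset_Icc_right hT)
  eq t ht k := h.eq t ⟨ht.1, ht.2.trans hT⟩ k
  bounded := by
    obtain ⟨B, hB, h⟩ := h.bounded
    exact ⟨B, hB, fun t ht => h t ⟨ht.1, ht.2.trans hT⟩⟩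
  lintegral_lt_top := (lintegral_mono_set (Ioc_subset_Ioc_right hT)).trans_lt h.lintegral_lt_top

lemma sobolevSq_zero_add (c : Coeffs) :
    sobolevSq 1 c = sobolevSq 0 c + ∑' k, ENNReal.ofReal (sqNorm k) * ‖c k‖ₑ ^ 2 := by
  rw [sobolevSq_one, sobolevSq_zero, ← ENNReal.tsum_add]
  refine tsum_congr fun k => ?_
  rw [wt_eq, ENNReal.ofReal_add zero_le_one (sqNorm_nonneg k), ENNReal.ofReal_one, add_mul, one_mul]

lemma le_one_add_sq (x : ENNReal) : x ≤ 1 + x ^ 2 := by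
  rcases le_total x 1 with h | h
  · exact h.trans le_self_add
  · exact (le_self_pow₀ h two_ne_zero).trans le_add_self

lemma sobolevSq_one_lintegral_lt_top {ν T : ℝ} {c : ℝ → Coeffs} (h : IsWeakCoeffSolution ν T c) :
    ∫⁻ s in Ioc 0 T, sobolevSq 1 (c s) < ⊤ := by
  refine (lintegral_mono fun s => le_one_add_sq _).trans_lt ?_
  rw [lintegral_add_left measurable_const]
  refine ENNReal.add_lt_top.2 ⟨?_, h.lintegral_lt_top⟩
  simp

/-- The dissipation 2ν∑|k|²|w_k|² equals 2ν‖w‖²_{H¹} - 2ν‖w‖²_{L²}. Half of its first part absorbs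
the H¹ term of `tsum_difference_le`, and the subtracted L² term reappears as the summand 2ν of the
rate. -/
lemma difference_energy_le {ν T : ℝ} (hν : 0 < ν) (hT : 0 ≤ T) {u v : ℝ → Coeffs}
    (hu : IsWeakCoeffSolution ν T u) (hv : IsWeakCoeffSolution ν T v) (h0 : u 0 = v 0) :
    sobolevSq 0 (u T - v T) ≤ ∫⁻ s in Ioc 0 T, ENNReal.ofReal (2 * ν + ν / 2 *
      splitScale ν (sobolevSq 1 (u s) + sobolevSq 1 (v s)) ^ 2) * sobolevSq 0 (u s - v s) := by
  set w : ℝ → Coeffs := fun s => u s - v s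
  set g : ℝ → ℝ := fun s => ν / 2 * splitScale ν (sobolevSq 1 (u s) + sobolevSq 1 (v s)) ^ 2
  have hg : ∀ s, 0 ≤ g s := fun s => by positivity
  set N : ℝ → Coeffs := fun s k => nonlin (u s) (u s) k - nonlin (v s) (v s) k
  have hwc : ∀ k, ContinuousOn (fun t => w t k) (Icc 0 T) := fun k =>
    (hu.continuousOn k).sub (hv.continuousOn k)
  -- The nonlinear difference is expressed through `rhs`, whose integrability in time is part of the
  -- definition of the class.
  have hNe : ∀ k s, N s k = -(rhs ν (u s) k - rhs ν (v s) k) - (ν * sqNorm k) • w s k :=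
    fun k s => by
      simp only [N, rhs, w, Pi.sub_apply, smul_sub]; abel
  have hN : ∀ k, IntervalIntegrable (fun t => N t k) volume 0 T := fun k => by
    simp only [hNe]
    refine ((hu.integrable k).sub (hv.integrable k)).neg.sub ?_
    refine ContinuousOn.intervalIntegrable ?_
    rw [uIcc_of_le hT]
    exact (hwc k).const_smul (ν * sqNorm k)
  have hmeas : ∀ k, AEStronglyMeasurable (fun t => w t k) (volume.restrict (Ioc 0 T)) := fun k =>
    (hu.aestronglyMeasurable k).sub (hv.aestronglyMeasurable k)
  have h1 := weighted_energy_le (f := w) (N := N) (lam := fun k => ν * sqNorm k) (w := fun _ => 1) hT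
    (fun k => mul_nonneg hν.le (sqNorm_nonneg k)) hN hwc (fun t ht k => by
      have hsub : uIcc 0 t ⊆ uIcc 0 T := by
        rw [uIcc_of_le ht.1, uIcc_of_le hT]; exact Icc_subset_Icc_right ht.2
      have e : ∀ s, -((ν * sqNorm k) • w s k) - N s k = rhs ν (u s) k - rhs ν (v s) k := fun s => by
        rw [hNe]; abel
      simp only [e]
      rw [intervalIntegral.integral_sub ((hu.integrable k).mono_set hsub)
        ((hv.integrable k).mono_set hsub)]
      simp only [w, Pi.sub_apply]
      rw [hu.eq t ht k, hv.eq t ht k, h0]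
      abel)
  have hw0 : w 0 = 0 := sub_eq_zero.2 h0
  simp only [ENNReal.ofReal_one, one_mul, hw0, Pi.zero_apply, enorm_zero, ne_eq, OfNat.ofNat_ne_zero,
    not_false_eq_true, zero_pow, tsum_zero, zero_add] at h1
  rw [← sobolevSq_zero] at h1
  have hw1 : ∫⁻ s in Ioc 0 T, sobolevSq 1 (w s) < ⊤ := by
    refine (lintegral_mono fun s => sobolevSq_sub_le 1 (u s) (v s)).trans_lt ?_
    rw [lintegral_add_left' ((aemeasurable_sobolevSq hu.aestronglyMeasurable).const_mul 2),
      lintegral_const_mul' _ _ (by simp), lintegral_const_mul' _ _ (by simp)]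
    have := sobolevSq_one_lintegral_lt_top hu
    have := sobolevSq_one_lintegral_lt_top hv
    finiteness
  have hm1 : AEMeasurable (fun s => sobolevSq 1 (w s)) (volume.restrict (Ioc 0 T)) :=
    aemeasurable_sobolevSq hmeas
  have hm0 : AEMeasurable (fun s => sobolevSq 0 (w s)) (volume.restrict (Ioc 0 T)) :=
    aemeasurable_sobolevSq hmeas
  have hae : ∀ᵐ s ∂volume.restrict (Ioc 0 T), ∑' k, 2 * (‖w s k‖ₑ * ‖N s k‖ₑ) ≤
      ENNReal.ofReal ν * sobolevSq 1 (w s) + ENNReal.ofReal (g s) * sobolevSq 0 (w s) := by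
    have f1 := ae_lt_top' (aemeasurable_sobolevSq hu.aestronglyMeasurable)
      (sobolevSq_one_lintegral_lt_top hu).ne
    have f2 := ae_lt_top' (aemeasurable_sobolevSq hv.aestronglyMeasurable)
      (sobolevSq_one_lintegral_lt_top hv).ne
    filter_upwards [f1, f2] with s hs1 hs2
    exact tsum_difference_le hν hs1 hs2
  have h2 : sobolevSq 0 (w T) + 2 * ENNReal.ofReal ν * ∫⁻ s in Ioc 0 T, sobolevSq 1 (w s) ≤
      ENNReal.ofReal ν * (∫⁻ s in Ioc 0 T, sobolevSq 1 (w s)) +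
        ∫⁻ s in Ioc 0 T, ENNReal.ofReal (2 * ν + g s) * sobolevSq 0 (w s) := by
    have e1 : ∀ s, 2 * ENNReal.ofReal ν * sobolevSq 1 (w s) =
        2 * ENNReal.ofReal ν * sobolevSq 0 (w s) +
          ∑' k, ENNReal.ofReal (2 * (ν * sqNorm k)) * ‖w s k‖ₑ ^ 2 := fun s => by
      rw [sobolevSq_zero_add, mul_add, ← ENNReal.tsum_mul_left]
      congr 1
      refine tsum_congr fun k => ?_
      rw [ENNReal.ofReal_mul zero_le_two, ENNReal.ofReal_mul hν.le]
      simp only [ENNReal.ofReal_ofNat]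
      ring
    rw [← lintegral_const_mul' _ _ (by finiteness)]
    simp only [e1]
    rw [lintegral_add_left' (hm0.const_mul _), add_left_comm]
    refine (add_le_add le_rfl (h1.trans (lintegral_mono_ae hae))).trans_eq ?_
    have e2 : ∀ s, ENNReal.ofReal (2 * ν + g s) * sobolevSq 0 (w s) =
        2 * ENNReal.ofReal ν * sobolevSq 0 (w s) + ENNReal.ofReal (g s) * sobolevSq 0 (w s) :=
      fun s => by
        rw [ENNReal.ofReal_add (by positivity) (hg s), add_mul, ENNReal.ofReal_mul zero_le_two,
          ENNReal.ofReal_ofNat]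
    simp only [e2]
    rw [lintegral_add_left' (hm1.const_mul _), lintegral_add_left' (hm0.const_mul _),
      lintegral_const_mul' (ENNReal.ofReal ν) _ ENNReal.ofReal_ne_top]
    ring
  have h3 : ENNReal.ofReal ν * (∫⁻ s in Ioc 0 T, sobolevSq 1 (w s)) + sobolevSq 0 (w T) ≤
      ENNReal.ofReal ν * (∫⁻ s in Ioc 0 T, sobolevSq 1 (w s)) +
        ∫⁻ s in Ioc 0 T, ENNReal.ofReal (2 * ν + g s) * sobolevSq 0 (w s) := by
    refine le_trans ?_ h2
    rw [add_comm, two_mul, add_mul]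
    gcongr
    exact le_self_add
  -- Cancellation in [0,∞] requires that the absorbed H¹ integral be finite, which `hw1` provides.
  exact (ENNReal.add_le_add_iff_left (ENNReal.mul_lt_top ENNReal.ofReal_lt_top hw1).ne).1 h3

/-- With x = 3456V/ν² the right side minus the left side is (ν/2)(1-x)². For V = ∞ the right side is
infinite. -/
lemma rate_le (ν : ℝ) (hν : 0 < ν) (V : ENNReal) :
    ENNReal.ofReal (2 * ν + ν / 2 * splitScale ν V ^ 2) ≤
      ENNReal.ofReal (3 * ν) + ENNReal.ofReal (ν * (3456 / ν ^ 2) ^ 2) * V ^ 2 := by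
  rcases eq_or_ne V ⊤ with rfl | hV
  · have : 0 < ν * (3456 / ν ^ 2) ^ 2 := by positivity
    simp [ENNReal.mul_top, this]
  rw [← ENNReal.ofReal_toReal hV, ← ENNReal.ofReal_pow ENNReal.toReal_nonneg,
    ← ENNReal.ofReal_mul (by positivity), ← ENNReal.ofReal_add (by positivity) (by positivity)]
  apply ENNReal.ofReal_le_ofReal
  rw [ENNReal.ofReal_toReal hV, splitScale]
  have e : 3456 * V.toReal / ν ^ 2 = 3456 / ν ^ 2 * V.toReal := by ring
  rw [e, mul_assoc ν, ← mul_pow]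
  nlinarith [mul_nonneg hν.le (sq_nonneg (1 - 3456 / ν ^ 2 * V.toReal))]

/-- Grönwall for the L² energy of the difference: the rate is at most a constant plus a multiple of
V², integrable by the L⁴(H¹) condition, while the L^∞(L²) condition gives the a priori bound that
Grönwall's inequality asks for. -/
theorem IsWeakCoeffSolution.unique {ν T : ℝ} (hν : 0 < ν) {u v : ℝ → Coeffs}
    (hu : IsWeakCoeffSolution ν T u) (hv : IsWeakCoeffSolution ν T v) (h0 : u 0 = v 0) :
    ∀ t ∈ Icc 0 T, u t = v t := by
  obtain ⟨B₁, hB₁, hb₁⟩ := hu.bounded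
  obtain ⟨B₂, hB₂, hb₂⟩ := hv.bounded
  have hz := eq_zero_of_le_lintegral_mul (T := T) (B := 2 * B₁ + 2 * B₂)
    (y := fun t => sobolevSq 0 (u t - v t)) (g := fun s => ENNReal.ofReal (2 * ν + ν / 2 *
      splitScale ν (sobolevSq 1 (u s) + sobolevSq 1 (v s)) ^ 2)) (by finiteness)
    (fun t ht => (sobolevSq_sub_le 0 _ _).trans (by gcongr; exacts [hb₁ t ht, hb₂ t ht])) ?_
    (fun t ht => difference_energy_le hν ht.1 (hu.mono ht.1 ht.2) (hv.mono ht.1 ht.2) h0)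
  · intro t ht
    have h1 := hz t ht
    simp only [sobolevSq_zero, ENNReal.tsum_eq_zero] at h1
    funext k
    have h2 := h1 k
    rw [pow_eq_zero_iff two_ne_zero, enorm_eq_zero, Pi.sub_apply, sub_eq_zero] at h2
    exact h2
  · refine (lintegral_mono fun s => rate_le ν hν _).trans_lt ?_
    rw [lintegral_add_left measurable_const, lintegral_const_mul' _ _ ENNReal.ofReal_ne_top]
    refine ENNReal.add_lt_top.2 ⟨by simp [ENNReal.mul_lt_top_iff],
      ENNReal.mul_lt_top ENNReal.ofReal_lt_top ?_⟩
    have hsq : ∀ x y : ENNReal, (x + y) ^ 2 ≤ 4 * x ^ 2 + 4 * y ^ 2 := fun x y => by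
      rcases le_total x y with h | h
      · calc (x + y) ^ 2 ≤ (y + y) ^ 2 := by gcongr
          _ = 4 * y ^ 2 := by ring
          _ ≤ _ := le_add_self
      · calc (x + y) ^ 2 ≤ (x + x) ^ 2 := by gcongr
          _ = 4 * x ^ 2 := by ring
          _ ≤ _ := le_self_add
    refine (lintegral_mono fun s => hsq _ _).trans_lt ?_
    rw [lintegral_add_left' (((aemeasurable_sobolevSq hu.aestronglyMeasurable).pow_const 2).const_mul 4),
      lintegral_const_mul' _ _ (by simp), lintegral_const_mul' _ _ (by simp)]
    have := hu.lintegral_lt_top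
    have := hv.lintegral_lt_top
    finiteness

lemma IsCoeffSolution.isWeakCoeffSolution {ν T : ℝ} (hT : 0 ≤ T) {c : ℝ → Coeffs}
    (h : IsCoeffSolution ν 0 T c) : IsWeakCoeffSolution ν T c := by
  obtain ⟨m, hm, hb⟩ := h.exists_majorant
  have h1 : ∀ t ∈ Icc 0 T, sobolevSq 1 (c t) ≤ ENNReal.ofReal (∑' k, wt k * m k ^ 2) :=
    fun t ht => sobolevSq_one_le_of_norm_le hm (hb t ht)
  refine ⟨fun k => ?_, h.eq, ⟨_, ENNReal.ofReal_lt_top, fun t ht =>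
    (sobolevSq_mono zero_le_one _).trans (h1 t ht)⟩, ?_⟩
  · refine ContinuousOn.intervalIntegrable ?_
    rw [uIcc_of_le hT]
    exact h.continuousOn_rhs k
  · refine (setLIntegral_mono' (g := fun _ => ENNReal.ofReal (∑' k, wt k * m k ^ 2) ^ 2)
      measurableSet_Ioc fun t ht => ?_).trans_lt ?_
    · gcongr
      exact h1 t (Ioc_subset_Icc_self ht)
    · simp [ENNReal.mul_lt_top_iff]

end Burgers

end


noncomputable section

namespace Burgers

/-! ### Local existence -/

lemma tsum_enorm_sq_eq {ι : Type*} {E : ι → Type*} [∀ i, NormedAddCommGroup (E i)] (x : lp E 2) :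
    ∑' i, ‖x i‖ₑ ^ 2 = ENNReal.ofReal (‖x‖ ^ 2) := by
  have h2 : (0 : ℝ) < (2 : ENNReal).toReal := by simp
  have h := lp.norm_rpow_eq_tsum h2 x
  have hs := (memℓp_gen_iff h2).1 (lp.memℓp x)
  simp only [ENNReal.toReal_ofNat, Real.rpow_ofNat] at h hs
  rw [h, ENNReal.ofReal_tsum_of_nonneg (fun _ => sq_nonneg _) hs]
  refine tsum_congr fun i => ?_
  rw [ENNReal.ofReal_pow (norm_nonneg _), ofReal_norm]

lemma memℓp_two_of_tsum_lt_top {ι : Type*} {E : ι → Type*} [∀ i, NormedAddCommGroup (E i)]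
    {f : ∀ i, E i} (h : ∑' i, ‖f i‖ₑ ^ 2 < ⊤) : Memℓp f 2 := by
  refine memℓp_gen ?_
  simp only [ENNReal.toReal_ofNat, Real.rpow_ofNat]
  have := ENNReal.summable_toReal h.ne
  simpa using this

lemma enorm_tsum_le_of_normed {ι E : Type*} [NormedAddCommGroup E] (f : ι → E) :
    ‖∑' i, f i‖ₑ ≤ ∑' i, ‖f i‖ₑ := enorm_tsum_le_tsum_enorm

section LocalExistence

variable {T : ℝ} (hT : 0 ≤ T)

/-- Convolution in time with `e^{-λt}`. -/
def duhamel (lam : ℝ) (g : C(Icc 0 T, EuclideanSpace ℂ (Fin 3))) :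
    C(Icc 0 T, EuclideanSpace ℂ (Fin 3)) where
  toFun t := Real.exp (-(lam * t)) • ∫ s in 0..(t : ℝ), Real.exp (lam * s) • g (projIcc 0 T hT s)
  continuous_toFun := by
    have h : Continuous fun s : ℝ => Real.exp (lam * s) • g (projIcc 0 T hT s) := by fun_prop
    have h2 := intervalIntegral.continuous_primitive (μ := volume) (fun a b => h.intervalIntegrable a b) 0
    exact (by fun_prop : Continuous fun t : Icc 0 T => Real.exp (-(lam * t))).smul
      (h2.comp continuous_subtype_val)

lemma duhamel_sub (lam : ℝ) (g h : C(Icc 0 T, EuclideanSpace ℂ (Fin 3))) :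
    duhamel hT lam (g - h) = duhamel hT lam g - duhamel hT lam h := by
  ext1 t
  simp only [duhamel, ContinuousMap.coe_mk, ContinuousMap.sub_apply]
  have hc : ∀ g : C(Icc 0 T, EuclideanSpace ℂ (Fin 3)),
      Continuous fun s : ℝ => Real.exp (lam * s) • g (projIcc 0 T hT s) := fun g => by fun_prop
  simp only [smul_sub]
  rw [intervalIntegral.integral_sub ((hc g).intervalIntegrable _ _)
    ((hc h).intervalIntegrable _ _), smul_sub]

lemma mul_exp_integral_le {a t : ℝ} : a * (Real.exp (-(a * t)) * ∫ s in 0..t, Real.exp (a * s)) ≤ 1 := by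
  have h : a * ∫ s in 0..t, Real.exp (a * s) = Real.exp (a * t) - 1 := by
    rw [← intervalIntegral.integral_const_mul]
    simp
  rw [mul_left_comm, h, mul_sub, ← Real.exp_add, neg_add_cancel, Real.exp_zero]
  linarith [Real.exp_pos (-(a * t))]

/-- The kernel e^{-λ(t-s)} is at most e^{-a(t-s)}, whose integral over [0,t] is at most both t and
1/a. The second bound is stated without division because a = 0 occurs for the zero mode. -/
lemma norm_duhamel_le {lam a : ℝ} (ha : 0 ≤ a) (hlam : a ≤ lam)
    (g : C(Icc 0 T, EuclideanSpace ℂ (Fin 3))) :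
    ‖duhamel hT lam g‖ ≤ T * ‖g‖ ∧ a * ‖duhamel hT lam g‖ ≤ ‖g‖ := by
  have hpt : ∀ t : Icc (0 : ℝ) T, ‖duhamel hT lam g t‖ ≤
      (Real.exp (-(a * t)) * ∫ s in 0..(t : ℝ), Real.exp (a * s)) * ‖g‖ := fun t => by
    have ht : (0 : ℝ) ≤ t := t.2.1
    simp only [duhamel, ContinuousMap.coe_mk]
    rw [← intervalIntegral.integral_smul, ← intervalIntegral.integral_const_mul,
      ← intervalIntegral.integral_mul_const]
    refine intervalIntegral.norm_integral_le_of_norm_le ht ?_ ?_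
    · refine Eventually.of_forall fun s hs => ?_
      rw [norm_smul, norm_smul, Real.norm_eq_abs, Real.norm_eq_abs, Real.abs_exp, Real.abs_exp,
        ← mul_assoc, ← Real.exp_add, ← Real.exp_add]
      gcongr ?_ * ?_
      · apply Real.exp_le_exp.2
        nlinarith [hs.2]
      · exact g.norm_coe_le_norm _
    · exact (by fun_prop : Continuous fun s => Real.exp (-(a * t)) * Real.exp (a * s) * ‖g‖)
        |>.intervalIntegrable _ _
  constructor
  · refine (ContinuousMap.norm_le _ (by positivity)).2 fun t => (hpt t).trans ?_
    gcongr
    have ht : (0 : ℝ) ≤ t := t.2.1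
    rw [← intervalIntegral.integral_const_mul]
    calc ∫ s in 0..(t : ℝ), Real.exp (-(a * t)) * Real.exp (a * s) ≤ ∫ s in 0..(t : ℝ), 1 := by
          refine intervalIntegral.integral_mono_on ht
            ((by fun_prop : Continuous fun s => Real.exp (-(a * t)) * Real.exp (a * s)).intervalIntegrable _ _)
            (by simp) fun s hs => ?_
          rw [← Real.exp_add, Real.exp_le_one_iff]
          nlinarith [hs.2]
      _ ≤ T := by simpa using t.2.2
  · rcases ha.eq_or_lt with rfl | ha'
    · simp
    · rw [← le_div_iff₀' ha']
      refine (ContinuousMap.norm_le _ (by positivity)).2 fun t => (hpt t).trans ?_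
      rw [le_div_iff₀' ha', ← mul_assoc]
      exact mul_le_of_le_one_left (norm_nonneg _) mul_exp_integral_le

/-- The decay rate left over for the mode `k` when the weight `e^{νt|k|/2}` is split off. -/
def decay (ν : ℝ) (k : Fin 3 → ℤ) : ℝ := ν * sqNorm k - ν / 2 * maxNorm k

/-- Since |k|_∞ ≤ |k|², half of the viscosity compensates the growth of the analytic weight and the
other half remains for smoothing. -/
lemma half_le_decay {ν : ℝ} (hν : 0 < ν) (k : Fin 3 → ℤ) : ν / 2 * sqNorm k ≤ decay ν k := by
  have := maxNorm_le_sum_sq k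
  rw [decay, sqNorm] at *
  nlinarith

/-- For T = R⁻² the two bounds of `norm_duhamel_le` combine into one. In R² + 1 + |k|² the first two
summands are controlled by the short time and cost 1 each; the third is controlled by the decay and
costs 2/ν. -/
lemma enorm_duhamel_le {ν : ℝ} (hν : 0 < ν) {R : ℝ} (hR : 1 ≤ R) (hTR : T * R ^ 2 = 1)
    (k : Fin 3 → ℤ) (g : C(Icc 0 T, EuclideanSpace ℂ (Fin 3))) :
    ‖duhamel hT (decay ν k) g‖ₑ ≤
      ENNReal.ofReal ((2 + 2 / ν) * (R ^ 2 + wt k)⁻¹) * ‖g‖ₑ := by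
  obtain ⟨h1, h2⟩ := norm_duhamel_le hT (mul_nonneg (half_pos hν).le (sqNorm_nonneg k))
    (half_le_decay hν k) g
  set D := ‖duhamel hT (decay ν k) g‖
  have hp : 0 < R ^ 2 + wt k := add_pos_of_nonneg_of_pos (sq_nonneg R) (wt_pos k)
  have hT1 : T ≤ 1 := by
    have : T * 1 ≤ T * R ^ 2 := by gcongr; exact one_le_pow₀ hR
    linarith
  rw [← ofReal_norm, ← ofReal_norm, ← ENNReal.ofReal_mul (by positivity)]
  apply ENNReal.ofReal_le_ofReal
  rw [← div_eq_mul_inv, div_mul_eq_mul_div, le_div_iff₀ hp, wt_eq]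
  have hg := norm_nonneg g
  have e1 : D * R ^ 2 ≤ ‖g‖ := by
    calc D * R ^ 2 ≤ T * ‖g‖ * R ^ 2 := by gcongr
      _ = (T * R ^ 2) * ‖g‖ := by ring
      _ = ‖g‖ := by rw [hTR, one_mul]
  have e2 : D ≤ ‖g‖ := h1.trans (mul_le_of_le_one_left hg hT1)
  have e3 : D * sqNorm k ≤ 2 / ν * ‖g‖ := by
    have : D * sqNorm k = 2 / ν * (ν / 2 * sqNorm k * D) := by field_simp
    rw [this]
    gcongr
  linarith

/-- The interaction of the modes `l` and `k - l` for the weighted Fourier coefficients. -/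
def weightedTerm (ν : ℝ) (k l : Fin 3 → ℤ)
    (a b : C(Icc 0 T, EuclideanSpace ℂ (Fin 3))) : C(Icc 0 T, EuclideanSpace ℂ (Fin 3)) where
  toFun s := (√(wt k) * (√(wt l))⁻¹ * (√(wt (k - l)))⁻¹ *
    Real.exp (ν / 2 * s * (maxNorm k - maxNorm l - maxNorm (k - l)))) • modeProduct (k - l) (a s) (b s)
  continuous_toFun := by
    have h : Continuous fun s : Icc 0 T => modeProduct (k - l) (a s) (b s) :=
      continuousOn_univ.1 (a.continuous.continuousOn.modeProduct b.continuous.continuousOn (k - l))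
    exact (by fun_prop : Continuous fun s : Icc 0 T => √(wt k) * (√(wt l))⁻¹ * (√(wt (k - l)))⁻¹ *
      Real.exp (ν / 2 * s * (maxNorm k - maxNorm l - maxNorm (k - l)))).smul h

/-- The exponential is at most 1 because |k|_∞ ≤ |l|_∞ + |k-l|_∞. The derivative in `modeProduct`
costs √wt(k-l), exactly the weight divided out of the second factor. -/
lemma norm_weightedTerm_le {ν : ℝ} (hν : 0 < ν) (k l : Fin 3 → ℤ)
    (a b : C(Icc 0 T, EuclideanSpace ℂ (Fin 3))) :
    ‖weightedTerm ν k l a b‖ ≤ √(wt k) * ((√(wt l))⁻¹ * ‖a‖ * ‖b‖) := by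
  refine (ContinuousMap.norm_le _ (by positivity)).2 fun s => ?_
  have hs : (0 : ℝ) ≤ s := s.2.1
  have hk : (maxNorm k : ℝ) - maxNorm l - maxNorm (k - l) ≤ 0 := by
    have h := maxNorm_add_le l (k - l)
    rw [add_sub_cancel] at h
    have h' : (maxNorm k : ℝ) ≤ maxNorm l + maxNorm (k - l) := by exact_mod_cast h
    linarith
  have he : Real.exp (ν / 2 * s * (maxNorm k - maxNorm l - maxNorm (k - l))) ≤ 1 :=
    Real.exp_le_one_iff.2 (mul_nonpos_of_nonneg_of_nonpos (by positivity) hk)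
  have hq : 0 < √(wt (k - l)) := Real.sqrt_pos.2 (wt_pos _)
  simp only [weightedTerm, ContinuousMap.coe_mk]
  rw [norm_smul, Real.norm_of_nonneg (by positivity)]
  calc √(wt k) * (√(wt l))⁻¹ * (√(wt (k - l)))⁻¹ *
        Real.exp (ν / 2 * s * (maxNorm k - maxNorm l - maxNorm (k - l))) *
        ‖modeProduct (k - l) (a s) (b s)‖
      ≤ √(wt k) * (√(wt l))⁻¹ * (√(wt (k - l)))⁻¹ * 1 * (‖a‖ * (√(wt (k - l)) * ‖b‖)) := by
        gcongr
        refine (norm_modeProduct_le _ _ _).trans ?_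
        gcongr
        · exact a.norm_coe_le_norm _
        · exact b.norm_coe_le_norm _
    _ = _ := by field_simp

lemma enorm_weightedTerm_le {ν : ℝ} (hν : 0 < ν) (k l : Fin 3 → ℤ)
    (a b : C(Icc 0 T, EuclideanSpace ℂ (Fin 3))) :
    ‖weightedTerm ν k l a b‖ₑ ≤
      ENNReal.ofReal √(wt k) * (ENNReal.ofReal (√(wt l))⁻¹ * ‖a‖ₑ * ‖b‖ₑ) := by
  have h := ENNReal.ofReal_le_ofReal (norm_weightedTerm_le hν k l a b)
  rwa [ENNReal.ofReal_mul (by positivity), ENNReal.ofReal_mul (by positivity),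
    ENNReal.ofReal_mul (by positivity), ofReal_norm, ofReal_norm, ofReal_norm] at h

lemma weightedTerm_sub (ν : ℝ) (k l : Fin 3 → ℤ)
    (a a' b b' : C(Icc 0 T, EuclideanSpace ℂ (Fin 3))) :
    weightedTerm ν k l a b - weightedTerm ν k l a' b' =
      weightedTerm ν k l (a - a') b + weightedTerm ν k l a' (b - b') := by
  ext1 s
  simp only [weightedTerm, ContinuousMap.sub_apply, ContinuousMap.add_apply, ContinuousMap.coe_mk,
    modeProduct_sub_left, modeProduct_sub_right, smul_sub]
  abel

/-- The space in which the local solution is constructed: square summable families of continuous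
functions of time. -/
abbrev PathSpace (T : ℝ) : Type := lp (fun _ : Fin 3 → ℤ => C(Icc 0 T, EuclideanSpace ℂ (Fin 3))) 2

/-- The nonlinearity for the weighted Fourier coefficients. -/
def weightedNonlin (ν : ℝ) (d : PathSpace T) (k : Fin 3 → ℤ) :
    C(Icc 0 T, EuclideanSpace ℂ (Fin 3)) := ∑' l, weightedTerm ν k l (d l) (d (k - l))

lemma tsum_weighted_sq (d : PathSpace T) :
    energy (fun l => ENNReal.ofReal (√(wt l))⁻¹ * ‖d l‖ₑ) = ENNReal.ofReal (‖d‖ ^ 2) := by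
  rw [← tsum_enorm_sq_eq]
  refine tsum_congr fun l => ?_
  rw [mul_pow, ← mul_assoc, ← Real.sqrt_inv, ofReal_sqrt_sq (inv_nonneg.2 (wt_pos l).le),
    ofReal_mul_ofReal_inv (wt_pos l), one_mul]

lemma tsum_enorm_weightedTerm_le {ν : ℝ} (hν : 0 < ν) (k : Fin 3 → ℤ) (d e : PathSpace T) :
    ∑' l, ‖weightedTerm ν k l (d l) (e (k - l))‖ₑ ≤ ENNReal.ofReal √(wt k) *
      conv (fun l => ENNReal.ofReal (√(wt l))⁻¹ * ‖d l‖ₑ) (fun m => ‖e m‖ₑ) k := by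
  rw [conv, ← ENNReal.tsum_mul_left]
  exact ENNReal.tsum_le_tsum fun l => enorm_weightedTerm_le hν k l _ _

lemma summable_weightedTerm {ν : ℝ} (hν : 0 < ν) (k : Fin 3 → ℤ) (d e : PathSpace T) :
    Summable fun l => weightedTerm ν k l (d l) (e (k - l)) := by
  refine summable_of_tsum_enorm_lt_top ((tsum_enorm_weightedTerm_le hν k d e).trans_lt
    (ENNReal.mul_lt_top ENNReal.ofReal_lt_top ?_))
  have h := tsum_mul_sq_le (fun l => ENNReal.ofReal (√(wt l))⁻¹ * ‖d l‖ₑ)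
    fun l => ‖e (k - l)‖ₑ
  have h1 : ∑' l, ‖e (k - l)‖ₑ ^ 2 = ENNReal.ofReal (‖e‖ ^ 2) := by
    rw [← tsum_enorm_sq_eq]
    exact (Equiv.subLeft k).tsum_eq fun l => ‖e l‖ₑ ^ 2
  have h2 : ∑' l, (ENNReal.ofReal (√(wt l))⁻¹ * ‖d l‖ₑ) ^ 2 ≤ ENNReal.ofReal (‖d‖ ^ 2) := by
    rw [← tsum_weighted_sq]
    refine ENNReal.tsum_le_tsum fun l => le_mul_of_one_le_left zero_le ?_
    exact ENNReal.one_le_ofReal.2 (one_le_wt l)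
  have h3 : conv (fun l => ENNReal.ofReal (√(wt l))⁻¹ * ‖d l‖ₑ) (fun m => ‖e m‖ₑ) k ^ 2 < ⊤ :=
    lt_of_le_of_lt h (ENNReal.mul_lt_top (h2.trans_lt ENNReal.ofReal_lt_top)
      (h1.trans_lt ENNReal.ofReal_lt_top))
  exact (ENNReal.pow_lt_top_iff.1 h3).resolve_right two_ne_zero

lemma enorm_weightedNonlin_sub_le {ν : ℝ} (hν : 0 < ν) (k : Fin 3 → ℤ) (d e : PathSpace T) :
    ‖weightedNonlin ν d k - weightedNonlin ν e k‖ₑ ≤ ENNReal.ofReal √(wt k) *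
      (conv (fun l => ENNReal.ofReal (√(wt l))⁻¹ * ‖(d - e) l‖ₑ) (fun m => ‖d m‖ₑ) k +
        conv (fun l => ENNReal.ofReal (√(wt l))⁻¹ * ‖e l‖ₑ) (fun m => ‖(d - e) m‖ₑ) k) := by
  rw [weightedNonlin, weightedNonlin, ← (summable_weightedTerm hν k d d).tsum_sub
    (summable_weightedTerm hν k e e)]
  simp only [weightedTerm_sub]
  have h1 := summable_weightedTerm hν k (d - e) d
  have h2 := summable_weightedTerm hν k e (d - e)
  refine (congr_arg (fun g : C(Icc 0 T, EuclideanSpace ℂ (Fin 3)) => ‖g‖ₑ)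
    (h1.tsum_add h2)).trans_le ?_
  have hadd : ∀ f g : C(Icc 0 T, EuclideanSpace ℂ (Fin 3)), ‖f + g‖ₑ ≤ ‖f‖ₑ + ‖g‖ₑ :=
    fun f g => enorm_add_le f g
  have hsum : ∀ f : (Fin 3 → ℤ) → C(Icc 0 T, EuclideanSpace ℂ (Fin 3)),
      ‖∑' l, f l‖ₑ ≤ ∑' l, ‖f l‖ₑ := fun f =>
    enorm_tsum_le_of_normed f
  refine (hadd _ _).trans ?_
  rw [mul_add]
  exact add_le_add ((hsum _).trans (tsum_enorm_weightedTerm_le hν k _ _))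
    ((hsum _).trans (tsum_enorm_weightedTerm_le hν k _ _))

/-- Squaring the Duhamel gain gives (R²+wt k)⁻². One power absorbs the output weight wt k; the other
is the weight in `tsum_conv_sq_div_le`, which supplies the small factor 432/R. -/
lemma tsum_duhamel_sub_le {ν : ℝ} (hν : 0 < ν) {R : ℝ} (hR : 1 ≤ R) (hTR : T * R ^ 2 = 1)
    (d e : PathSpace T) :
    ∑' k, ‖duhamel hT (decay ν k) (weightedNonlin ν d k) -
        duhamel hT (decay ν k) (weightedNonlin ν e k)‖ₑ ^ 2 ≤
      ENNReal.ofReal ((2 + 2 / ν) ^ 2 * 2 * (432 / R) * ((‖d‖ ^ 2 + ‖e‖ ^ 2) * ‖d - e‖ ^ 2)) := by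
  set A := conv (fun l => ENNReal.ofReal (√(wt l))⁻¹ * ‖(d - e) l‖ₑ) (fun m => ‖d m‖ₑ)
  set B := conv (fun l => ENNReal.ofReal (√(wt l))⁻¹ * ‖e l‖ₑ) (fun m => ‖(d - e) m‖ₑ)
  set C : ENNReal := ENNReal.ofReal (2 + 2 / ν)
  have hC : 0 ≤ 2 + 2 / ν := by positivity
  have hk : ∀ k, ‖duhamel hT (decay ν k) (weightedNonlin ν d k) -
        duhamel hT (decay ν k) (weightedNonlin ν e k)‖ₑ ^ 2 ≤
      C ^ 2 * (2 * (ENNReal.ofReal (R ^ 2 + wt k)⁻¹ * A k ^ 2) +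
        2 * (ENNReal.ofReal (R ^ 2 + wt k)⁻¹ * B k ^ 2)) := fun k => by
    have hp : 0 < R ^ 2 + wt k := add_pos_of_nonneg_of_pos (sq_nonneg R) (wt_pos k)
    rw [← duhamel_sub]
    have h1 := (enorm_duhamel_le hT hν hR hTR k _).trans
      (mul_le_mul_right (enorm_weightedNonlin_sub_le hν k d e) _)
    have hAB : (A k + B k) ^ 2 ≤ 2 * A k ^ 2 + 2 * B k ^ 2 := by
      have := ENNReal.rpow_add_le_mul_rpow_add_rpow (A k) (B k) (p := 2) (by norm_num)
      norm_num at this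
      rw [← mul_add]
      exact this
    have hw : ENNReal.ofReal (R ^ 2 + wt k)⁻¹ ^ 2 * ENNReal.ofReal (wt k) ≤
        ENNReal.ofReal (R ^ 2 + wt k)⁻¹ := by
      rw [← ENNReal.ofReal_pow (by positivity), ← ENNReal.ofReal_mul (by positivity)]
      apply ENNReal.ofReal_le_ofReal
      rw [sq, mul_assoc]
      refine mul_le_of_le_one_right (by positivity) ?_
      rw [inv_mul_le_one₀ hp]
      nlinarith [sq_nonneg R]
    calc _ ≤ (ENNReal.ofReal ((2 + 2 / ν) * (R ^ 2 + wt k)⁻¹) *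
          (ENNReal.ofReal √(wt k) * (A k + B k))) ^ 2 := by gcongr
      _ = C ^ 2 * ((ENNReal.ofReal (R ^ 2 + wt k)⁻¹ ^ 2 * ENNReal.ofReal (wt k)) *
          (A k + B k) ^ 2) := by
        rw [ENNReal.ofReal_mul hC, ← ofReal_sqrt_sq (wt_pos k).le]
        ring
      _ ≤ C ^ 2 * (ENNReal.ofReal (R ^ 2 + wt k)⁻¹ * (2 * A k ^ 2 + 2 * B k ^ 2)) := by gcongr
      _ = _ := by ring
  refine (ENNReal.tsum_le_tsum hk).trans ?_
  rw [ENNReal.tsum_mul_left, ENNReal.tsum_add, ENNReal.tsum_mul_left, ENNReal.tsum_mul_left]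
  have hA := tsum_conv_sq_div_le hR (fun l => ENNReal.ofReal (√(wt l))⁻¹ * ‖(d - e) l‖ₑ)
    fun m => ‖d m‖ₑ
  have hB := tsum_conv_sq_div_le hR (fun l => ENNReal.ofReal (√(wt l))⁻¹ * ‖e l‖ₑ)
    fun m => ‖(d - e) m‖ₑ
  rw [tsum_weighted_sq, tsum_enorm_sq_eq] at hA hB
  refine (mul_le_mul_right (add_le_add (mul_le_mul_right hA 2) (mul_le_mul_right hB 2))
    (C ^ 2)).trans_eq ?_
  simp only [C]
  rw [← ENNReal.ofReal_pow hC, ENNReal.ofReal_mul (p := (2 + 2 / ν) ^ 2 * 2 * (432 / R)) (by positivity), ENNReal.ofReal_mul (by positivity),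
    ENNReal.ofReal_mul (by positivity), ENNReal.ofReal_mul (by positivity),
    ENNReal.ofReal_add (by positivity) (by positivity), ENNReal.ofReal_ofNat]
  ring

end LocalExistence

end Burgers

end


noncomputable section

namespace Burgers

/-! ### The contraction argument and the return to unweighted coefficients -/

section LocalExistence

variable {T : ℝ} (hT : 0 ≤ T)

/-- The free evolution of the weighted Fourier coefficients. -/
def freePath (T ν : ℝ) (c₀ : Coeffs) (k : Fin 3 → ℤ) : C(Icc 0 T, EuclideanSpace ℂ (Fin 3)) where
  toFun t := (Real.exp (-(decay ν k * t)) * √(wt k)) • c₀ k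
  continuous_toFun := by fun_prop

lemma norm_freePath_le {ν : ℝ} (hν : 0 < ν) (c₀ : Coeffs) (k : Fin 3 → ℤ) :
    ‖freePath T ν c₀ k‖ ≤ √(wt k) * ‖c₀ k‖ := by
  refine (ContinuousMap.norm_le _ (by positivity)).2 fun t => ?_
  have ht : (0 : ℝ) ≤ t := t.2.1
  have hd : 0 ≤ decay ν k := (mul_nonneg (half_pos hν).le (sqNorm_nonneg k)).trans
    (half_le_decay hν k)
  simp only [freePath, ContinuousMap.coe_mk]
  rw [norm_smul, Real.norm_of_nonneg (by positivity)]
  gcongr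
  refine mul_le_of_le_one_left (Real.sqrt_nonneg _) (Real.exp_le_one_iff.2 ?_)
  nlinarith

lemma tsum_freePath_sq_le {ν : ℝ} (hν : 0 < ν) (c₀ : Coeffs) :
    ∑' k, ‖freePath T ν c₀ k‖ₑ ^ 2 ≤ sobolevSq 1 c₀ := by
  rw [sobolevSq_one]
  refine ENNReal.tsum_le_tsum fun k => ?_
  have h := ENNReal.ofReal_le_ofReal (norm_freePath_le (T := T) hν c₀ k)
  rw [ENNReal.ofReal_mul (Real.sqrt_nonneg _), ofReal_norm, ofReal_norm] at h
  calc _ ≤ (ENNReal.ofReal √(wt k) * ‖c₀ k‖ₑ) ^ 2 := by gcongr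
    _ = _ := by rw [mul_pow, ofReal_sqrt_sq (wt_pos k).le]

lemma weightedNonlin_zero (ν : ℝ) (k : Fin 3 → ℤ) : weightedNonlin ν (0 : PathSpace T) k = 0 := by
  rw [weightedNonlin]
  convert tsum_zero with l
  ext1 s
  simp [weightedTerm, modeProduct]

lemma duhamel_zero (lam : ℝ) : duhamel hT lam 0 = 0 := by
  have := duhamel_sub hT lam 0 0
  simpa using this

lemma tsum_duhamel_le {ν : ℝ} (hν : 0 < ν) {R : ℝ} (hR : 1 ≤ R) (hTR : T * R ^ 2 = 1)
    (d : PathSpace T) :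
    ∑' k, ‖duhamel hT (decay ν k) (weightedNonlin ν d k)‖ₑ ^ 2 ≤
      ENNReal.ofReal ((2 + 2 / ν) ^ 2 * 2 * (432 / R) * (‖d‖ ^ 2 * ‖d‖ ^ 2)) := by
  have h := tsum_duhamel_sub_le hT hν hR hTR d 0
  simpa [weightedNonlin_zero, duhamel_zero] using h

/-- The Duhamel term as an element of the path space. -/
def duhamelPath {ν : ℝ} (hν : 0 < ν) {R : ℝ} (hR : 1 ≤ R) (hTR : T * R ^ 2 = 1)
    (d : PathSpace T) : PathSpace T :=
  ⟨fun k => duhamel hT (decay ν k) (weightedNonlin ν d k),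
    memℓp_two_of_tsum_lt_top ((tsum_duhamel_le hT hν hR hTR d).trans_lt ENNReal.ofReal_lt_top)⟩

lemma norm_sq_duhamelPath_sub_le {ν : ℝ} (hν : 0 < ν) {R : ℝ} (hR : 1 ≤ R) (hTR : T * R ^ 2 = 1)
    (d e : PathSpace T) :
    ‖duhamelPath hT hν hR hTR d - duhamelPath hT hν hR hTR e‖ ^ 2 ≤
      (2 + 2 / ν) ^ 2 * 2 * (432 / R) * ((‖d‖ ^ 2 + ‖e‖ ^ 2) * ‖d - e‖ ^ 2) := by
  have hR0 : 0 < R := by linarith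
  rw [← ENNReal.ofReal_le_ofReal_iff (by positivity), ← tsum_enorm_sq_eq]
  exact tsum_duhamel_sub_le hT hν hR hTR d e

lemma norm_sq_duhamelPath_le {ν : ℝ} (hν : 0 < ν) {R : ℝ} (hR : 1 ≤ R) (hTR : T * R ^ 2 = 1)
    (d : PathSpace T) :
    ‖duhamelPath hT hν hR hTR d‖ ^ 2 ≤
      (2 + 2 / ν) ^ 2 * 2 * (432 / R) * (‖d‖ ^ 2 * ‖d‖ ^ 2) := by
  have hR0 : 0 < R := by linarith
  rw [← ENNReal.ofReal_le_ofReal_iff (by positivity), ← tsum_enorm_sq_eq]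
  exact tsum_duhamel_le hT hν hR hTR d

/-- The inverse square root of the existence time for data of size `M`. -/
def existenceScale (ν M : ℝ) : ℝ := 1 + 32 * 864 * (2 + 2 / ν) ^ 2 * M ^ 2

/-- Banach's fixed point theorem in the ball of radius 2M: the free part has norm at most M, and the
Duhamel term maps the ball into that of radius M and is ½-Lipschitz there. -/
lemma exists_weighted_path {ν : ℝ} (hν : 0 < ν) {M : ℝ} (hM : 0 < M)
    (hTR : T * existenceScale ν M ^ 2 = 1) (c₀ : Coeffs)
    (hc₀ : sobolevSq 1 c₀ ≤ ENNReal.ofReal (M ^ 2)) :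
    ∃ d : PathSpace T, ‖d‖ ≤ 2 * M ∧ ∀ k, d k = freePath T ν c₀ k -
      duhamel hT (decay ν k) (weightedNonlin ν d k) := by
  set R := existenceScale ν M
  have hR : 1 ≤ R := le_add_of_nonneg_right (by positivity)
  have hR0 : 0 < R := by linarith
  set q := (2 + 2 / ν) ^ 2 * 2 * (432 / R)
  -- On the ball ‖d‖²+‖e‖² ≤ 8M², so this makes the squared Lipschitz constant at most 1/4. The
  -- factors 32 = 4·8 and 864 = 2·432 of `existenceScale` are chosen for it.
  have hq : q * (8 * M ^ 2) ≤ 1 / 4 := by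
    have e : q * (8 * M ^ 2) = (8 * 864 * (2 + 2 / ν) ^ 2 * M ^ 2) / R := by
      simp only [q]; field_simp; ring
    rw [e, div_le_iff₀ hR0]
    simp only [R, existenceScale]
    nlinarith
  have hq0 : 0 ≤ q := by positivity
  have hfree : ∑' k, ‖freePath T ν c₀ k‖ₑ ^ 2 ≤ ENNReal.ofReal (M ^ 2) :=
    (tsum_freePath_sq_le hν c₀).trans hc₀
  set y : PathSpace T := ⟨fun k => freePath T ν c₀ k,
    memℓp_two_of_tsum_lt_top (hfree.trans_lt ENNReal.ofReal_lt_top)⟩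
  have hy : ‖y‖ ≤ M := by
    refine le_of_sq_le_sq ?_ hM.le
    rw [← ENNReal.ofReal_le_ofReal_iff (by positivity), ← tsum_enorm_sq_eq]
    exact hfree
  set Φ : PathSpace T → PathSpace T := fun d => y - duhamelPath hT hν hR hTR d
  set s : Set (PathSpace T) := Metric.closedBall 0 (2 * M)
  have hs : ∀ d ∈ s, ‖d‖ ≤ 2 * M := fun d hd => mem_closedBall_zero_iff.1 hd
  have hmaps : MapsTo Φ s s := fun d hd => by
    have hd' := hs d hd
    rw [mem_closedBall_zero_iff]
    have h1 : ‖duhamelPath hT hν hR hTR d‖ ≤ M := by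
      refine le_of_sq_le_sq ((norm_sq_duhamelPath_le hT hν hR hTR d).trans ?_) hM.le
      have h4 : ‖d‖ ^ 2 ≤ 4 * M ^ 2 := by nlinarith [norm_nonneg d]
      calc q * (‖d‖ ^ 2 * ‖d‖ ^ 2) ≤ q * ((4 * M ^ 2) * (4 * M ^ 2)) := by gcongr
        _ = q * (8 * M ^ 2) * (2 * M ^ 2) := by ring
        _ ≤ 1 / 4 * (2 * M ^ 2) := by gcongr
        _ ≤ M ^ 2 := by nlinarith [sq_nonneg M]
    calc ‖Φ d‖ ≤ ‖y‖ + ‖duhamelPath hT hν hR hTR d‖ := norm_sub_le _ _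
      _ ≤ 2 * M := by linarith
  have hlip : ∀ d ∈ s, ∀ e ∈ s, ‖Φ d - Φ e‖ ≤ 1 / 2 * ‖d - e‖ := fun d hd e he => by
    have hd' := hs d hd
    have he' := hs e he
    have e1 : Φ d - Φ e = -(duhamelPath hT hν hR hTR d - duhamelPath hT hν hR hTR e) := by
      simp only [Φ]; abel
    rw [e1, norm_neg]
    refine le_of_sq_le_sq ((norm_sq_duhamelPath_sub_le hT hν hR hTR d e).trans ?_) (by positivity)
    have h4 : ‖d‖ ^ 2 ≤ 4 * M ^ 2 := by nlinarith [norm_nonneg d]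
    have h5 : ‖e‖ ^ 2 ≤ 4 * M ^ 2 := by nlinarith [norm_nonneg e]
    calc q * ((‖d‖ ^ 2 + ‖e‖ ^ 2) * ‖d - e‖ ^ 2) ≤ q * ((4 * M ^ 2 + 4 * M ^ 2) * ‖d - e‖ ^ 2) := by
          gcongr
      _ = q * (8 * M ^ 2) * ‖d - e‖ ^ 2 := by ring
      _ ≤ 1 / 4 * ‖d - e‖ ^ 2 := by gcongr
      _ = _ := by ring
  have hcontr : ContractingWith (1 / 2) (hmaps.restrict Φ s s) := by
    refine ⟨by norm_num, LipschitzWith.of_dist_le_mul fun d e => ?_⟩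
    rw [Subtype.dist_eq, Subtype.dist_eq, dist_eq_norm, dist_eq_norm]
    simpa using hlip d d.2 e e.2
  obtain ⟨d, hds, hd, -⟩ := hcontr.exists_fixedPoint' (x := 0)
    Metric.isClosed_closedBall.isComplete hmaps (Metric.mem_closedBall_self (by positivity))
    (edist_ne_top _ _)
  refine ⟨d, hs d hds, fun k => ?_⟩
  have hd' : Φ d = d := hd
  conv_lhs => rw [← hd']
  rfl

/-- The Fourier coefficients belonging to a weighted path. -/
def pathCoeffs (ν : ℝ) (d : PathSpace T) (t : ℝ) : Coeffs := fun k =>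
  (Real.exp (-(ν / 2 * maxNorm k * t)) * (√(wt k))⁻¹) • d k (projIcc 0 T hT t)

lemma norm_pathCoeffs_le (ν : ℝ) (d : PathSpace T) (t : ℝ) (k : Fin 3 → ℤ) :
    ‖pathCoeffs hT ν d t k‖ ≤ Real.exp (-(ν / 2 * maxNorm k * t)) * ((√(wt k))⁻¹ * ‖d k‖) := by
  rw [pathCoeffs, norm_smul, Real.norm_of_nonneg (by positivity), mul_assoc]
  gcongr
  exact (d k).norm_coe_le_norm _

lemma isMajorant_path (d : PathSpace T) : IsMajorant fun k => (√(wt k))⁻¹ * ‖d k‖ := by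
  refine ⟨fun k => by positivity, ?_⟩
  have h := lp.memℓp d
  rw [memℓp_gen_iff (by simp)] at h
  simp only [ENNReal.toReal_ofNat, Real.rpow_ofNat] at h
  refine h.congr fun k => ?_
  rw [mul_pow, inv_pow, Real.sq_sqrt (wt_pos k).le, ← mul_assoc, mul_inv_cancel₀ (wt_pos k).ne',
    one_mul]

/-- The weights in `weightedTerm` are those that turn products of weighted coefficients into the
weighted product: removing them recovers the true nonlinearity. -/
lemma weightedNonlin_apply {ν : ℝ} (hν : 0 < ν) (d : PathSpace T) (k : Fin 3 → ℤ) (t : Icc 0 T) :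
    weightedNonlin ν d k t = (√(wt k) * Real.exp (ν / 2 * maxNorm k * t)) •
      nonlin (pathCoeffs hT ν d t) (pathCoeffs hT ν d t) k := by
  have h := (summable_weightedTerm hν k d d)
  rw [weightedNonlin, nonlin, ← tsum_const_smul'']
  refine (ContinuousMap.tsum_apply h t).symm.trans (tsum_congr fun l => ?_)
  simp only [weightedTerm, ContinuousMap.coe_mk, pathCoeffs, projIcc_val]
  have hm : ∀ (m : Fin 3 → ℤ) (x y : ℝ) (a b : EuclideanSpace ℂ (Fin 3)),
      modeProduct m (x • a) (y • b) = (x * y) • modeProduct m a b := fun m x y a b => by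
    simp only [modeProduct, PiLp.smul_apply, smul_mul_assoc, ← Finset.smul_sum]
    rw [smul_assoc, smul_comm _ y b, smul_smul]
  rw [hm, smul_smul]
  congr 1
  have e : Real.exp (ν / 2 * t * (maxNorm k - maxNorm l - maxNorm (k - l))) =
      Real.exp (ν / 2 * maxNorm k * t) * Real.exp (-(ν / 2 * maxNorm l * t)) *
        Real.exp (-(ν / 2 * maxNorm (k - l) * t)) := by
    rw [← Real.exp_add, ← Real.exp_add]
    congr 1
    ring
  rw [e]
  ring

/-- The rates add up: ν|k|_∞/2 from the weight and `decay` from the Duhamel kernel give the full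
heat rate ν|k|². -/
lemma pathCoeffs_mild {ν : ℝ} (hν : 0 < ν) {d : PathSpace T} {c₀ : Coeffs}
    (hd : ∀ k, d k = freePath T ν c₀ k - duhamel hT (decay ν k) (weightedNonlin ν d k))
    (k : Fin 3 → ℤ) {t : ℝ} (ht : t ∈ Icc 0 T) :
    pathCoeffs hT ν d t k = Real.exp (-(ν * sqNorm k * t)) • (c₀ k - ∫ s in 0..t,
      Real.exp (ν * sqNorm k * s) • nonlin (pathCoeffs hT ν d s) (pathCoeffs hT ν d s) k) := by
  have hp : projIcc 0 T hT t = ⟨t, ht⟩ := projIcc_of_mem hT ht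
  have hw : 0 < √(wt k) := Real.sqrt_pos.2 (wt_pos k)
  have hint : ∫ s in 0..t, Real.exp (decay ν k * s) • weightedNonlin ν d k (projIcc 0 T hT s) =
      √(wt k) • ∫ s in 0..t,
      Real.exp (ν * sqNorm k * s) • nonlin (pathCoeffs hT ν d s) (pathCoeffs hT ν d s) k := by
    rw [← intervalIntegral.integral_smul]
    refine intervalIntegral.integral_congr fun s hs => ?_
    rw [uIcc_of_le ht.1] at hs
    have hs' : s ∈ Icc 0 T := ⟨hs.1, hs.2.trans ht.2⟩
    beta_reduce
    rw [projIcc_of_mem hT hs', weightedNonlin_apply hT hν, smul_smul, smul_smul]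
    congr 1
    rw [mul_left_comm, ← Real.exp_add, decay]
    congr 2
    ring
  rw [pathCoeffs, hp, hd k]
  simp only [ContinuousMap.sub_apply, freePath, duhamel, ContinuousMap.coe_mk]
  rw [hint, smul_sub, smul_sub, smul_smul, smul_smul, smul_smul]
  have e : Real.exp (-(ν / 2 * maxNorm k * t)) * Real.exp (-(decay ν k * t)) =
      Real.exp (-(ν * sqNorm k * t)) := by
    rw [← Real.exp_add, decay]
    congr 1
    ring
  congr 2
  · rw [← e]; field_simp
  · rw [← e]; field_simp

/-- Variation of constants read backwards: the formula is differentiated and integrated again.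
Extending `n` beyond [0,T] by its boundary values makes the formula differentiable on the whole
line, so that endpoints need no separate treatment. -/
lemma eq_add_integral_of_mild {f : ℝ → EuclideanSpace ℂ (Fin 3)} {x : EuclideanSpace ℂ (Fin 3)}
    {n : ℝ → EuclideanSpace ℂ (Fin 3)} {lam : ℝ} (hn : ContinuousOn n (Icc 0 T))
    (hf : ∀ t ∈ Icc 0 T, f t = Real.exp (-(lam * t)) • (x - ∫ s in 0..t, Real.exp (lam * s) • n s)) :
    ∀ t ∈ Icc 0 T, f t = f 0 + ∫ s in 0..t, (-(lam • f s) - n s) := by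
  intro t ht
  have hT' : 0 ≤ T := ht.1.trans ht.2
  set n' : ℝ → EuclideanSpace ℂ (Fin 3) := fun s => n (projIcc 0 T hT' s)
  have hn' : Continuous n' :=
    (continuousOn_iff_continuous_domRestrict.1 hn).comp continuous_projIcc
  have hnn : ∀ s ∈ Icc 0 T, n' s = n s := fun s hs => by simp only [n', projIcc_of_mem hT' hs]
  have hc : Continuous fun s => Real.exp (lam * s) • n' s :=
    (by fun_prop : Continuous fun s : ℝ => Real.exp (lam * s)).smul hn'
  set F : ℝ → EuclideanSpace ℂ (Fin 3) := fun t =>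
    Real.exp (-(lam * t)) • (x - ∫ s in 0..t, Real.exp (lam * s) • n' s)
  have hF : ∀ s ∈ Icc 0 T, f s = F s := fun s hs => by
    rw [hf s hs]
    simp only [F]
    congr 2
    refine intervalIntegral.integral_congr fun r hr => ?_
    rw [uIcc_of_le hs.1] at hr
    beta_reduce
    rw [hnn r ⟨hr.1, hr.2.trans hs.2⟩]
  have hd : ∀ s, HasDerivAt F (-(lam • F s) - n' s) s := fun s => by
    have h1 : HasDerivAt (fun t => Real.exp (-(lam * t))) (Real.exp (-(lam * s)) * -lam) s := by
      simpa using ((hasDerivAt_id s).const_mul lam).neg.exp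
    have h2 := (hc.integral_hasStrictDerivAt 0 s).hasDerivAt.const_sub x
    refine (h1.smul h2).congr_deriv ?_
    simp only [F]
    rw [smul_neg, smul_smul, ← Real.exp_add, neg_add_cancel, Real.exp_zero, one_smul, mul_comm,
      mul_smul, neg_smul]
    abel
  have hFc : Continuous F := continuous_iff_continuousAt.2 fun s => (hd s).continuousAt
  have h3 := intervalIntegral.integral_eq_sub_of_hasDerivAt (a := 0) (b := t) (fun s _ => hd s)
    (((hFc.const_smul lam).neg.sub hn').intervalIntegrable _ _)
  rw [hF t ht, hF 0 (left_mem_Icc.2 hT'), ← sub_eq_iff_eq_add', ← h3]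
  refine intervalIntegral.integral_congr fun s hs => ?_
  rw [uIcc_of_le ht.1] at hs
  have hs' : s ∈ Icc 0 T := ⟨hs.1, hs.2.trans ht.2⟩
  beta_reduce
  rw [hF s hs', hnn s hs']

end LocalExistence

/-- Local existence, with an analytic smoothing estimate. -/
theorem exists_local_solution {ν : ℝ} (hν : 0 < ν) {M : ℝ} (hM : 0 < M) :
    ∃ δ, 0 < δ ∧ ∀ c₀ : Coeffs, sobolevSq 1 c₀ ≤ ENNReal.ofReal (M ^ 2) →
      ∃ c : ℝ → Coeffs, c 0 = c₀ ∧ IsCoeffSolution ν 0 δ c ∧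
        ∀ t ∈ Icc 0 δ, ∀ k, ‖c t k‖ ≤ Real.exp (-(ν / 2 * maxNorm k * t)) * (2 * M) := by
  set R := existenceScale ν M
  have hR : 1 ≤ R := le_add_of_nonneg_right (by positivity)
  have hR0 : 0 < R := by linarith
  have hδ : 0 < (R ^ 2)⁻¹ := by positivity
  refine ⟨(R ^ 2)⁻¹, hδ, fun c₀ hc₀ => ?_⟩
  obtain ⟨d, hdM, hd⟩ := exists_weighted_path hδ.le hν hM
    (inv_mul_cancel₀ (by positivity : R ^ 2 ≠ 0)) c₀ hc₀
  have hmild := fun k t (ht : t ∈ Icc 0 (R ^ 2)⁻¹) => pathCoeffs_mild hδ.le hν hd k ht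
  have hcont : ∀ k, Continuous fun t => pathCoeffs hδ.le ν d t k := fun k => by
    unfold pathCoeffs
    exact (by fun_prop : Continuous fun t : ℝ =>
      Real.exp (-(ν / 2 * maxNorm k * t)) * (√(wt k))⁻¹).smul
        ((d k).continuous.comp continuous_projIcc)
  have hmaj := isMajorant_path d
  -- Suprema in time are taken inside the ℓ² norm of the path space, so the modes have one H¹
  -- majorant for all times, the initial time included.
  have hle : ∀ t ∈ Icc 0 (R ^ 2)⁻¹, ∀ k,
      ‖pathCoeffs hδ.le ν d t k‖ ≤ (√(wt k))⁻¹ * ‖d k‖ := fun t ht k => by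
    refine (norm_pathCoeffs_le hδ.le ν d t k).trans (mul_le_of_le_one_left (by positivity) ?_)
    rw [Real.exp_le_one_iff, neg_nonpos]
    have := ht.1
    positivity
  refine ⟨pathCoeffs hδ.le ν d, ?_, ⟨fun k => (hcont k).continuousOn, ⟨_, hmaj, hle⟩,
    fun t ht k => ?_⟩, fun t ht k => ?_⟩
  · funext k
    rw [hmild k 0 (left_mem_Icc.2 hδ.le)]
    simp
  · exact eq_add_integral_of_mild (f := fun t => pathCoeffs hδ.le ν d t k)
      (continuousOn_nonlin hmaj (fun k => (hcont k).continuousOn) hle k) (hmild k) t ht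
  · refine (norm_pathCoeffs_le hδ.le ν d t k).trans ?_
    refine mul_le_mul_of_nonneg_left ?_ (Real.exp_pos _).le
    have h1 : (√(wt k))⁻¹ ≤ 1 := inv_le_one_of_one_le₀ (Real.one_le_sqrt.2 (one_le_wt k))
    have h2 := lp.norm_apply_le_norm two_ne_zero d k
    calc (√(wt k))⁻¹ * ‖d k‖ ≤ 1 * (2 * M) := by gcongr; exact h2.trans hdM
      _ = _ := one_mul _

end Burgers

end


noncomputable section

namespace Burgers

/-! ### Fourier series on the torus -/

open scoped ComplexConjugate

/-- The volume of the torus. -/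
abbrev vol : ℝ := (2 * Real.pi) ^ 3

lemma vol_pos : 0 < vol := by positivity

/-- The characters as continuous functions. -/
def charC (k : Fin 3 → ℤ) : C(T3, ℂ) where
  toFun := character k
  continuous_toFun := by unfold character; fun_prop

@[simp] lemma charC_apply (k : Fin 3 → ℤ) (x : T3) : charC k x = character k x := rfl

lemma continuous_character (k : Fin 3 → ℤ) : Continuous (character k) := (charC k).continuous

lemma character_neg (k : Fin 3 → ℤ) (x : T3) : character (-k) x = conj (character k x) := by
  simp only [character, Pi.neg_apply, fourier_neg, map_prod]

lemma character_add (k l : Fin 3 → ℤ) (x : T3) :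
    character (k + l) x = character k x * character l x := by
  simp only [character, Pi.add_apply, fourier_add, ← Finset.prod_mul_distrib]

lemma character_zero (x : T3) : character 0 x = 1 := by simp [character]

@[simp] lemma norm_character (k : Fin 3 → ℤ) (x : T3) : ‖character k x‖ = 1 := by
  simp only [character, norm_prod, fourier_apply, Circle.norm_coe, Finset.prod_const_one]

lemma integral_fourier (n : ℤ) :
    ∫ x : AddCircle (2 * Real.pi), fourier n x = if n = 0 then ((2 * Real.pi : ℝ) : ℂ) else 0 := by
  have h := orthonormal_iff_ite.1 (orthonormal_fourier (T := 2 * Real.pi)) 0 n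
  have h2 : ∫ x : AddCircle (2 * Real.pi), fourier n x ∂AddCircle.haarAddCircle =
      if 0 = n then 1 else 0 := by
    rw [← h, ContinuousMap.inner_toLp]
    simp
  rw [AddCircle.volume_eq_smul_haarAddCircle, integral_smul_measure, h2,
    ENNReal.toReal_ofReal Real.two_pi_pos.le]
  by_cases hn : n = 0
  · simp [hn]
  · simp [hn, Ne.symm hn]

lemma integral_character (k : Fin 3 → ℤ) :
    ∫ x : T3, character k x = if k = 0 then (vol : ℂ) else 0 := by
  unfold character
  rw [integral_fintype_prod_volume_eq_prod (fun i => fun x : AddCircle (2 * Real.pi) =>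
    (fourier (k i) x : ℂ))]
  simp only [integral_fourier]
  split_ifs with h
  · subst h
    simp [vol]
  · obtain ⟨i, hi⟩ := Function.ne_iff.mp h
    exact Finset.prod_eq_zero (Finset.mem_univ i) (if_neg hi)

/-- The trigonometric polynomials. -/
def charSubalgebra : StarSubalgebra ℂ C(T3, ℂ) where
  toSubalgebra := Algebra.adjoin ℂ (range charC)
  star_mem' := by
    change Algebra.adjoin ℂ (range charC) ≤ star (Algebra.adjoin ℂ (range charC))
    refine Algebra.adjoin_le ?_
    rintro _ ⟨n, rfl⟩
    refine Algebra.subset_adjoin ⟨-n, ?_⟩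
    ext1 x
    simp only [charC_apply, character_neg, starRingEnd_apply, ContinuousMap.star_apply]

lemma charSubalgebra_coe :
    charSubalgebra.toSubalgebra.toSubmodule = Submodule.span ℂ (range charC) := by
  apply Algebra.adjoin_eq_span_of_subset
  refine .trans (fun x ↦ Submonoid.closure_induction (fun _ ↦ id) ⟨0, ?_⟩ ?_)
    Submodule.subset_span
  · ext z
    simp [character_zero]
  · rintro _ _ _ _ ⟨m, rfl⟩ ⟨n, rfl⟩
    refine ⟨m + n, ?_⟩
    ext z
    simp [character_add]

lemma character_single (x : T3) (i : Fin 3) :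
    character (Pi.single i 1) x = fourier 1 (x i) := by
  rw [character, Finset.prod_eq_single i]
  · rw [Pi.single_eq_same]
  · intro j _ hj
    rw [Pi.single_eq_of_ne hj, fourier_zero]
  · simp

lemma charSubalgebra_separatesPoints : charSubalgebra.SeparatesPoints := by
  intro x y hxy
  obtain ⟨i, hi⟩ := Function.ne_iff.mp hxy
  refine ⟨_, ⟨charC (Pi.single i 1), Algebra.subset_adjoin ⟨Pi.single i 1, rfl⟩, rfl⟩, ?_⟩
  beta_reduce
  rw [charC_apply, charC_apply, character_single, character_single, fourier_one, fourier_one]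
  exact fun h => hi (AddCircle.injective_toCircle Real.two_pi_pos.ne' (Circle.ext h))

/-- Stone–Weierstrass for the trigonometric polynomials. Density in the continuous functions gives
density in L², hence completeness of the characters. -/
lemma span_charC_closure_eq_top :
    (Submodule.span ℂ (range charC)).topologicalClosure = ⊤ := by
  rw [← charSubalgebra_coe]
  exact congr_arg (Subalgebra.toSubmodule <| StarSubalgebra.toSubalgebra ·)
    (ContinuousMap.starSubalgebra_topologicalClosure_eq_top_of_separatesPoints _
      charSubalgebra_separatesPoints)

/-- The characters in `L²`, normalized. -/
def charLp (k : Fin 3 → ℤ) : Lp ℂ 2 (volume : Measure T3) :=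
  ((√vol : ℝ) : ℂ)⁻¹ • ContinuousMap.toLp (E := ℂ) 2 volume ℂ (charC k)

lemma span_charLp_closure_eq_top :
    (Submodule.span ℂ (range charLp)).topologicalClosure = ⊤ := by
  have h : (Submodule.span ℂ (range fun k =>
      ContinuousMap.toLp (E := ℂ) 2 (volume : Measure T3) ℂ (charC k))).topologicalClosure = ⊤ := by
    simpa only [Submodule.map_span, ContinuousLinearMap.coe_coe, ← range_comp, Function.comp_def]
      using (ContinuousMap.toLp_denseRange ℂ (volume : Measure T3) ℂ (p := 2)
        (by simp)).topologicalClosure_map_submodule span_charC_closure_eq_top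
  rw [eq_top_iff, ← h]
  refine Submodule.topologicalClosure_mono (Submodule.span_le.2 ?_)
  rintro _ ⟨k, rfl⟩
  have hv : ((√vol : ℝ) : ℂ) ≠ 0 := by
    exact_mod_cast (Real.sqrt_pos.2 vol_pos).ne'
  have := Submodule.smul_mem _ ((√vol : ℝ) : ℂ) (Submodule.subset_span (R := ℂ) (mem_range_self
    (f := charLp) k))
  rw [charLp, smul_smul, mul_inv_cancel₀ hv, one_smul] at this
  exact this

lemma inner_charLp (k l : Fin 3 → ℤ) :
    inner ℂ (charLp k) (charLp l) = if k = l then 1 else 0 := by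
  have hv : ((√vol : ℝ) : ℂ) ≠ 0 := by
    exact_mod_cast (Real.sqrt_pos.2 vol_pos).ne'
  have hv2 : ((√vol : ℝ) : ℂ) * ((√vol : ℝ) : ℂ) = (vol : ℂ) := by
    rw [← Complex.ofReal_mul, Real.mul_self_sqrt vol_pos.le]
  rw [charLp, charLp, inner_smul_left, inner_smul_right, ContinuousMap.inner_toLp]
  have e : ∀ x : T3, charC l x * (starRingEnd ℂ) (charC k x) = character (l + -k) x := fun x => by
    rw [charC_apply, charC_apply, character_add, character_neg]
  simp only [e, integral_character, map_inv₀, Complex.conj_ofReal]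
  by_cases h : k = l
  · subst h
    simp only [add_neg_cancel, if_true]
    rw [← hv2]
    field_simp
  · rw [if_neg h, if_neg]
    · simp
    · rw [← sub_eq_add_neg, sub_eq_zero]; exact Ne.symm h

/-- The Hilbert basis of characters. -/
def charBasis : HilbertBasis (Fin 3 → ℤ) ℂ (Lp ℂ 2 (volume : Measure T3)) :=
  HilbertBasis.mk (orthonormal_iff_ite.2 inner_charLp) span_charLp_closure_eq_top.ge

/-- The Fourier coefficients of a complex function. -/
def scalarCoeff (f : T3 → ℂ) (k : Fin 3 → ℤ) : ℂ := (vol : ℂ)⁻¹ * ∫ x, character (-k) x * f x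

lemma scalarCoeff_congr {f g : T3 → ℂ} (h : f =ᵐ[volume] g) : scalarCoeff f = scalarCoeff g := by
  funext k
  rw [scalarCoeff, scalarCoeff]
  congr 1
  refine integral_congr_ae ?_
  filter_upwards [h] with x hx
  rw [hx]

/-- The basis vectors carry the factor vol^{-1/2}, the Fourier coefficients the factor vol⁻¹; the
quotient is the constant here. -/
lemma charBasis_repr (f : Lp ℂ 2 (volume : Measure T3)) (k : Fin 3 → ℤ) :
    charBasis.repr f k = ((√vol : ℝ) : ℂ) * scalarCoeff f k := by
  have hv2 : ((√vol : ℝ) : ℂ) * ((√vol : ℝ) : ℂ) = (vol : ℂ) := by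
    rw [← Complex.ofReal_mul, Real.mul_self_sqrt vol_pos.le]
  have hv : ((√vol : ℝ) : ℂ) ≠ 0 := by
    exact_mod_cast (Real.sqrt_pos.2 vol_pos).ne'
  rw [charBasis.repr_apply_apply, charBasis, HilbertBasis.coe_mk, charLp, inner_smul_left,
    MeasureTheory.L2.inner_def, scalarCoeff, ← mul_assoc, ← hv2, map_inv₀, Complex.conj_ofReal]
  congr 1
  · field_simp
  · refine integral_congr_ae ?_
    filter_upwards [ContinuousMap.coeFn_toLp (p := 2) (𝕜 := ℂ) (volume : Measure T3) (charC k)]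
      with x hx
    rw [hx, RCLike.inner_apply, charC_apply, character_neg, mul_comm]

lemma hasSum_conj_scalarCoeff_mul {f g : T3 → ℂ} (hf : MemLp f 2 volume) (hg : MemLp g 2 volume) :
    HasSum (fun k => conj (scalarCoeff f k) * scalarCoeff g k)
      ((vol : ℂ)⁻¹ * ∫ x, conj (f x) * g x) := by
  have hv2 : ((√vol : ℝ) : ℂ) * ((√vol : ℝ) : ℂ) = (vol : ℂ) := by
    rw [← Complex.ofReal_mul, Real.mul_self_sqrt vol_pos.le]
  have hv : (vol : ℂ) ≠ 0 := by exact_mod_cast vol_pos.ne'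
  have h := charBasis.hasSum_inner_mul_inner hf.toLp hg.toLp
  have e1 : inner ℂ hf.toLp hg.toLp = ∫ x, conj (f x) * g x := by
    rw [MeasureTheory.L2.inner_def]
    refine integral_congr_ae ?_
    filter_upwards [hf.coeFn_toLp, hg.coeFn_toLp] with x h1 h2
    rw [h1, h2, RCLike.inner_apply, mul_comm]
  rw [e1] at h
  refine (h.mul_left (vol : ℂ)⁻¹).congr_fun fun k => ?_
  rw [← inner_conj_symm, ← charBasis.repr_apply_apply, ← charBasis.repr_apply_apply, charBasis_repr,
    charBasis_repr, scalarCoeff_congr hf.coeFn_toLp, scalarCoeff_congr hg.coeFn_toLp, map_mul,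
    Complex.conj_ofReal, mul_mul_mul_comm, hv2, inv_mul_cancel_left₀ hv]

lemma ae_eq_of_scalarCoeff_eq {f g : T3 → ℂ} (hf : MemLp f 2 volume) (hg : MemLp g 2 volume)
    (h : scalarCoeff f = scalarCoeff g) : f =ᵐ[volume] g := by
  have : hf.toLp = hg.toLp := by
    apply charBasis.repr.injective
    ext k
    rw [charBasis_repr, charBasis_repr, scalarCoeff_congr hf.coeFn_toLp,
      scalarCoeff_congr hg.coeFn_toLp, h]
  rwa [MemLp.toLp_eq_toLp_iff] at this

lemma exists_scalarCoeff_eq {a : (Fin 3 → ℤ) → ℂ} (ha : ∑' k, ‖a k‖ₑ ^ 2 < ⊤) :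
    ∃ f : T3 → ℂ, MemLp f 2 volume ∧ scalarCoeff f = a := by
  have hv : ((√vol : ℝ) : ℂ) ≠ 0 := by
    exact_mod_cast (Real.sqrt_pos.2 vol_pos).ne'
  have hm : Memℓp a 2 := by
    refine memℓp_gen ?_
    simp only [ENNReal.toReal_ofNat, Real.rpow_ofNat]
    have := ENNReal.summable_toReal ha.ne
    simpa using this
  set f := charBasis.repr.symm (((√vol : ℝ) : ℂ) • (⟨a, hm⟩ : lp (fun _ : Fin 3 → ℤ => ℂ) 2))
  refine ⟨f, Lp.memLp f, ?_⟩
  funext k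
  have h := charBasis_repr f k
  rw [LinearIsometryEquiv.apply_symm_apply] at h
  exact (mul_left_cancel₀ hv h).symm

lemma memLp_conj {f : T3 → ℂ} (hf : MemLp f 2 volume) :
    MemLp (fun x => conj (f x)) 2 volume := hf.star

lemma memLp_character_mul {f : T3 → ℂ} (hf : MemLp f 2 volume) (k : Fin 3 → ℤ) :
    MemLp (fun x => character k x * f x) 2 volume := by
  refine MemLp.of_le hf ((continuous_character k).aestronglyMeasurable.mul hf.1)
    (Eventually.of_forall fun x => ?_)
  rw [norm_mul, norm_character, one_mul]

lemma scalarCoeff_conj (f : T3 → ℂ) (k : Fin 3 → ℤ) :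
    scalarCoeff (fun x => conj (f x)) k = conj (scalarCoeff f (-k)) := by
  rw [scalarCoeff, scalarCoeff, map_mul, ← integral_conj, map_inv₀, Complex.conj_ofReal]
  congr 2
  funext x
  rw [map_mul, ← character_neg, neg_neg]

lemma scalarCoeff_character_mul (f : T3 → ℂ) (k l : Fin 3 → ℤ) :
    scalarCoeff (fun x => character l x * f x) k = scalarCoeff f (k - l) := by
  rw [scalarCoeff, scalarCoeff]
  congr 2
  funext x
  rw [← mul_assoc, ← character_add, show -k + l = -(k - l) by abel]

/-- The Fourier coefficients of a product of two square integrable functions. -/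
lemma hasSum_scalarCoeff_mul {f g : T3 → ℂ} (hf : MemLp f 2 volume) (hg : MemLp g 2 volume)
    (k : Fin 3 → ℤ) :
    HasSum (fun l => scalarCoeff f l * scalarCoeff g (k - l))
      (scalarCoeff (fun x => f x * g x) k) := by
  -- Parseval's identity for the pair conj f and e^{-ik·x}g: the inner product is the coefficient of
  -- fg up to normalization, and the series becomes a convolution after l ↦ -l.
  have h := hasSum_conj_scalarCoeff_mul (memLp_conj hf) (memLp_character_mul hg (-k))
  simp only [scalarCoeff_conj, Complex.conj_conj, scalarCoeff_character_mul] at h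
  rw [← (Equiv.neg (Fin 3 → ℤ)).hasSum_iff] at h
  simp only [Function.comp_def, Equiv.neg_apply, neg_neg] at h
  have e : ∀ l : Fin 3 → ℤ, -l - -k = k - l := fun l => by abel
  simp only [e] at h
  convert h using 1
  rw [scalarCoeff]
  congr 2
  funext x
  ring

/-! ### Fourier coefficients of vector fields -/

lemma fourierCoeffs_apply (f : T3 → V3) (k : Fin 3 → ℤ) (i : Fin 3) :
    fourierCoeffs f k i = scalarCoeff (fun x => ((f x i : ℝ) : ℂ)) k := rfl

lemma fourierCoeffs_congr {f g : T3 → V3} (h : f =ᵐ[volume] g) :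
    fourierCoeffs f = fourierCoeffs g := by
  funext k
  ext i
  rw [fourierCoeffs_apply, fourierCoeffs_apply, scalarCoeff_congr]
  filter_upwards [h] with x hx
  rw [hx]

lemma memLp_component {f : T3 → V3} (hf : MemLp f 2 volume) (i : Fin 3) :
    MemLp (fun x => ((f x i : ℝ) : ℂ)) 2 volume := by
  refine MemLp.of_le hf (Complex.continuous_ofReal.comp_aestronglyMeasurable
    ((EuclideanSpace.proj (𝕜 := ℝ) i).continuous.comp_aestronglyMeasurable hf.1))
    (Eventually.of_forall fun x => ?_)
  rw [Complex.norm_real]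
  exact PiLp.norm_apply_le (f x) i

/-- The families of Fourier coefficients of real vector fields. -/
def IsReal (c : Coeffs) : Prop := ∀ k i, c (-k) i = conj (c k i)

lemma isReal_fourierCoeffs (f : T3 → V3) : IsReal (fourierCoeffs f) := fun k i => by
  rw [fourierCoeffs_apply, fourierCoeffs_apply, ← Complex.conj_conj (scalarCoeff _ (-k)),
    ← scalarCoeff_conj]
  simp only [Complex.conj_ofReal]

/-- Parseval's identity for real vector fields. -/
lemma hasSum_fourierCoeffs_inner {f g : T3 → V3} (hf : MemLp f 2 volume) (hg : MemLp g 2 volume) :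
    HasSum (fun k => ∑ i, fourierCoeffs f k i * conj (fourierCoeffs g k i))
      ((vol : ℂ)⁻¹ * ((∫ x, inner ℝ (f x) (g x) : ℝ) : ℂ)) := by
  have h := hasSum_sum fun i (_ : i ∈ (Finset.univ : Finset (Fin 3))) =>
    hasSum_conj_scalarCoeff_mul (memLp_component hg i) (memLp_component hf i)
  have hint : ∀ i, Integrable (fun x => conj ((g x i : ℝ) : ℂ) * ((f x i : ℝ) : ℂ)) volume :=
    fun i => (memLp_conj (memLp_component hg i)).integrable_mul (memLp_component hf i)
  rw [← Finset.mul_sum, ← integral_finsetSum _ fun i _ => hint i] at h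
  convert h using 1
  · funext k
    refine Finset.sum_congr rfl fun i _ => ?_
    rw [fourierCoeffs_apply, fourierCoeffs_apply, mul_comm]
  · congr 1
    rw [← integral_complex_ofReal]
    congr 1
    funext x
    simp only [PiLp.inner_apply, RCLike.inner_apply, Complex.ofReal_sum, conj_trivial,
      Complex.ofReal_mul, Complex.conj_ofReal]

lemma hasSum_norm_fourierCoeffs_sq {f : T3 → V3} (hf : MemLp f 2 volume) :
    HasSum (fun k => ‖fourierCoeffs f k‖ ^ 2) (vol⁻¹ * ∫ x, ‖f x‖ ^ 2) := by
  have h := Complex.hasSum_re (hasSum_fourierCoeffs_inner hf hf)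
  convert h using 1
  · funext k
    rw [EuclideanSpace.norm_sq_eq, Complex.re_sum]
    refine Finset.sum_congr rfl fun i _ => ?_
    rw [Complex.mul_conj, Complex.ofReal_re, Complex.normSq_eq_norm_sq]
  · rw [← Complex.ofReal_inv, Complex.re_ofReal_mul, Complex.ofReal_re]
    simp only [real_inner_self_eq_norm_sq]

lemma tsum_enorm_fourierCoeffs_sq {f : T3 → V3} (hf : MemLp f 2 volume) :
    ∑' k, ‖fourierCoeffs f k‖ₑ ^ 2 = ENNReal.ofReal (vol⁻¹ * ∫ x, ‖f x‖ ^ 2) := by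
  have h := hasSum_norm_fourierCoeffs_sq hf
  rw [← h.tsum_eq, ENNReal.ofReal_tsum_of_nonneg (fun _ => sq_nonneg _) h.summable]
  refine tsum_congr fun k => ?_
  rw [ENNReal.ofReal_pow (norm_nonneg _), ofReal_norm]

lemma ae_eq_of_fourierCoeffs_eq {f g : T3 → V3} (hf : MemLp f 2 volume) (hg : MemLp g 2 volume)
    (h : fourierCoeffs f = fourierCoeffs g) : f =ᵐ[volume] g := by
  have hi : ∀ i, (fun x => ((f x i : ℝ) : ℂ)) =ᵐ[volume] fun x => ((g x i : ℝ) : ℂ) := fun i => by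
    refine ae_eq_of_scalarCoeff_eq (memLp_component hf i) (memLp_component hg i) ?_
    funext k
    rw [← fourierCoeffs_apply, ← fourierCoeffs_apply, h]
  filter_upwards [ae_all_iff.2 hi] with x hx
  ext i
  exact Complex.ofReal_injective (hx i)

lemma L2_ext {f g : L2} (h : fourierCoeffs f = fourierCoeffs g) : f = g :=
  Lp.ext (ae_eq_of_fourierCoeffs_eq (Lp.memLp f) (Lp.memLp g) h)

/-- Riesz–Fischer in each component. By the symmetry of the coefficients a component and its
conjugate have the same Fourier coefficients, hence it is real almost everywhere. -/
lemma exists_L2_of_coeffs {c : Coeffs} (hc : ∑' k, ‖c k‖ₑ ^ 2 < ⊤) (hr : IsReal c) :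
    ∃ f : L2, fourierCoeffs f = c := by
  have hi : ∀ i, ∃ f : T3 → ℂ, MemLp f 2 volume ∧ scalarCoeff f = fun k => c k i := fun i => by
    refine exists_scalarCoeff_eq (lt_of_le_of_lt (ENNReal.tsum_le_tsum fun k => ?_) hc)
    gcongr
    rw [← ofReal_norm, ← ofReal_norm]
    exact ENNReal.ofReal_le_ofReal (PiLp.norm_apply_le (c k) i)
  choose f hf hfc using hi
  have hre : ∀ i, f i =ᵐ[volume] fun x => (((f i x).re : ℝ) : ℂ) := fun i => by
    have h1 : f i =ᵐ[volume] fun x => conj (f i x) := by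
      refine ae_eq_of_scalarCoeff_eq (hf i) (memLp_conj (hf i)) ?_
      funext k
      rw [scalarCoeff_conj, hfc]
      beta_reduce
      rw [hr, Complex.conj_conj]
    filter_upwards [h1] with x hx
    exact (Complex.conj_eq_iff_re.1 hx.symm).symm
  have hmem : MemLp (fun x => (WithLp.toLp 2 fun i => (f i x).re : V3)) 2 volume :=
    MemLp.of_eval_piLp fun i => (hf i).re
  refine ⟨hmem.toLp, ?_⟩
  rw [fourierCoeffs_congr hmem.coeFn_toLp]
  funext k
  ext i
  rw [fourierCoeffs_apply, ← scalarCoeff_congr (hre i), hfc]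

end Burgers

end


noncomputable section

namespace Burgers

open scoped ComplexConjugate

/-! ### Derivatives on the torus -/

/-- The covering map of the torus. -/
def toTorus (y : Fin 3 → ℝ) : T3 := fun i => (y i : AddCircle (2 * Real.pi))

lemma isOpenQuotientMap_toTorus : IsOpenQuotientMap toTorus :=
  IsOpenQuotientMap.piMap fun _ => QuotientAddGroup.isOpenQuotientMap_mk

lemma exists_toTorus_eq (x : T3) : ∃ y, toTorus y = x := isOpenQuotientMap_toTorus.surjective x

lemma toTorus_add_single (y : Fin 3 → ℝ) (j : Fin 3) (h : ℝ) :
    toTorus y + Pi.single j (h : AddCircle (2 * Real.pi)) = toTorus (y + h • Pi.single j 1) := by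
  funext i
  by_cases hij : i = j
  · subst hij
    simp [toTorus]
  · simp [toTorus, hij]

lemma continuous_of_continuous_periodicLift {f : T3 → V3} (h : Continuous (periodicLift f)) :
    Continuous f := isOpenQuotientMap_toTorus.isQuotientMap.continuous_iff.2 h

lemma IsCn.continuous {n : WithTop ℕ∞} {f : T3 → V3} (h : IsCn n f) : Continuous f :=
  continuous_of_continuous_periodicLift (ContDiff.continuous h)

lemma hasDerivAt_periodicLift {f : T3 → V3} (h : Differentiable ℝ (periodicLift f))
    (y : Fin 3 → ℝ) (j : Fin 3) (s : ℝ) :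
    HasDerivAt (fun r : ℝ => f (toTorus y + Pi.single j (r : AddCircle (2 * Real.pi))))
      (fderiv ℝ (periodicLift f) (y + s • Pi.single j 1) (Pi.single j 1)) s := by
  simp only [toTorus_add_single]
  have h1 : HasDerivAt (fun r : ℝ => y + r • (Pi.single j 1 : Fin 3 → ℝ)) (Pi.single j 1) s := by
    simpa using ((hasDerivAt_id s).smul_const (Pi.single j 1 : Fin 3 → ℝ)).const_add y
  exact (h _).hasFDerivAt.comp_hasDerivAt s h1

lemma partialD_toTorus {f : T3 → V3} (h : Differentiable ℝ (periodicLift f)) (j : Fin 3)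
    (y : Fin 3 → ℝ) :
    partialD j f (toTorus y) = fderiv ℝ (periodicLift f) y (Pi.single j 1) := by
  have := (hasDerivAt_periodicLift h y j 0).deriv
  rwa [zero_smul, add_zero] at this

lemma IsCn.hasDerivAt {n : WithTop ℕ∞} {f : T3 → V3} (h : IsCn n f) (hn : 1 ≤ n) (j : Fin 3) (x : T3)
    (s : ℝ) : HasDerivAt (fun r : ℝ => f (x + Pi.single j (r : AddCircle (2 * Real.pi))))
      (partialD j f (x + Pi.single j (s : AddCircle (2 * Real.pi)))) s := by
  obtain ⟨y, rfl⟩ := exists_toTorus_eq x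
  have hd : Differentiable ℝ (periodicLift f) :=
    ContDiff.differentiable h (zero_lt_one.trans_le hn).ne'
  rw [toTorus_add_single, partialD_toTorus hd]
  exact hasDerivAt_periodicLift hd y j s

lemma IsCn.continuous_partialD {n : WithTop ℕ∞} {f : T3 → V3} (h : IsCn n f) (hn : 1 ≤ n)
    (j : Fin 3) : Continuous (partialD j f) := by
  have h0 : n ≠ 0 := (zero_lt_one.trans_le hn).ne'
  refine continuous_of_continuous_periodicLift ?_
  have e : periodicLift (partialD j f) = fun y => fderiv ℝ (periodicLift f) y (Pi.single j 1) :=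
    funext fun y => partialD_toTorus (ContDiff.differentiable h h0) j y
  rw [e]
  exact (ContDiff.continuous_fderiv h h0).clm_apply continuous_const

lemma _root_.Continuous.memLp_two {E : Type*} [NormedAddCommGroup E] [SecondCountableTopology E]
    {f : T3 → E} (hf : Continuous f) : MemLp f 2 (volume : Measure T3) :=
  hf.memLp_of_hasCompactSupport (HasCompactSupport.of_compactSpace f)

lemma _root_.Continuous.integrable_torus {E : Type*} [NormedAddCommGroup E]
    [SecondCountableTopology E] {f : T3 → E} (hf : Continuous f) :
    Integrable f (volume : Measure T3) :=
  hf.integrable_of_hasCompactSupport (HasCompactSupport.of_compactSpace f)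

lemma character_single_coe (k : Fin 3 → ℤ) (j : Fin 3) (s : ℝ) :
    character k (Pi.single j (s : AddCircle (2 * Real.pi))) =
      Complex.exp (Complex.I * (k j : ℂ) * s) := by
  rw [character, Finset.prod_eq_single j]
  · rw [Pi.single_eq_same, fourier_coe_apply]
    congr 1
    have : (Real.pi : ℂ) ≠ 0 := by exact_mod_cast Real.pi_ne_zero
    push_cast
    field_simp
  · intro i _ hi
    rw [Pi.single_eq_of_ne hi, fourier_eval_zero]
  · simp

lemma character_apply_add (k : Fin 3 → ℤ) (x y : T3) :
    character k (x + y) = character k x * character k y := by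
  simp only [character, ← Finset.prod_mul_distrib]
  refine Finset.prod_congr rfl fun i _ => ?_
  rw [Pi.add_apply, fourier_apply, fourier_apply, fourier_apply, smul_add, AddCircle.toCircle_add,
    Circle.coe_mul]

lemma scalarCoeff_translate (f : T3 → ℂ) (s : T3) (k : Fin 3 → ℤ) :
    scalarCoeff (fun x => f (x + s)) k = character k s * scalarCoeff f k := by
  rw [scalarCoeff, scalarCoeff, mul_left_comm]
  congr 1
  rw [← integral_add_right_eq_self (fun x => character (-k) x * f x) s, ← integral_const_mul]
  congr 1
  funext x
  have h : character k s * character (-k) s = 1 := by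
    rw [← character_add, add_neg_cancel, character_zero]
  rw [character_apply_add]
  linear_combination -(character (-k) x * f (x + s)) * h

lemma hasDerivAt_scalarCoeff_translate {g g' : T3 → ℂ} (hg : Continuous g) (hg' : Continuous g')
    {τ : ℝ → T3} (h : ∀ x s, HasDerivAt (fun r => g (x + τ r)) (g' (x + τ s)) s) (k : Fin 3 → ℤ)
    (s₀ : ℝ) :
    HasDerivAt (fun s => scalarCoeff (fun x => g (x + τ s)) k)
      (scalarCoeff (fun x => g' (x + τ s₀)) k) s₀ := by
  obtain ⟨B, hB⟩ := (isCompact_range hg').isBounded.exists_norm_le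
  have hcont : ∀ s, Continuous fun x : T3 => x + τ s := fun s => continuous_id.add continuous_const
  have hc1 : ∀ s, Continuous fun x : T3 => character (-k) x * g (x + τ s) := fun s =>
    (continuous_character _).mul (hg.comp (hcont s))
  have hc2 : ∀ s, Continuous fun x : T3 => character (-k) x * g' (x + τ s) := fun s =>
    (continuous_character _).mul (hg'.comp (hcont s))
  refine HasDerivAt.const_mul _ ?_
  refine (hasDerivAt_integral_of_dominated_loc_of_deriv_le (μ := (volume : Measure T3))
    (s := univ) (bound := fun _ => B)
    (F := fun s x => character (-k) x * g (x + τ s))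
    (F' := fun s x => character (-k) x * g' (x + τ s))
    univ_mem (Eventually.of_forall fun s => (hc1 s).aestronglyMeasurable)
    (hc1 s₀).integrable_torus (hc2 s₀).aestronglyMeasurable
    (Eventually.of_forall fun x s _ => ?_) (integrable_const _)
    (Eventually.of_forall fun x s _ => (h x s).const_mul _)).2
  rw [norm_mul, norm_character, one_mul]
  exact hB _ (mem_range_self _)

/-- Translation invariance takes the place of integration by parts: translating by s in direction j
multiplies the k-th coefficient by e^{i kⱼ s}, and both expressions for the translated coefficient
are differentiated at s = 0. -/
lemma scalarCoeff_deriv {g g' : T3 → ℂ} (hg : Continuous g) (hg' : Continuous g') (j : Fin 3)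
    (h : ∀ (x : T3) (s : ℝ), HasDerivAt
      (fun r : ℝ => g (x + Pi.single j (r : AddCircle (2 * Real.pi))))
      (g' (x + Pi.single j (s : AddCircle (2 * Real.pi)))) s) (k : Fin 3 → ℤ) :
    scalarCoeff g' k = Complex.I * (k j : ℂ) * scalarCoeff g k := by
  have h2 := hasDerivAt_scalarCoeff_translate hg hg'
    (τ := fun s : ℝ => Pi.single j (s : AddCircle (2 * Real.pi))) h k 0
  have h3 : HasDerivAt (fun s : ℝ => Complex.exp (Complex.I * (k j : ℂ) * s) * scalarCoeff g k)
      (Complex.I * (k j : ℂ) * scalarCoeff g k) 0 := by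
    have h4 : HasDerivAt (fun s : ℝ => Complex.exp (Complex.I * (k j : ℂ) * s))
        (Complex.I * (k j : ℂ)) 0 := by
      have := ((Complex.ofRealCLM.hasDerivAt (x := 0)).const_mul (Complex.I * (k j : ℂ))).cexp
      simpa using this
    exact h4.mul_const _
  simp only [scalarCoeff_translate g, character_single_coe] at h2
  have h4 := h2.unique h3
  rwa [QuotientAddGroup.mk_zero, Pi.single_zero, funext fun x : T3 => congrArg g' (add_zero x)] at h4

/-- Differentiation multiplies the Fourier coefficients by `i kⱼ`. -/
lemma fourierCoeffs_partialD {n : WithTop ℕ∞} {f : T3 → V3} (h : IsCn n f) (hn : 1 ≤ n)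
    (j : Fin 3) (k : Fin 3 → ℤ) :
    fourierCoeffs (partialD j f) k = (Complex.I * (k j : ℂ)) • fourierCoeffs f k := by
  ext i
  rw [PiLp.smul_apply, fourierCoeffs_apply, fourierCoeffs_apply, smul_eq_mul]
  set L : V3 →L[ℝ] ℂ := Complex.ofRealCLM.comp (EuclideanSpace.proj (𝕜 := ℝ) i)
  exact scalarCoeff_deriv (L.continuous.comp h.continuous)
    (L.continuous.comp (h.continuous_partialD hn j)) j
    (fun x s => L.hasFDerivAt.comp_hasDerivAt s (h.hasDerivAt hn j x s)) k

/-- Multiplication of the Fourier coefficients by `i kⱼ`. -/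
def coeffD (j : Fin 3) (c : Coeffs) : Coeffs := fun k => (Complex.I * (k j : ℂ)) • c k

/-- By Parseval both integrals are series, which agree term by term; the minus sign is conj i = -i
acting on the coefficients of ∂ⱼφ. -/
lemma isWeakPartial_of_fourierCoeffs {j : Fin 3} {f g : L2}
    (h : fourierCoeffs g = coeffD j (fourierCoeffs f)) : IsWeakPartial j f g := by
  intro φ hφ
  have hφc : MemLp φ 2 (volume : Measure T3) := hφ.continuous.memLp_two
  have hn : (1 : WithTop ℕ∞) ≤ ∞ := by norm_cast
  have hφd : MemLp (partialD j φ) 2 (volume : Measure T3) := (hφ.continuous_partialD hn j).memLp_two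
  have h1 := hasSum_fourierCoeffs_inner (Lp.memLp f) hφd
  have h2 := (hasSum_fourierCoeffs_inner (Lp.memLp g) hφc).neg
  have e : ∀ k, ∑ i, fourierCoeffs f k i * conj (fourierCoeffs (partialD j φ) k i) =
      -∑ i, fourierCoeffs g k i * conj (fourierCoeffs φ k i) := fun k => by
    rw [← Finset.sum_neg_distrib]
    refine Finset.sum_congr rfl fun i _ => ?_
    rw [fourierCoeffs_partialD hφ hn, h, coeffD]
    simp only [PiLp.smul_apply, smul_eq_mul, map_mul, Complex.conj_I, map_intCast]
    ring
  simp only [e] at h1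
  have h3 := h1.unique h2
  have hv : (vol : ℂ)⁻¹ ≠ 0 := inv_ne_zero (by exact_mod_cast vol_pos.ne')
  rw [← mul_neg] at h3
  exact_mod_cast mul_left_cancel₀ hv h3

/-! ### Trigonometric test functions -/

/-- The test function `cos(k·x) eᵢ`. -/
def cosField (k : Fin 3 → ℤ) (i : Fin 3) (x : T3) : V3 := EuclideanSpace.single i (character k x).re

/-- The test function `sin(k·x) eᵢ`. -/
def sinField (k : Fin 3 → ℤ) (i : Fin 3) (x : T3) : V3 := EuclideanSpace.single i (character k x).im

lemma character_toTorus (k : Fin 3 → ℤ) (y : Fin 3 → ℝ) :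
    character k (toTorus y) = Complex.exp (((∑ i, (k i : ℝ) * y i : ℝ) : ℂ) * Complex.I) := by
  rw [character]
  simp only [toTorus, fourier_coe_apply]
  rw [← Complex.exp_sum]
  congr 1
  have : (Real.pi : ℂ) ≠ 0 := by exact_mod_cast Real.pi_ne_zero
  push_cast
  rw [Finset.sum_mul]
  refine Finset.sum_congr rfl fun i _ => ?_
  field_simp

lemma smul_single (i : Fin 3) (r s : ℝ) :
    r • (EuclideanSpace.single i s : V3) = EuclideanSpace.single i (r * s) := by
  ext m
  by_cases h : m = i <;> simp [h]

/-- The isometry onto the `i`-th coordinate axis. -/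
def axis (i : Fin 3) : ℝ →L[ℝ] V3 := (ContinuousLinearMap.id ℝ ℝ).smulRight (EuclideanSpace.single i 1)

lemma axis_apply (i : Fin 3) (r : ℝ) : axis i r = EuclideanSpace.single i r := by
  simp [axis, smul_single]

lemma contDiff_character_toTorus (k : Fin 3 → ℤ) {n : WithTop ℕ∞} :
    ContDiff ℝ n fun y => character k (toTorus y) := by
  simp only [character_toTorus]
  have h : ContDiff ℝ n fun y : Fin 3 → ℝ => (∑ i, (k i : ℝ) * y i : ℝ) := by fun_prop
  exact ((Complex.ofRealCLM.contDiff.comp h).mul contDiff_const).cexp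

lemma isCn_cosField (k : Fin 3 → ℤ) (i : Fin 3) {n : WithTop ℕ∞} : IsCn n (cosField k i) := by
  have e : periodicLift (cosField k i) = fun y => axis i (Complex.reCLM (character k (toTorus y))) :=
    funext fun y => (axis_apply _ _).symm
  rw [IsCn, e]
  exact (axis i).contDiff.comp (Complex.reCLM.contDiff.comp (contDiff_character_toTorus k))

lemma isCn_sinField (k : Fin 3 → ℤ) (i : Fin 3) {n : WithTop ℕ∞} : IsCn n (sinField k i) := by
  have e : periodicLift (sinField k i) = fun y => axis i (Complex.imCLM (character k (toTorus y))) :=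
    funext fun y => (axis_apply _ _).symm
  rw [IsCn, e]
  exact (axis i).contDiff.comp (Complex.imCLM.contDiff.comp (contDiff_character_toTorus k))

lemma hasDerivAt_character (k : Fin 3 → ℤ) (j : Fin 3) (x : T3) (s : ℝ) :
    HasDerivAt (fun h : ℝ => character k (x + Pi.single j (h : AddCircle (2 * Real.pi))))
      (Complex.I * (k j : ℂ) * character k (x + Pi.single j (s : AddCircle (2 * Real.pi)))) s := by
  simp only [character_apply_add, character_single_coe]
  have h4 : HasDerivAt (fun s : ℝ => Complex.exp (Complex.I * (k j : ℂ) * s))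
      (Complex.exp (Complex.I * (k j : ℂ) * s) * (Complex.I * (k j : ℂ))) s := by
    have := ((Complex.ofRealCLM.hasDerivAt (x := s)).const_mul (Complex.I * (k j : ℂ))).cexp
    simpa using this
  exact (h4.const_mul _).congr_deriv (by ring)

lemma partialD_cosField (k : Fin 3 → ℤ) (i j : Fin 3) (x : T3) :
    partialD j (cosField k i) x = -(k j : ℝ) • sinField k i x := by
  have h := ((axis i).comp Complex.reCLM).hasFDerivAt.comp_hasDerivAt 0 (hasDerivAt_character k j x 0)
  have e : (((axis i).comp Complex.reCLM) ∘ fun h : ℝ =>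
      character k (x + Pi.single j (h : AddCircle (2 * Real.pi)))) =
      fun h : ℝ => cosField k i (x + Pi.single j (h : AddCircle (2 * Real.pi))) :=
    funext fun h => axis_apply _ _
  rw [e] at h
  rw [partialD, h.deriv]
  simp [sinField, axis_apply, smul_single, -neg_smul]

lemma partialD_sinField (k : Fin 3 → ℤ) (i j : Fin 3) (x : T3) :
    partialD j (sinField k i) x = (k j : ℝ) • cosField k i x := by
  have h := ((axis i).comp Complex.imCLM).hasFDerivAt.comp_hasDerivAt 0 (hasDerivAt_character k j x 0)
  have e : (((axis i).comp Complex.imCLM) ∘ fun h : ℝ =>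
      character k (x + Pi.single j (h : AddCircle (2 * Real.pi)))) =
      fun h : ℝ => sinField k i (x + Pi.single j (h : AddCircle (2 * Real.pi))) :=
    funext fun h => axis_apply _ _
  rw [e] at h
  rw [partialD, h.deriv]
  simp [cosField, axis_apply, smul_single]

lemma fourierCoeffs_eq_integral_inner {f : T3 → V3} (hf : Integrable f volume) (k : Fin 3 → ℤ)
    (i : Fin 3) : fourierCoeffs f k i = (vol : ℂ)⁻¹ *
      (((∫ x, inner ℝ (f x) (cosField k i x) : ℝ) : ℂ) -
        Complex.I * ((∫ x, inner ℝ (f x) (sinField k i x) : ℝ) : ℂ)) := by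
  rw [fourierCoeffs_apply, scalarCoeff]
  congr 1
  have hfi : Integrable (fun x => f x i) volume :=
    (EuclideanSpace.proj (𝕜 := ℝ) i).integrable_comp hf
  have h1 : ∀ g : T3 → ℝ, Continuous g → (∀ x, |g x| ≤ 1) →
      Integrable (fun x => f x i * g x) volume := fun g hg hb =>
    hfi.mul_bdd (c := 1) hg.aestronglyMeasurable (Eventually.of_forall hb)
  have hre := h1 (fun x => (character k x).re) (Complex.continuous_re.comp (continuous_character k))
    fun x => (Complex.abs_re_le_norm _).trans (norm_character k x).le
  have him := h1 (fun x => (character k x).im) (Complex.continuous_im.comp (continuous_character k))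
    fun x => (Complex.abs_im_le_norm _).trans (norm_character k x).le
  rw [← integral_complex_ofReal, ← integral_complex_ofReal, ← integral_const_mul, ← integral_sub]
  · refine integral_congr_ae (Eventually.of_forall fun x => ?_)
    simp only [cosField, sinField, character_neg, EuclideanSpace.inner_single_right, conj_trivial]
    have hz : ∀ z : ℂ, conj z = (z.re : ℂ) - z.im * Complex.I := fun z => by
      apply Complex.ext <;> simp
    rw [hz]
    push_cast
    ring
  · simp only [cosField, EuclideanSpace.inner_single_right, conj_trivial, mul_comm _ (f _ i)]
    exact hre.ofReal
  · simp only [sinField, EuclideanSpace.inner_single_right, conj_trivial, mul_comm _ (f _ i)]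
    exact him.ofReal.const_mul _

lemma L2_integrable (f : L2) : Integrable (f : T3 → V3) volume :=
  (Lp.memLp f).integrable one_le_two

/-- Differentiation exchanges the cosine and sine fields up to a factor ±kⱼ, so testing with the
pair yields multiplication by i kⱼ. In particular weak partial derivatives are unique. -/
lemma fourierCoeffs_of_isWeakPartial {j : Fin 3} {f g : L2} (h : IsWeakPartial j f g) :
    fourierCoeffs g = coeffD j (fourierCoeffs f) := by
  funext k
  ext i
  rw [coeffD, PiLp.smul_apply, smul_eq_mul, fourierCoeffs_eq_integral_inner (L2_integrable f),
    fourierCoeffs_eq_integral_inner (L2_integrable g)]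
  have h1 := h _ (isCn_cosField k i)
  have h2 := h _ (isCn_sinField k i)
  simp only [partialD_cosField, partialD_sinField, neg_smul, inner_neg_right, inner_smul_right,
    integral_neg, integral_const_mul] at h1 h2
  have h1' : ∫ x, inner ℝ (g x) (cosField k i x) = k j * ∫ x, inner ℝ (f x) (sinField k i x) := by
    linarith
  have h2' : ∫ x, inner ℝ (g x) (sinField k i x) = -(k j * ∫ x, inner ℝ (f x) (cosField k i x)) := by
    linarith
  rw [h1', h2']
  simp only [Complex.ofReal_mul, Complex.ofReal_neg, Complex.ofReal_intCast]
  linear_combination (vol : ℂ)⁻¹ * (k j : ℂ) *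
    ((∫ x, inner ℝ (f x) (sinField k i x) : ℝ) : ℂ) * Complex.I_sq

end Burgers

end

noncomputable section
namespace Burgers
open scoped ComplexConjugate

/-! ### Synthesis of continuous vector fields from their Fourier coefficients -/

/-- The real part, from `ℂ³` to `ℝ³`. -/
def reV : EuclideanSpace ℂ (Fin 3) →L[ℝ] V3 :=
  LinearMap.mkContinuous
    { toFun := fun z => WithLp.toLp 2 fun i => (z i).re
      map_add' := fun z w => by ext i; simp
      map_smul' := fun r z => by ext i; simp }
    1 fun z => by
      rw [one_mul, EuclideanSpace.norm_eq, EuclideanSpace.norm_eq]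
      refine Real.sqrt_le_sqrt (Finset.sum_le_sum fun i _ => ?_)
      exact pow_le_pow_left₀ (norm_nonneg _) (Complex.abs_re_le_norm _) 2

@[simp] lemma reV_apply (z : EuclideanSpace ℂ (Fin 3)) (i : Fin 3) : reV z i = (z i).re := rfl

lemma norm_reV_le (z : EuclideanSpace ℂ (Fin 3)) : ‖reV z‖ ≤ ‖z‖ := by
  have := reV.le_of_opNorm_le (LinearMap.mkContinuous_norm_le _ zero_le_one _) z
  rwa [one_mul] at this

/-- The vector field `x ↦ Re (e^{i k·x} z)`, as a linear function of `z`. -/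
def modeL (k : Fin 3 → ℤ) : EuclideanSpace ℂ (Fin 3) →L[ℝ] C(T3, V3) :=
  LinearMap.mkContinuous
    { toFun := fun z => ⟨fun x => reV (character k x • z),
        reV.continuous.comp ((continuous_character k).smul continuous_const)⟩
      map_add' := fun z w => by ext x i; simp
      map_smul' := fun r z => by ext x i; simp; ring }
    1 fun z => by
      rw [one_mul]
      refine (ContinuousMap.norm_le _ (norm_nonneg z)).2 fun x => ?_
      refine (norm_reV_le _).trans ?_
      rw [norm_smul, norm_character, one_mul]

lemma modeL_apply (k : Fin 3 → ℤ) (z : EuclideanSpace ℂ (Fin 3)) (x : T3) :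
    modeL k z x = reV (character k x • z) := rfl

lemma norm_modeL_le (k : Fin 3 → ℤ) (z : EuclideanSpace ℂ (Fin 3)) : ‖modeL k z‖ ≤ ‖z‖ := by
  have := (modeL k).le_of_opNorm_le (LinearMap.mkContinuous_norm_le _ zero_le_one _) z
  rwa [one_mul] at this

/-- The vector field with given Fourier coefficients. -/
def synth (c : Coeffs) : C(T3, V3) := ∑' k, modeL k (c k)

lemma summable_modeL {c : Coeffs} (hc : Summable fun k => ‖c k‖) :
    Summable fun k => modeL k (c k) :=
  Summable.of_norm_bounded hc fun k => norm_modeL_le k (c k)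

lemma hasSum_synth_apply {c : Coeffs} (hc : Summable fun k => ‖c k‖) (x : T3) :
    HasSum (fun k => reV (character k x • c k)) (synth c x) :=
  (summable_modeL hc).hasSum.mapL (ContinuousMap.evalCLM ℝ x)

/-- For a real family the substitution k ↦ -k shows that the complex series is its own conjugate, so
the real part taken in `modeL` loses nothing. -/
lemma hasSum_synth {c : Coeffs} (hc : Summable fun k => ‖c k‖) (hr : IsReal c) (x : T3)
    (i : Fin 3) : HasSum (fun k => character k x * c k i) ((synth c x i : ℝ) : ℂ) := by
  have hs : Summable fun k => character k x * c k i :=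
    Summable.of_norm_bounded hc fun k => by
      rw [norm_mul, norm_character, one_mul]
      exact PiLp.norm_apply_le (c k) i
  have h1 : HasSum (fun k => (character k x * c k i).re) (synth c x i) :=
    (hasSum_synth_apply hc x).mapL (EuclideanSpace.proj (𝕜 := ℝ) i)
  have h2 : conj (∑' k, character k x * c k i) = ∑' k, character k x * c k i := by
    rw [Complex.conj_tsum, ← (Equiv.neg (Fin 3 → ℤ)).tsum_eq]
    refine tsum_congr fun k => ?_
    rw [Equiv.neg_apply, hr, map_mul, Complex.conj_conj, character_neg, Complex.conj_conj]
  have h3 : (∑' k, character k x * c k i) = ((synth c x i : ℝ) : ℂ) := by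
    rw [← Complex.conj_eq_iff_re.1 h2, (Complex.hasSum_re hs.hasSum).unique h1]
  exact h3 ▸ hs.hasSum

lemma scalarCoeff_mul_const (k l : Fin 3 → ℤ) (z : ℂ) :
    scalarCoeff (fun x => character l x * z) k = if l = k then z else 0 := by
  have hv : (vol : ℂ) ≠ 0 := by exact_mod_cast vol_pos.ne'
  rw [scalarCoeff]
  simp only [← mul_assoc, ← character_add]
  rw [integral_mul_const, integral_character]
  have : -k + l = 0 ↔ l = k := by rw [neg_add_eq_zero, eq_comm]
  simp only [this]
  split_ifs
  · field_simp
  · simp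

lemma fourierCoeffs_synth {c : Coeffs} (hc : Summable fun k => ‖c k‖) (hr : IsReal c) :
    fourierCoeffs (synth c) = c := by
  funext k
  ext i
  have hci : ∀ l, ‖c l i‖ ≤ ‖c l‖ := fun l => PiLp.norm_apply_le (c l) i
  rw [fourierCoeffs_apply, scalarCoeff]
  have hn : ∀ l (x : T3), ‖character (-k) x * (character l x * c l i)‖ = ‖c l i‖ := fun l x => by
    rw [norm_mul, norm_mul, norm_character, norm_character, one_mul, one_mul]
  have h := hasSum_integral_of_summable_integral_norm (μ := (volume : Measure T3))
    (F := fun l x => character (-k) x * (character l x * c l i))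
    (fun l => Continuous.integrable_torus ((continuous_character _).mul
      ((continuous_character _).mul continuous_const)))
    (by
      simp only [hn, integral_const, smul_eq_mul]
      exact (Summable.of_nonneg_of_le (fun _ => norm_nonneg _) hci hc).mul_left _)
  have e : ∀ x, ∑' l, character (-k) x * (character l x * c l i) =
      character (-k) x * ((synth c x i : ℝ) : ℂ) := fun x =>
    ((hasSum_synth hc hr x i).mul_left _).tsum_eq
  simp only [e] at h
  have h2 := h.mul_left ((vol : ℂ)⁻¹)
  have e2 : ∀ l, (vol : ℂ)⁻¹ * ∫ x, character (-k) x * (character l x * c l i) =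
      if l = k then c l i else 0 := fun l => scalarCoeff_mul_const k l (c l i)
  simp only [e2] at h2
  have h3 : HasSum (fun l => if l = k then c l i else 0) (if k = k then c k i else 0) :=
    hasSum_single k fun l hl => if_neg hl
  rw [if_pos rfl] at h3
  exact h2.unique h3

lemma toLp_two_ext {f g : T3 → V3} (hf : Continuous f) (hg : Continuous g)
    (h : fourierCoeffs f = fourierCoeffs g) : f = g :=
  (hf.ae_eq_iff_eq volume hg).1 (ae_eq_of_fourierCoeffs_eq hf.memLp_two hg.memLp_two h)

lemma synth_fourierCoeffs {f : T3 → V3} (hf : Continuous f)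
    (hc : Summable fun k => ‖fourierCoeffs f k‖) : ⇑(synth (fourierCoeffs f)) = f :=
  toLp_two_ext (map_continuous _) hf (fourierCoeffs_synth hc (isReal_fourierCoeffs f))

lemma continuousOn_synth {f : ℝ → Coeffs} {s : Set ℝ} {m : (Fin 3 → ℤ) → ℝ}
    (hf : ∀ k, ContinuousOn (fun t => f t k) s) (hm : Summable m)
    (h : ∀ t ∈ s, ∀ k, ‖f t k‖ ≤ m k) : ContinuousOn (fun t => synth (f t)) s :=
  continuousOn_tsum (fun k => (modeL k).continuous.comp_continuousOn (hf k)) hm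
    fun k t ht => (norm_modeL_le k _).trans (h t ht k)

lemma hasDerivAt_synth {f f' : ℝ → Coeffs} {a b : ℝ} {m m' : (Fin 3 → ℤ) → ℝ}
    (hf : ∀ t ∈ Ioo a b, ∀ k, HasDerivAt (fun t => f t k) (f' t k) t)
    (hm : Summable m) (h : ∀ t ∈ Ioo a b, ∀ k, ‖f t k‖ ≤ m k)
    (hm' : Summable m') (h' : ∀ t ∈ Ioo a b, ∀ k, ‖f' t k‖ ≤ m' k) {t : ℝ} (ht : t ∈ Ioo a b) :
    HasDerivAt (fun t => synth (f t)) (synth (f' t)) t :=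
  hasDerivAt_tsum_of_isPreconnected (g := fun k t => modeL k (f t k))
    (g' := fun k t => modeL k (f' t k)) hm' isOpen_Ioo isPreconnected_Ioo
    (fun k t ht => (modeL k).hasFDerivAt.comp_hasDerivAt t (hf t ht k))
    (fun k t ht => (norm_modeL_le k _).trans (h' t ht k)) ht
    (summable_modeL (Summable.of_nonneg_of_le (fun _ => norm_nonneg _) (h t ht) hm)) ht

lemma norm_coeffD_le (j : Fin 3) (c : Coeffs) (k : Fin 3 → ℤ) : ‖coeffD j c k‖ ≤ wt k * ‖c k‖ := by
  rw [coeffD, norm_smul, norm_mul, Complex.norm_I, one_mul, Complex.norm_intCast]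
  refine mul_le_mul_of_nonneg_right ?_ (norm_nonneg _)
  have h1 : (k j : ℝ) ^ 2 ≤ ∑ i, (k i : ℝ) ^ 2 :=
    Finset.single_le_sum (f := fun i => (k i : ℝ) ^ 2) (fun i _ => sq_nonneg _) (Finset.mem_univ j)
  have h2 : wt k = 1 + ∑ i, (k i : ℝ) ^ 2 := rfl
  rw [h2]
  nlinarith [sq_abs (k j : ℝ), sq_nonneg (|(k j : ℝ)| - 1)]

/-- The derivative of `synth c`, lifted to `ℝ³`, when the derivatives are given by `g`. -/
def gradMap (g : Fin 3 → V3) : (Fin 3 → ℝ) →L[ℝ] V3 :=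
  ∑ j, (ContinuousLinearMap.proj (R := ℝ) (φ := fun _ : Fin 3 => ℝ) j).smulRight (g j)

lemma gradMap_apply (g : Fin 3 → V3) (y : Fin 3 → ℝ) : gradMap g y = ∑ j, y j • g j := by
  simp [gradMap]

lemma gradMap_single (g : Fin 3 → V3) (j : Fin 3) : gradMap g (Pi.single j 1) = g j := by
  rw [gradMap_apply, Finset.sum_eq_single j] <;> simp +contextual

lemma norm_gradMap_le {g : Fin 3 → V3} {B : ℝ} (h : ∀ j, ‖g j‖ ≤ B) : ‖gradMap g‖ ≤ 3 * B := by
  have hB : 0 ≤ B := (norm_nonneg _).trans (h 0)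
  refine ContinuousLinearMap.opNorm_le_bound _ (by positivity) fun y => ?_
  rw [gradMap_apply]
  refine (norm_sum_le _ _).trans ?_
  have : ∀ j ∈ Finset.univ, ‖y j • g j‖ ≤ ‖y‖ * B := fun j _ => by
    rw [norm_smul]
    exact mul_le_mul (norm_le_pi_norm y j) (h j) (norm_nonneg _) (norm_nonneg _)
  refine (Finset.sum_le_sum this).trans ?_
  simp only [Finset.sum_const, Finset.card_univ, Fintype.card_fin, nsmul_eq_mul]
  push_cast
  linarith

lemma hasFDerivAt_modeL (k : Fin 3 → ℤ) (z : EuclideanSpace ℂ (Fin 3)) (y : Fin 3 → ℝ) :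
    HasFDerivAt (fun y => modeL k z (toTorus y))
      (gradMap fun j => modeL k ((Complex.I * (k j : ℂ)) • z) (toTorus y)) y := by
  set A : (Fin 3 → ℝ) →L[ℝ] ℂ := ∑ j, (ContinuousLinearMap.proj (R := ℝ)
    (φ := fun _ : Fin 3 => ℝ) j).smulRight (Complex.I * (k j : ℂ)) with hA
  have hAy : ∀ y, A y = ∑ j, (y j : ℂ) * (Complex.I * (k j : ℂ)) := fun y => by
    simp [hA]
  have hχ : ∀ y, character k (toTorus y) = Complex.exp (A y) := fun y => by
    rw [character_toTorus, hAy]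
    congr 1
    push_cast
    rw [Finset.sum_mul]
    exact Finset.sum_congr rfl fun j _ => by ring
  have h1 : HasFDerivAt (fun y => Complex.exp (A y)) (Complex.exp (A y) • A) y :=
    A.hasFDerivAt.cexp
  have h2 := reV.hasFDerivAt.comp y (h1.smul_const z)
  have e : (reV ∘ fun y => Complex.exp (A y) • z) = fun y => modeL k z (toTorus y) :=
    funext fun y => by rw [Function.comp_apply, ← hχ, modeL_apply]
  rw [e] at h2
  refine h2.congr_fderiv (ContinuousLinearMap.ext fun v => ?_)
  rw [gradMap_apply]
  simp only [modeL_apply, hχ, ← map_smul, ← map_sum]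
  rw [ContinuousLinearMap.comp_apply, ContinuousLinearMap.smulRight_apply]
  congr 1
  rw [smul_apply, hAy v, smul_eq_mul, Finset.mul_sum, Finset.sum_smul]
  refine Finset.sum_congr rfl fun j _ => ?_
  rw [smul_smul, ← Complex.coe_smul, smul_smul]
  congr 1
  ring

lemma hasFDerivAt_synth {c : Coeffs} (hc : Summable fun k => wt k * ‖c k‖) (y : Fin 3 → ℝ) :
    HasFDerivAt (periodicLift (synth c))
      (gradMap fun j => synth (coeffD j c) (toTorus y)) y := by
  have hc0 : Summable fun k => ‖c k‖ := Summable.of_nonneg_of_le (fun _ => norm_nonneg _)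
    (fun k => le_mul_of_one_le_left (norm_nonneg _) (one_le_wt k)) hc
  have hcD : ∀ j, Summable fun k => ‖coeffD j c k‖ := fun j =>
    Summable.of_nonneg_of_le (fun _ => norm_nonneg _) (fun k => norm_coeffD_le j c k) hc
  have hb : ∀ k (y : Fin 3 → ℝ), ‖gradMap fun j => modeL k (coeffD j c k) (toTorus y)‖ ≤
      3 * (wt k * ‖c k‖) := fun k y => norm_gradMap_le fun j =>
    ((ContinuousMap.norm_coe_le_norm _ _).trans (norm_modeL_le k _)).trans (norm_coeffD_le j c k)
  have h := hasFDerivAt_tsum (𝕜 := ℝ) (f := fun k y => modeL k (c k) (toTorus y)) (x₀ := y)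
    (hc.mul_left 3) (fun k y => hasFDerivAt_modeL k (c k) y) hb
    (hasSum_synth_apply hc0 (toTorus y)).summable y
  have e1 : (fun y => ∑' k, modeL k (c k) (toTorus y)) = periodicLift (synth c) :=
    funext fun y => (hasSum_synth_apply hc0 (toTorus y)).tsum_eq
  rw [e1] at h
  refine h.congr_fderiv (ContinuousLinearMap.ext fun v => ?_)
  have hs : Summable fun k => gradMap fun j => modeL k (coeffD j c k) (toTorus y) :=
    Summable.of_norm_bounded (hc.mul_left 3) fun k => hb k y
  have h1 := hs.hasSum.mapL (ContinuousLinearMap.apply ℝ V3 v)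
  have h2 : HasSum (fun k => gradMap (fun j => modeL k (coeffD j c k) (toTorus y)) v)
      (gradMap (fun j => synth (coeffD j c) (toTorus y)) v) := by
    simp only [gradMap_apply]
    exact hasSum_sum fun j _ => (hasSum_synth_apply (hcD j) (toTorus y)).const_smul (v j)
  exact h1.unique h2

lemma summable_wt_mul_coeffD {c : Coeffs} {n : ℕ} (hc : Summable fun k => wt k ^ (n + 1) * ‖c k‖)
    (j : Fin 3) : Summable fun k => wt k ^ n * ‖coeffD j c k‖ := by
  refine Summable.of_nonneg_of_le (fun k => mul_nonneg (pow_nonneg (wt_pos k).le _) (norm_nonneg _))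
    (fun k => ?_) hc
  rw [pow_succ, mul_assoc]
  exact mul_le_mul_of_nonneg_left (norm_coeffD_le j c k) (pow_nonneg (wt_pos k).le _)

lemma summable_wt_pow_mono {a : (Fin 3 → ℤ) → ℝ} (ha : ∀ k, 0 ≤ a k) {m n : ℕ} (hmn : m ≤ n)
    (h : Summable fun k => wt k ^ n * a k) : Summable fun k => wt k ^ m * a k :=
  Summable.of_nonneg_of_le (fun k => mul_nonneg (pow_nonneg (wt_pos k).le _) (ha k))
    (fun k => mul_le_mul_of_nonneg_right (pow_le_pow_right₀ (one_le_wt k) hmn) (ha k)) h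

/-- Induction on n: the derivative is assembled from the fields with coefficients `coeffD j c`, and
each differentiation uses up one power of the weight. -/
lemma isCn_synth {n : ℕ} {c : Coeffs} (hc : Summable fun k => wt k ^ n * ‖c k‖) :
    IsCn n (synth c) := by
  induction n generalizing c with
  | zero =>
    refine contDiff_zero.2 ((synth c).continuous.comp ?_)
    exact isOpenQuotientMap_toTorus.continuous
  | succ n ih =>
    have h1 : Summable fun k => wt k * ‖c k‖ := by
      simpa using summable_wt_pow_mono (fun k => norm_nonneg (c k)) (show 1 ≤ n + 1 by omega) hc
    have hd : fderiv ℝ (periodicLift (synth c)) =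
        fun y => gradMap fun j => periodicLift (synth (coeffD j c)) y :=
      funext fun y => (hasFDerivAt_synth h1 y).fderiv
    rw [IsCn]
    push_cast
    rw [contDiff_succ_iff_fderiv]
    refine ⟨fun y => (hasFDerivAt_synth h1 y).differentiableAt, by simp, ?_⟩
    rw [hd]
    unfold gradMap
    exact ContDiff.sum fun j _ => contDiff_const.smulRight (ih (summable_wt_mul_coeffD hc j))

lemma partialD_synth {c : Coeffs} (hc : Summable fun k => wt k * ‖c k‖) (j : Fin 3) :
    partialD j (synth c) = synth (coeffD j c) := by
  funext x
  obtain ⟨y, rfl⟩ := exists_toTorus_eq x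
  rw [partialD_toTorus fun y => (hasFDerivAt_synth hc y).differentiableAt,
    (hasFDerivAt_synth hc y).fderiv, gradMap_single]

lemma isReal_coeffD {c : Coeffs} (hc : IsReal c) (j : Fin 3) : IsReal (coeffD j c) := fun k i => by
  simp [coeffD, hc k i]

/-! ### Products -/

lemma hasSum_euclidean {ι : Type*} {f : ι → EuclideanSpace ℂ (Fin 3)} {a : EuclideanSpace ℂ (Fin 3)}
    (h : ∀ i, HasSum (fun k => f k i) (a i)) : HasSum f a := by
  have h1 : HasSum (fun k => (f k).ofLp) a.ofLp := Pi.hasSum.2 h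
  exact h1.mapL ((PiLp.continuousLinearEquiv 2 ℂ fun _ : Fin 3 => ℂ).symm :
    (Fin 3 → ℂ) →L[ℂ] EuclideanSpace ℂ (Fin 3))

lemma memLp_mul_component_integrable {f g : T3 → V3} (hf : MemLp f 2 volume) (hg : MemLp g 2 volume)
    (i j : Fin 3) : Integrable (fun x => ((f x j : ℝ) : ℂ) * ((g x i : ℝ) : ℂ)) volume :=
  (memLp_component hf j).integrable_mul (memLp_component hg i)

/-- The Fourier coefficients of `(f·∇)g`. -/
lemma fourierCoeffs_sum_smul {f : T3 → V3} {G : Fin 3 → T3 → V3} {b : Coeffs}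
    (hf : MemLp f 2 volume) (hG : ∀ j, MemLp (G j) 2 volume)
    (hb : ∀ j, fourierCoeffs (G j) = coeffD j b) :
    fourierCoeffs (fun x => ∑ j, f x j • G j x) = nonlin (fourierCoeffs f) b := by
  funext k
  refine ((hasSum_euclidean fun i => ?_).tsum_eq).symm
  -- Only square integrability of the two factors is used, so the formula holds for strong solutions
  -- as well as for smooth fields.
  have h := hasSum_sum fun j (_ : j ∈ (Finset.univ : Finset (Fin 3))) =>
    hasSum_scalarCoeff_mul (memLp_component hf j) (memLp_component (hG j) i) k
  have hi : ∀ j, Integrable (fun x => character (-k) x * (((f x j : ℝ) : ℂ) * ((G j x i : ℝ) : ℂ)))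
      volume := fun j => by
    refine (memLp_mul_component_integrable hf (hG j) i j).bdd_mul (c := 1)
      (continuous_character _).aestronglyMeasurable (Eventually.of_forall fun x => ?_)
    rw [norm_character]
  convert h using 1
  · funext l
    rw [modeProduct, PiLp.smul_apply, smul_eq_mul, Finset.sum_mul]
    refine Finset.sum_congr rfl fun j _ => ?_
    rw [← fourierCoeffs_apply, ← fourierCoeffs_apply, hb, coeffD, PiLp.smul_apply, smul_eq_mul]
    ring_nf
  · rw [fourierCoeffs_apply]
    simp only [scalarCoeff]
    rw [← Finset.mul_sum, ← integral_finsetSum _ fun j _ => hi j]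
    congr 2
    funext x
    rw [← Finset.mul_sum]
    congr 1
    simp

end Burgers
end

noncomputable section
namespace Burgers
open scoped ComplexConjugate

/-! ### Restriction, translation and gluing of solutions -/

lemma IsMajorant.add {m m' : (Fin 3 → ℤ) → ℝ} (h : IsMajorant m) (h' : IsMajorant m') :
    IsMajorant (fun k => m k + m' k) := by
  refine ⟨fun k => add_nonneg (h.1 k) (h'.1 k), ?_⟩
  refine Summable.of_nonneg_of_le (fun k => mul_nonneg (wt_pos k).le (sq_nonneg _)) (fun k => ?_)
    ((h.2.mul_left 2).add (h'.2.mul_left 2))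
  nlinarith [mul_nonneg (wt_pos k).le (sq_nonneg (m k - m' k))]

section algebra

variable {ν a b : ℝ} {c d : ℝ → Coeffs}

lemma IsCoeffSolution.intervalIntegrable_rhs (h : IsCoeffSolution ν a b c) {s t : ℝ}
    (hs : s ∈ Icc a b) (ht : t ∈ Icc a b) (k : Fin 3 → ℤ) :
    IntervalIntegrable (fun r => rhs ν (c r) k) volume s t :=
  ((h.continuousOn_rhs k).mono (uIcc_subset_Icc hs ht)).intervalIntegrable

lemma IsCoeffSolution.eq_add (h : IsCoeffSolution ν a b c) {s t : ℝ}
    (hs : s ∈ Icc a b) (ht : t ∈ Icc a b) (k : Fin 3 → ℤ) :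
    c t k = c s k + ∫ r in s..t, rhs ν (c r) k := by
  have ha : a ∈ Icc a b := ⟨le_rfl, hs.1.trans hs.2⟩
  rw [h.eq t ht k, h.eq s hs k, add_assoc, intervalIntegral.integral_add_adjacent_intervals
    (h.intervalIntegrable_rhs ha hs k) (h.intervalIntegrable_rhs hs ht k)]

lemma IsCoeffSolution.restrict (h : IsCoeffSolution ν a b c) {a' b' : ℝ} (ha : a ≤ a')
    (hab : a' ≤ b') (hb : b' ≤ b) : IsCoeffSolution ν a' b' c where
  continuousOn k := (h.continuousOn k).mono (Icc_subset_Icc ha hb)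
  exists_majorant := by
    obtain ⟨m, hm, hc⟩ := h.exists_majorant
    exact ⟨m, hm, fun t ht => hc t ⟨ha.trans ht.1, ht.2.trans hb⟩⟩
  eq t ht k := h.eq_add ⟨ha, hab.trans hb⟩ ⟨ha.trans ht.1, ht.2.trans hb⟩ k

lemma IsCoeffSolution.congr (h : IsCoeffSolution ν a b c) (hcd : ∀ t ∈ Icc a b, c t = d t) :
    IsCoeffSolution ν a b d where
  continuousOn k := (h.continuousOn k).congr fun t ht => congrFun (hcd t ht).symm k
  exists_majorant := by
    obtain ⟨m, hm, hc⟩ := h.exists_majorant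
    exact ⟨m, hm, fun t ht k => hcd t ht ▸ hc t ht k⟩
  eq t ht k := by
    have ha : a ∈ Icc a b := ⟨le_rfl, ht.1.trans ht.2⟩
    rw [← hcd t ht, ← hcd a ha, h.eq t ht k]
    congr 1
    refine intervalIntegral.integral_congr fun s hs => ?_
    rw [hcd s (uIcc_subset_Icc ha ht hs)]

lemma IsCoeffSolution.translate (h : IsCoeffSolution ν a b c) (r : ℝ) :
    IsCoeffSolution ν (a - r) (b - r) fun t => c (t + r) := by
  have hmaps : ∀ t ∈ Icc (a - r) (b - r), t + r ∈ Icc a b := fun t ht =>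
    ⟨by linarith [ht.1], by linarith [ht.2]⟩
  refine ⟨fun k => ?_, ?_, fun t ht k => ?_⟩
  · exact (h.continuousOn k).comp (by fun_prop) hmaps
  · obtain ⟨m, hm, hc⟩ := h.exists_majorant
    exact ⟨m, hm, fun t ht => hc _ (hmaps t ht)⟩
  · rw [h.eq _ (hmaps t ht) k, intervalIntegral.integral_comp_add_right (fun s => rhs ν (c s) k),
      sub_add_cancel]

lemma IsCoeffSolution.glue {e : ℝ} (h : IsCoeffSolution ν a b c) (h' : IsCoeffSolution ν b e c)
    (hab : a ≤ b) (hbe : b ≤ e) : IsCoeffSolution ν a e c where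
  continuousOn k := by
    rw [← Icc_union_Icc_eq_Icc hab hbe]
    exact (h.continuousOn k).union_of_isClosed (h'.continuousOn k) isClosed_Icc isClosed_Icc
  exists_majorant := by
    obtain ⟨m, hm, hc⟩ := h.exists_majorant
    obtain ⟨m', hm', hc'⟩ := h'.exists_majorant
    refine ⟨_, hm.add hm', fun t ht k => ?_⟩
    rcases le_total t b with htb | htb
    · exact (hc t ⟨ht.1, htb⟩ k).trans (le_add_of_nonneg_right (hm'.1 k))
    · exact (hc' t ⟨htb, ht.2⟩ k).trans (le_add_of_nonneg_left (hm.1 k))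
  eq t ht k := by
    rcases le_total t b with htb | htb
    · exact h.eq t ⟨ht.1, htb⟩ k
    · have hb : b ∈ Icc b e := ⟨le_rfl, hbe⟩
      have hb' : b ∈ Icc a b := ⟨hab, le_rfl⟩
      have ha' : a ∈ Icc a b := ⟨le_rfl, hab⟩
      rw [h'.eq t ⟨htb, ht.2⟩ k, h.eq b hb' k, add_assoc,
        intervalIntegral.integral_add_adjacent_intervals (h.intervalIntegrable_rhs ha' hb' k)
          (h'.intervalIntegrable_rhs hb ⟨htb, ht.2⟩ k)]

lemma IsCoeffSolution.unique (hν : 0 < ν) (h : IsCoeffSolution ν a b c)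
    (h' : IsCoeffSolution ν a b d) (h0 : c a = d a) : ∀ t ∈ Icc a b, c t = d t := by
  intro t ht
  have hab : 0 ≤ b - a := by linarith [ht.1, ht.2]
  have h1 := h.translate a
  have h2 := h'.translate a
  rw [sub_self] at h1 h2
  have := (h1.isWeakCoeffSolution hab).unique hν (h2.isWeakCoeffSolution hab)
    (by simpa only [zero_add] using h0) (t - a) ⟨by linarith [ht.1], by linarith [ht.2]⟩
  simpa only [sub_add_cancel] using this

lemma IsCoeffSolution.hasDerivAt (h : IsCoeffSolution ν a b c) {t : ℝ} (ht : t ∈ Ioo a b)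
    (k : Fin 3 → ℤ) : HasDerivAt (fun t => c t k) (rhs ν (c t) k) t := by
  have ht' := Ioo_subset_Icc_self ht
  have ha : a ∈ Icc a b := ⟨le_rfl, ht'.1.trans ht'.2⟩
  have hn : Icc a b ∈ 𝓝 t := Icc_mem_nhds ht.1 ht.2
  have h1 : HasDerivAt (fun t => c a k + ∫ s in a..t, rhs ν (c s) k) (rhs ν (c t) k) t := by
    refine (intervalIntegral.integral_hasDerivAt_right (h.intervalIntegrable_rhs ha ht' k) ?_
      ((h.continuousOn_rhs k).continuousAt hn)).const_add _
    exact (h.continuousOn_rhs k).stronglyMeasurableAtFilter_nhdsWithin measurableSet_Icc t |>.filter_mono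
      (by rw [nhdsWithin_eq_nhds.2 hn])
  refine h1.congr_of_eventuallyEq ?_
  filter_upwards [hn] with s hs using h.eq s hs k

end algebra

/-! ### Smoothing -/

lemma maxNorm_sq_ge (k : Fin 3 → ℤ) : wt k ≤ 3 * (1 + (maxNorm k : ℝ)) ^ 2 := by
  have h : ∀ i ∈ Finset.univ, (k i : ℝ) ^ 2 ≤ (maxNorm k : ℝ) ^ 2 := fun i _ => by
    rw [← sq_abs (k i : ℝ), ← Int.cast_abs, Int.abs_eq_natAbs, Int.cast_natCast]
    exact pow_le_pow_left₀ (Nat.cast_nonneg _) (Nat.cast_le.2 (natAbs_le_maxNorm k i)) 2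
  have h2 := Finset.sum_le_sum h
  simp only [Finset.sum_const, Finset.card_univ, Fintype.card_fin, nsmul_eq_mul] at h2
  push_cast at h2
  rw [wt_eq, sqNorm]
  nlinarith [(Nat.cast_nonneg (maxNorm k) : (0 : ℝ) ≤ maxNorm k)]

lemma summable_wt_sq_inv : Summable fun k => (wt k ^ 2)⁻¹ := by
  have h := lattice_sum_le le_rfl
  have h1 : Summable fun k => (wt k * (1 ^ 2 + wt k))⁻¹ := by
    have h0 : ∀ k, 0 ≤ (wt k * (1 ^ 2 + wt k))⁻¹ := fun k => by
      have := (wt_pos k).le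
      positivity
    have := ENNReal.summable_toReal (h.trans_lt ENNReal.ofReal_lt_top).ne
    simpa only [ENNReal.toReal_ofReal (h0 _)] using this
  refine Summable.of_nonneg_of_le (fun k => by positivity) (fun k => ?_) (h1.mul_left 2)
  have h1 := one_le_wt k
  have h2 : 0 < wt k := wt_pos k
  rw [← div_eq_mul_inv, inv_eq_one_div, div_le_div_iff₀ (by positivity) (by positivity)]
  nlinarith

/-- Families of Fourier coefficients that decay faster than any power. -/
def IsRapid (m : (Fin 3 → ℤ) → ℝ) : Prop :=
  (∀ k, 0 ≤ m k) ∧ ∀ p : ℕ, Summable fun k => wt k ^ p * m k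

lemma IsRapid.summable {m : (Fin 3 → ℤ) → ℝ} (h : IsRapid m) : Summable m := by
  simpa using h.2 0

lemma IsRapid.mul_wt_pow {m : (Fin 3 → ℤ) → ℝ} (h : IsRapid m) (q : ℕ) :
    IsRapid fun k => wt k ^ q * m k :=
  ⟨fun k => mul_nonneg (pow_nonneg (wt_pos k).le _) (h.1 k), fun p => by
    simpa only [← mul_assoc, ← pow_add] using h.2 (p + q)⟩

lemma IsRapid.const_mul {m : (Fin 3 → ℤ) → ℝ} (h : IsRapid m) {C : ℝ} (hC : 0 ≤ C) :
    IsRapid fun k => C * m k :=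
  ⟨fun k => mul_nonneg hC (h.1 k), fun p => by
    simpa only [mul_left_comm] using (h.2 p).mul_left C⟩

lemma isRapid_exp {α : ℝ} (hα : 0 < α) : IsRapid fun k => Real.exp (-(α * maxNorm k)) := by
  refine ⟨fun k => (Real.exp_pos _).le, fun p => ?_⟩
  -- From xⁿ/n! ≤ eˣ with n = 2(p+2) at x = α(1+|k|_∞), together with wt k ≤ 3(1+|k|_∞)². The two
  -- surplus powers of wt are spent on the summability of wt⁻².
  set B : ℝ := 3 ^ (p + 2) * ((2 * (p + 2)).factorial / α ^ (2 * (p + 2))) * Real.exp α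
  refine Summable.of_nonneg_of_le (fun k => mul_nonneg (pow_nonneg (wt_pos k).le _)
    (Real.exp_pos _).le) (fun k => ?_) (summable_wt_sq_inv.mul_left B)
  have hw := wt_pos k
  have h1 : wt k ^ (p + 2) ≤ 3 ^ (p + 2) * (1 + (maxNorm k : ℝ)) ^ (2 * (p + 2)) := by
    rw [pow_mul, ← mul_pow]
    exact pow_le_pow_left₀ hw.le (maxNorm_sq_ge k) _
  have h2 : (1 + (maxNorm k : ℝ)) ^ (2 * (p + 2)) ≤
      ((2 * (p + 2)).factorial / α ^ (2 * (p + 2))) * (Real.exp α * Real.exp (α * maxNorm k)) := by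
    have := Real.pow_div_factorial_le_exp (α * (1 + maxNorm k)) (by positivity) (2 * (p + 2))
    rw [← Real.exp_add, div_mul_eq_mul_div, le_div_iff₀ (by positivity), mul_comm, ← mul_pow]
    rw [div_le_iff₀ (by positivity)] at this
    convert this using 1
    rw [mul_comm, show α + α * maxNorm k = α * (1 + maxNorm k) by ring]
  have h3 : wt k ^ (p + 2) ≤ B * Real.exp (α * maxNorm k) := by
    refine h1.trans ((mul_le_mul_of_nonneg_left h2 (by positivity)).trans_eq ?_)
    ring
  beta_reduce
  rw [Real.exp_neg, ← div_eq_mul_inv, ← div_eq_mul_inv, div_le_div_iff₀ (Real.exp_pos _)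
    (by positivity), ← pow_add]
  exact h3

section smoothing

variable {ν a b : ℝ} {c : ℝ → Coeffs}

/-- For each t the local theory is restarted at t-η. By uniqueness its solution is the given one, so
after the time η the modes carry the factor e^{-νη|k|_∞/2}. Since η depends only on the H¹ bound and
on a'-a, the majorant is the same for all t ≥ a'. -/
lemma IsCoeffSolution.exists_isRapid (hν : 0 < ν) (h : IsCoeffSolution ν a b c) {a' : ℝ}
    (ha : a < a') : ∃ m, IsRapid m ∧ ∀ t ∈ Icc a' b, ∀ k, ‖c t k‖ ≤ m k := by
  obtain ⟨m, hm, hc⟩ := h.exists_majorant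
  set M : ℝ := √(∑' k, wt k * m k ^ 2) + 1
  have hM : 0 < M := by positivity
  have hM2 : (∑' k, wt k * m k ^ 2) ≤ M ^ 2 := by
    have h0 : 0 ≤ ∑' k, wt k * m k ^ 2 :=
      tsum_nonneg fun k => mul_nonneg (wt_pos k).le (sq_nonneg _)
    have := Real.sq_sqrt h0
    nlinarith [Real.sqrt_nonneg (∑' k, wt k * m k ^ 2)]
  obtain ⟨δ, hδ, hloc⟩ := exists_local_solution hν hM
  set η := min δ (a' - a)
  have hη : 0 < η := lt_min hδ (by linarith)
  refine ⟨fun k => 2 * M * Real.exp (-(ν / 2 * η * maxNorm k)),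
    (isRapid_exp (by positivity)).const_mul (by positivity), fun t ht k => ?_⟩
  have hηa : η ≤ a' - a := min_le_right _ _
  have hs : t - η ∈ Icc a b := ⟨by linarith [ht.1], by linarith [ht.2]⟩
  obtain ⟨d, hd0, hd, hdec⟩ := hloc (c (t - η)) ((sobolevSq_one_le_of_norm_le hm (hc _ hs)).trans
    (ENNReal.ofReal_le_ofReal hM2))
  have h1 := (h.restrict hs.1 (by linarith : t - η ≤ t) ht.2).translate (t - η)
  rw [sub_self, sub_sub_cancel] at h1
  have h2 := h1.unique hν (hd.restrict le_rfl hη.le (min_le_left _ _))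
    (by rw [zero_add, hd0]) η ⟨hη.le, le_rfl⟩
  rw [add_sub_cancel] at h2
  rw [h2]
  refine (hdec η ⟨hη.le, min_le_left _ _⟩ k).trans_eq ?_
  rw [mul_comm]
  congr 2
  ring_nf

end smoothing

/-! ### Reality -/

/-- Complex conjugation on `ℂ³`. -/
def conjV : EuclideanSpace ℂ (Fin 3) →L[ℝ] EuclideanSpace ℂ (Fin 3) :=
  LinearMap.mkContinuous
    { toFun := fun z => WithLp.toLp 2 fun i => conj (z i)
      map_add' := fun z w => by ext i; simp
      map_smul' := fun r z => by ext i; simp }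
    1 fun z => by
      rw [one_mul, EuclideanSpace.norm_eq, EuclideanSpace.norm_eq]
      simp

@[simp] lemma conjV_apply (z : EuclideanSpace ℂ (Fin 3)) (i : Fin 3) : conjV z i = conj (z i) := rfl

lemma norm_conjV (z : EuclideanSpace ℂ (Fin 3)) : ‖conjV z‖ = ‖z‖ := by
  rw [EuclideanSpace.norm_eq, EuclideanSpace.norm_eq]
  simp

/-- The Fourier coefficients of the complex conjugate. -/
def reflect (c : Coeffs) : Coeffs := fun k => conjV (c (-k))

lemma isReal_iff_reflect (c : Coeffs) : IsReal c ↔ reflect c = c := by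
  constructor
  · intro h
    funext k
    ext i
    rw [reflect, conjV_apply, h, Complex.conj_conj]
  · intro h k i
    conv_rhs => rw [← h]
    rw [reflect, conjV_apply, Complex.conj_conj]

lemma conjV_modeProduct (m : Fin 3 → ℤ) (a b : EuclideanSpace ℂ (Fin 3)) :
    conjV (modeProduct m a b) = modeProduct (-m) (conjV a) (conjV b) := by
  ext i
  simp [modeProduct]

lemma nonlin_reflect {a b : Coeffs} (ha : sobolevSq 1 a < ⊤) (hb : sobolevSq 1 b < ⊤)
    (k : Fin 3 → ℤ) : nonlin (reflect a) (reflect b) k = conjV (nonlin a b (-k)) := by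
  have h := (summable_modeProduct ha hb (-k)).hasSum.mapL conjV
  refine Eq.trans ?_ h.tsum_eq
  rw [nonlin, ← (Equiv.neg (Fin 3 → ℤ)).tsum_eq]
  refine tsum_congr fun l => ?_
  rw [conjV_modeProduct, reflect, reflect, Equiv.neg_apply, neg_neg]
  congr 2 <;> abel_nf

lemma rhs_reflect (ν : ℝ) {c : Coeffs} (hc : sobolevSq 1 c < ⊤) (k : Fin 3 → ℤ) :
    rhs ν (reflect c) k = conjV (rhs ν c (-k)) := by
  rw [rhs, nonlin_reflect hc hc, rhs, map_sub, map_neg, map_smul]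
  simp [reflect, sqNorm]

lemma IsReal.rhs (ν : ℝ) {c : Coeffs} (hc : sobolevSq 1 c < ⊤) (hr : IsReal c) :
    IsReal (rhs ν c) := by
  rw [isReal_iff_reflect] at *
  funext k
  rw [reflect, ← rhs_reflect ν hc, hr]

lemma IsCoeffSolution.sobolevSq_one_lt_top {ν a b : ℝ} {c : ℝ → Coeffs}
    (h : IsCoeffSolution ν a b c) {t : ℝ} (ht : t ∈ Icc a b) : sobolevSq 1 (c t) < ⊤ := by
  obtain ⟨m, hm, hc⟩ := h.exists_majorant
  exact (sobolevSq_one_le_of_norm_le hm (hc t ht)).trans_lt ENNReal.ofReal_lt_top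

lemma IsCoeffSolution.reflect {ν a b : ℝ} {c : ℝ → Coeffs} (h : IsCoeffSolution ν a b c) :
    IsCoeffSolution ν a b fun t => reflect (c t) where
  continuousOn k := conjV.continuous.comp_continuousOn (h.continuousOn (-k))
  exists_majorant := by
    obtain ⟨m, hm, hc⟩ := h.exists_majorant
    refine ⟨fun k => m (-k), ⟨fun k => hm.1 _, ?_⟩, fun t ht k => ?_⟩
    · have := (Equiv.neg (Fin 3 → ℤ)).summable_iff.2 hm.2
      simpa only [Function.comp_def, Equiv.neg_apply, wt_neg] using this
    · rw [Burgers.reflect, norm_conjV]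
      exact hc t ht _
  eq t ht k := by
    have ha : a ∈ Icc a b := ⟨le_rfl, ht.1.trans ht.2⟩
    have e : ∫ s in a..t, rhs ν (Burgers.reflect (c s)) k =
        ∫ s in a..t, conjV (rhs ν (c s) (-k)) :=
      intervalIntegral.integral_congr fun s hs =>
        rhs_reflect ν (h.sobolevSq_one_lt_top (uIcc_subset_Icc ha ht hs)) k
    rw [e, conjV.intervalIntegral_comp_comm (h.intervalIntegrable_rhs ha ht _)]
    rw [Burgers.reflect, h.eq t ht, map_add, Burgers.reflect]

/-- The reflected conjugate family solves the same system, and has the same initial value when that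
value is real. -/
lemma IsCoeffSolution.isReal {ν a b : ℝ} (hν : 0 < ν) {c : ℝ → Coeffs}
    (h : IsCoeffSolution ν a b c) (h0 : IsReal (c a)) : ∀ t ∈ Icc a b, IsReal (c t) := by
  intro t ht
  rw [isReal_iff_reflect] at h0 ⊢
  exact h.reflect.unique hν h h0 t ht

end Burgers
end

noncomputable section
namespace Burgers
open scoped ComplexConjugate

/-! ### The classical form of the equation -/

lemma tsum_conv (a b : (Fin 3 → ℤ) → ENNReal) : ∑' k, conv a b k = (∑' k, a k) * ∑' k, b k := by
  unfold conv
  rw [ENNReal.tsum_comm, ← ENNReal.tsum_mul_right]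
  refine tsum_congr fun l => ?_
  rw [ENNReal.tsum_mul_left]
  congr 1
  exact (Equiv.subRight l).tsum_eq b

/-- A summable bound for `rhs ν c` when `c` is bounded by a rapidly decaying family. -/
def rhsBound (ν : ℝ) (m : (Fin 3 → ℤ) → ℝ) (k : Fin 3 → ℤ) : ℝ :=
  ν * (wt k * m k) + (conv (fun l => ENNReal.ofReal (m l)) (fun l => ENNReal.ofReal (wt l * m l)) k).toReal

section rapid

variable {m : (Fin 3 → ℤ) → ℝ} (hm : IsRapid m)
include hm

lemma IsRapid.tsum_conv_lt_top : ∑' k, conv (fun l => ENNReal.ofReal (m l))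
    (fun l => ENNReal.ofReal (wt l * m l)) k < ⊤ := by
  have h1 : Summable fun k => wt k * m k := by simpa using hm.2 1
  rw [tsum_conv, ← ENNReal.ofReal_tsum_of_nonneg hm.1 hm.summable, ← ENNReal.ofReal_tsum_of_nonneg
    (fun k => mul_nonneg (wt_pos k).le (hm.1 k)) h1]
  exact ENNReal.mul_lt_top ENNReal.ofReal_lt_top ENNReal.ofReal_lt_top

lemma IsRapid.summable_rhsBound (ν : ℝ) : Summable (rhsBound ν m) := by
  have h1 : Summable fun k => wt k * m k := by simpa using hm.2 1
  exact (h1.mul_left ν).add (ENNReal.summable_toReal hm.tsum_conv_lt_top.ne)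

lemma IsRapid.isMajorant : IsMajorant m := by
  refine ⟨hm.1, ?_⟩
  have h1 : Summable fun k => wt k * m k := by simpa using hm.2 1
  have h2 : ∀ k, m k ≤ ∑' k, m k := fun k => hm.summable.le_tsum k fun l _ => hm.1 l
  refine Summable.of_nonneg_of_le (fun k => mul_nonneg (wt_pos k).le (sq_nonneg _)) (fun k => ?_)
    (h1.mul_right (∑' k, m k))
  rw [sq, ← mul_assoc]
  exact mul_le_mul_of_nonneg_left (h2 k) (mul_nonneg (wt_pos k).le (hm.1 k))

variable {c : Coeffs} (hc : ∀ k, ‖c k‖ ≤ m k)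
include hc

lemma IsRapid.norm_nonlin_le (k : Fin 3 → ℤ) :
    ‖nonlin c c k‖ ≤ (conv (fun l => ENNReal.ofReal (m l))
      (fun l => ENNReal.ofReal (wt l * m l)) k).toReal := by
  have h := (ENNReal.le_tsum k).trans_lt hm.tsum_conv_lt_top
  rw [← toReal_enorm]
  refine ENNReal.toReal_mono h.ne ((enorm_nonlin_le c c k).trans ?_)
  refine ENNReal.tsum_le_tsum fun l => ?_
  refine mul_le_mul' ?_ ?_
  · rw [absCoeffs, ← ofReal_norm]
    exact ENNReal.ofReal_le_ofReal (hc l)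
  · rw [absGrad, ← ofReal_norm, ← ENNReal.ofReal_mul (Real.sqrt_nonneg _)]
    refine ENNReal.ofReal_le_ofReal (mul_le_mul ?_ (hc _) (norm_nonneg _) (wt_pos _).le)
    exact Real.sqrt_le_iff.2 ⟨(wt_pos _).le, le_self_pow₀ (one_le_wt _) two_ne_zero⟩

lemma IsRapid.norm_rhs_le {ν : ℝ} (hν : 0 < ν) (k : Fin 3 → ℤ) : ‖rhs ν c k‖ ≤ rhsBound ν m k := by
  refine (norm_sub_le _ _).trans (add_le_add ?_ (hm.norm_nonlin_le hc k))
  rw [norm_neg, norm_smul, Real.norm_eq_abs, abs_mul, abs_of_pos hν, mul_assoc,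
    abs_of_nonneg (sqNorm_nonneg k)]
  have : sqNorm k ≤ wt k := by rw [wt_eq]; linarith
  exact mul_le_mul_of_nonneg_left (mul_le_mul this (hc k) (norm_nonneg _) (wt_pos k).le) hν.le

lemma IsRapid.summable_norm (p : ℕ) : Summable fun k => wt k ^ p * ‖c k‖ :=
  Summable.of_nonneg_of_le (fun k => mul_nonneg (pow_nonneg (wt_pos k).le _) (norm_nonneg _))
    (fun k => mul_le_mul_of_nonneg_left (hc k) (pow_nonneg (wt_pos k).le _)) (hm.2 p)

end rapid

lemma synth_sub {c d : Coeffs} (hc : Summable fun k => ‖c k‖) (hd : Summable fun k => ‖d k‖) :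
    synth (fun k => c k - d k) = synth c - synth d := by
  simp only [synth, map_sub]
  exact (summable_modeL hc).tsum_sub (summable_modeL hd)

lemma synth_smul (r : ℝ) {c : Coeffs} (hc : Summable fun k => ‖c k‖) :
    synth (fun k => r • c k) = r • synth c := by
  simp only [synth, map_smul]
  exact ((summable_modeL hc).hasSum.const_smul r).tsum_eq

lemma synth_sum {c : Fin 3 → Coeffs} (hc : ∀ j, Summable fun k => ‖c j k‖) :
    synth (fun k => ∑ j, c j k) = ∑ j, synth (c j) := by
  simp only [synth, map_sum]
  exact (hasSum_sum fun j _ => (summable_modeL (hc j)).hasSum).tsum_eq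

lemma laplacian_coeff (c : Coeffs) (k : Fin 3 → ℤ) :
    (-sqNorm k) • c k = ∑ j, coeffD j (coeffD j c) k := by
  simp only [coeffD, smul_smul, ← Finset.sum_smul]
  rw [← Complex.coe_smul]
  congr 1
  simp only [sqNorm]
  push_cast
  rw [← Finset.sum_neg_distrib]
  refine Finset.sum_congr rfl fun j _ => ?_
  rw [mul_mul_mul_comm, Complex.I_mul_I]
  ring

lemma norm_coeffD_le_of_le {m : (Fin 3 → ℤ) → ℝ} {c : Coeffs} (hc : ∀ k, ‖c k‖ ≤ m k) (j : Fin 3)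
    (k : Fin 3 → ℤ) : ‖coeffD j c k‖ ≤ wt k ^ 1 * m k := by
  rw [pow_one]
  exact (norm_coeffD_le j c k).trans (mul_le_mul_of_nonneg_left (hc k) (wt_pos k).le)

section smooth

variable {m : (Fin 3 → ℤ) → ℝ} (hm : IsRapid m) {c : Coeffs} (hc : ∀ k, ‖c k‖ ≤ m k)
include hm hc

lemma IsRapid.isCn (n : ℕ) : IsCn n (synth c) := isCn_synth (hm.summable_norm hc n)

lemma IsRapid.partialD_eq (j : Fin 3) : partialD j (synth c) = synth (coeffD j c) :=
  partialD_synth (by simpa using hm.summable_norm hc 1) j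

lemma IsRapid.fourierCoeffs_synth_coeffD (hr : IsReal c) (j : Fin 3) :
    fourierCoeffs (synth (coeffD j c)) = coeffD j c :=
  fourierCoeffs_synth (by simpa using (hm.mul_wt_pow 1).summable_norm (norm_coeffD_le_of_le hc j) 0)
    (isReal_coeffD hr j)

lemma IsRapid.fourierCoeffs_synth (hr : IsReal c) : fourierCoeffs (synth c) = c :=
  Burgers.fourierCoeffs_synth (by simpa using hm.summable_norm hc 0) hr

lemma IsRapid.fourierCoeffs_transport (hr : IsReal c) :
    fourierCoeffs (fun x => ∑ j, synth c x j • partialD j (synth c) x) = nonlin c c := by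
  simp only [hm.partialD_eq hc]
  have h := fourierCoeffs_sum_smul (f := synth c) (G := fun j => synth (coeffD j c)) (b := c)
    (synth c).continuous.memLp_two (fun j => (synth (coeffD j c)).continuous.memLp_two)
    fun j => hm.fourierCoeffs_synth_coeffD hc hr j
  rwa [hm.fourierCoeffs_synth hc hr] at h

/-- The bridge from the coefficient system to the pointwise equation. The transport term is a
continuous function with summable coefficients `nonlin c c`, hence equals the sum of its Fourier
series everywhere. -/
lemma IsRapid.synth_rhs {ν : ℝ} (hr : IsReal c) (x : T3) :
    synth (rhs ν c) x = ν • ∑ j, partialD j (partialD j (synth c)) x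
      - ∑ j, synth c x j • partialD j (synth c) x := by
  have hn : Summable fun k => ‖nonlin c c k‖ := Summable.of_nonneg_of_le (fun _ => norm_nonneg _)
    (hm.norm_nonlin_le hc) (ENNReal.summable_toReal hm.tsum_conv_lt_top.ne)
  have h2 : ∀ j k, ‖coeffD j (coeffD j c) k‖ ≤ wt k ^ 1 * (wt k ^ 1 * m k) := fun j k =>
    norm_coeffD_le_of_le (norm_coeffD_le_of_le hc j) j k
  have h2s : ∀ j, Summable fun k => ‖coeffD j (coeffD j c) k‖ := fun j => by
    simpa using ((hm.mul_wt_pow 1).mul_wt_pow 1).summable_norm (h2 j) 0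
  have hl : Summable fun k => ‖∑ j, coeffD j (coeffD j c) k‖ :=
    Summable.of_nonneg_of_le (fun _ => norm_nonneg _) (fun k => norm_sum_le _ _)
      (summable_sum fun j _ => h2s j)
  have e : rhs ν c = fun k => ν • (∑ j, coeffD j (coeffD j c) k) - nonlin c c k := by
    funext k
    rw [← laplacian_coeff, rhs, smul_smul, ← neg_smul, mul_neg]
  have hls : Summable fun k => ‖ν • ∑ j, coeffD j (coeffD j c) k‖ := by
    simpa only [norm_smul] using hl.mul_left ‖ν‖
  have e2 : (synth (nonlin c c) : T3 → V3) = fun x => ∑ j, synth c x j • partialD j (synth c) x := by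
    have hcont : Continuous fun x => ∑ j, synth c x j • partialD j (synth c) x := by
      simp only [hm.partialD_eq hc]
      refine continuous_finsetSum _ fun j _ =>
        Continuous.smul (f := fun x => synth c x j) ?_ (synth (coeffD j c)).continuous
      exact (EuclideanSpace.proj (𝕜 := ℝ) j).continuous.comp (map_continuous _)
    have := synth_fourierCoeffs hcont (by rwa [hm.fourierCoeffs_transport hc hr])
    rwa [hm.fourierCoeffs_transport hc hr] at this
  have e3 : ∀ j, partialD j (partialD j (synth c)) = synth (coeffD j (coeffD j c)) := fun j => by
    rw [hm.partialD_eq hc, (hm.mul_wt_pow 1).partialD_eq (norm_coeffD_le_of_le hc j)]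
  rw [e, synth_sub hls hn, synth_smul ν hl, synth_sum h2s]
  simp only [e3]
  rw [ContinuousMap.sub_apply, ContinuousMap.smul_apply, ContinuousMap.sum_apply, congrFun e2 x]

end smooth

/-! ### The maximum principle -/

/-- If f'' were positive, the second derivative test would make x a local minimum too; then f is
locally constant and f'' = 0, a contradiction. -/
lemma deriv_deriv_nonpos_of_isLocalMax {f : ℝ → ℝ} {x : ℝ} (h : IsLocalMax f x)
    (hf : ContinuousAt f x) : deriv (deriv f) x ≤ 0 := by
  by_contra! h0
  have h1 := isLocalMin_of_deriv_deriv_pos h0 h.deriv_eq_zero hf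
  have h2 : f =ᶠ[𝓝 x] fun _ => f x := by
    filter_upwards [h, h1] with y hy hy' using le_antisymm hy hy'
  have h3 := h2.deriv.deriv_eq
  simp at h3
  linarith

/-- Along the j-th coordinate line through x, g = |f|² has g' = 2f·∂f and g'' = 2(f·∂²f+|∂f|²). At
the maximum g' = 0 and g'' ≤ 0, and the term |∂f|² may be dropped. -/
lemma inner_partialD_of_isMax {f : T3 → V3} (hf : IsCn 2 f) {x : T3}
    (hx : ∀ y, ‖f y‖ ^ 2 ≤ ‖f x‖ ^ 2) (j : Fin 3) :
    inner ℝ (f x) (partialD j f x) = 0 ∧ inner ℝ (f x) (partialD j (partialD j f) x) ≤ 0 := by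
  set τ : ℝ → T3 := fun h => x + Pi.single j (h : AddCircle (2 * Real.pi)) with hτ
  have hτ0 : τ 0 = x := by simp [hτ, QuotientAddGroup.mk_zero]
  have h1 : ∀ s, HasDerivAt (fun r => f (τ r)) (partialD j f (τ s)) s :=
    fun s => hf.hasDerivAt one_le_two j x s
  have hf1 : IsCn 1 (partialD j f) := by
    have e : periodicLift (partialD j f) = fun y => fderiv ℝ (periodicLift f) y (Pi.single j 1) :=
      funext fun y => partialD_toTorus (ContDiff.differentiable hf two_ne_zero) j y
    rw [IsCn, e]
    exact (ContDiff.fderiv_right hf (by norm_num)).clm_apply contDiff_const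
  have h2 : ∀ s, HasDerivAt (fun r => partialD j f (τ r)) (partialD j (partialD j f) (τ s)) s :=
    fun s => hf1.hasDerivAt le_rfl j x s
  set g : ℝ → ℝ := fun r => ‖f (τ r)‖ ^ 2 with hg
  have hg1 : ∀ s, HasDerivAt g (2 * inner ℝ (f (τ s)) (partialD j f (τ s))) s :=
    fun s => (h1 s).norm_sq
  have hg2 : HasDerivAt (deriv g) (2 * (inner ℝ (f (τ 0)) (partialD j (partialD j f) (τ 0)) +
      inner ℝ (partialD j f (τ 0)) (partialD j f (τ 0)))) 0 := by
    rw [funext fun s => (hg1 s).deriv]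
    exact ((h1 0).inner ℝ (h2 0)).const_mul 2
  have hmax : IsLocalMax g 0 := Eventually.of_forall fun s => by
    simp only [hg, hτ0]
    exact hx _
  have hd := hmax.deriv_eq_zero
  have hdd := deriv_deriv_nonpos_of_isLocalMax hmax (hg1 0).continuousAt
  rw [hg2.deriv, hτ0] at hdd
  rw [(hg1 0).deriv, hτ0] at hd
  refine ⟨by linarith, ?_⟩
  have : 0 ≤ inner ℝ (partialD j f x) (partialD j f x) := real_inner_self_nonneg
  linarith

lemma _root_.HasDerivAt.nonneg_of_isMaxOn_left {g : ℝ → ℝ} {g' a t : ℝ} (h : HasDerivAt g g' t)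
    (hat : a < t) (hmax : ∀ s ∈ Icc a t, g s ≤ g t) : 0 ≤ g' := by
  by_contra! hg
  have h1 : Tendsto (slope g t) (𝓝[<] t) (𝓝 g') :=
    (hasDerivAt_iff_tendsto_slope.1 h).mono_left (nhdsWithin_mono _ fun s hs => ne_of_lt hs)
  have h2 := h1.eventually (gt_mem_nhds hg)
  have h3 : ∀ᶠ s in 𝓝[<] t, s ∈ Ioo a t := Ioo_mem_nhdsLT hat
  obtain ⟨s, hs, hs'⟩ := (h2.and h3).exists
  rw [slope_def_field] at hs
  have h4 := hmax s ⟨hs'.1.le, hs'.2.le⟩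
  have h5 : 0 ≤ (g s - g t) / (s - t) := div_nonneg_of_nonpos (by linarith) (by linarith [hs'.2])
  linarith

section maxPrinciple

variable {ν a b : ℝ} {c : ℝ → Coeffs}

lemma IsCoeffSolution.hasDerivAt_synth (hν : 0 < ν) (h : IsCoeffSolution ν a b c) {t : ℝ}
    (ht : t ∈ Ioo a b) : HasDerivAt (fun t => synth (c t)) (synth (rhs ν (c t))) t := by
  obtain ⟨a', ha, hat⟩ := exists_between ht.1
  obtain ⟨m, hm, hc⟩ := h.exists_isRapid hν ha
  exact Burgers.hasDerivAt_synth (a := a') (b := b)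
    (fun s hs k => h.hasDerivAt ⟨ha.trans hs.1, hs.2⟩ k) hm.summable
    (fun s hs => hc s (Ioo_subset_Icc_self hs)) (hm.summable_rhsBound ν)
    (fun s hs => hm.norm_rhs_le (hc s (Ioo_subset_Icc_self hs)) hν) ⟨hat, ht.2⟩

lemma IsCoeffSolution.continuousOn_synth (hν : 0 < ν) (h : IsCoeffSolution ν a b c) {a' : ℝ}
    (ha : a < a') : ContinuousOn (fun t => synth (c t)) (Icc a' b) := by
  obtain ⟨m, hm, hc⟩ := h.exists_isRapid hν ha
  exact Burgers.continuousOn_synth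
    (fun k => (h.continuousOn k).mono (Icc_subset_Icc_left ha.le)) hm.summable hc

/-- The maximum principle for |u|² - ε(s-a') on [a',t]×𝕋³. The start a' > a makes the solution
smooth up to the initial face, and t < b leaves room for a two-sided time derivative at the maximum.
-/
lemma IsCoeffSolution.norm_synth_le_of_lt (hν : 0 < ν) (h : IsCoeffSolution ν a b c)
    (hr : IsReal (c a)) {a' t : ℝ} (ha : a < a') (ht : t ∈ Ico a' b) :
    ‖synth (c t)‖ ≤ ‖synth (c a')‖ := by
  set K := ‖synth (c a')‖
  refine (ContinuousMap.norm_le _ (norm_nonneg _)).2 fun x => ?_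
  by_contra! hlt
  have hK : K ^ 2 < ‖synth (c t) x‖ ^ 2 := pow_lt_pow_left₀ hlt (norm_nonneg _) two_ne_zero
  have hta : a' < t := by
    refine lt_of_le_of_ne ht.1 ?_
    rintro rfl
    exact absurd (ContinuousMap.norm_coe_le_norm (synth (c a')) x) (not_le.2 hlt)
  -- Chosen so that the penalty at time t is half of the excess of |u(t,x)|² over K²; the maximum of
  -- the penalized function then still exceeds K² and cannot lie on the initial face.
  set ε := (‖synth (c t) x‖ ^ 2 - K ^ 2) / (2 * (t - a')) with hε
  have htpos : 0 < t - a' := sub_pos.2 hta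
  have hε0 : 0 < ε := div_pos (by linarith) (by linarith)
  have hεt : ε * (t - a') = (‖synth (c t) x‖ ^ 2 - K ^ 2) / 2 := by
    rw [hε]
    field_simp
  set g : ℝ × T3 → ℝ := fun p => ‖synth (c p.1) p.2‖ ^ 2 - ε * (p.1 - a') with hg
  have hcont : ContinuousOn g (Icc a' t ×ˢ univ) := by
    have h1 : ContinuousOn (fun p : ℝ × T3 => synth (c p.1)) (Icc a' t ×ˢ univ) :=
      ((h.continuousOn_synth hν ha).mono (Icc_subset_Icc_right ht.2.le)).comp
        continuousOn_fst fun p hp => hp.1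
    have h2 : ContinuousOn (fun p : ℝ × T3 => synth (c p.1) p.2) (Icc a' t ×ˢ univ) :=
      ContinuousEval.continuous_eval.comp_continuousOn (h1.prodMk continuousOn_snd)
    exact (h2.norm.pow 2).sub (by fun_prop)
  obtain ⟨⟨t₀, x₀⟩, hp, hmax⟩ := (isCompact_Icc.prod isCompact_univ).exists_isMaxOn
    ⟨(t, x), ⟨⟨hta.le, le_rfl⟩, mem_univ x⟩⟩ hcont
  have ht₀ : t₀ ∈ Icc a' t := hp.1
  have hval : K ^ 2 < g (t₀, x₀) := by
    have h1 : g (t, x) ≤ g (t₀, x₀) := hmax ⟨⟨hta.le, le_rfl⟩, mem_univ x⟩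
    have h2 : g (t, x) = ‖synth (c t) x‖ ^ 2 - ε * (t - a') := rfl
    linarith
  have hat₀ : a' < t₀ := by
    refine lt_of_le_of_ne ht₀.1 ?_
    rintro rfl
    have h1 : ‖synth (c a') x₀‖ ^ 2 ≤ K ^ 2 :=
      pow_le_pow_left₀ (norm_nonneg _) (ContinuousMap.norm_coe_le_norm _ x₀) 2
    simp only [hg, sub_self, mul_zero, sub_zero] at hval
    linarith
  have hin : t₀ ∈ Ioo a b := ⟨ha.trans hat₀, ht₀.2.trans_lt ht.2⟩
  obtain ⟨m, hm, hc⟩ := h.exists_isRapid hν ha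
  have hc₀ := hc t₀ ⟨hat₀.le, hin.2.le⟩
  have hreal := h.isReal hν hr t₀ (Ioo_subset_Icc_self hin)
  have hd : HasDerivAt (fun s => g (s, x₀))
      (2 * inner ℝ (synth (c t₀) x₀) (synth (rhs ν (c t₀)) x₀) - ε) t₀ := by
    have h1 : HasDerivAt (fun s => synth (c s) x₀) (synth (rhs ν (c t₀)) x₀) t₀ :=
      (ContinuousMap.evalCLM ℝ x₀ : C(T3, V3) →L[ℝ] V3).hasFDerivAt.comp_hasDerivAt t₀
        (h.hasDerivAt_synth hν hin)
    have h2 : HasDerivAt (fun s : ℝ => ε * (s - a')) ε t₀ := by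
      simpa using ((hasDerivAt_id t₀).sub_const a').const_mul ε
    exact h1.norm_sq.sub h2
  have h0 := hd.nonneg_of_isMaxOn_left hat₀ fun s hs =>
    hmax (show (s, x₀) ∈ Icc a' t ×ˢ univ from ⟨⟨hs.1, hs.2.trans ht₀.2⟩, mem_univ _⟩)
  have hx₀ : ∀ y, ‖synth (c t₀) y‖ ^ 2 ≤ ‖synth (c t₀) x₀‖ ^ 2 := fun y => by
    have := hmax (show (t₀, y) ∈ Icc a' t ×ˢ univ from ⟨ht₀, mem_univ _⟩)
    simp only [hg, mem_ofPred_eq] at this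
    linarith
  have htest := inner_partialD_of_isMax (hm.isCn hc₀ 2) hx₀
  -- At the maximum the transport terms vanish and the Laplacian contributes a nonpositive quantity,
  -- so the nonnegative time derivative would be at most -ε.
  rw [hm.synth_rhs hc₀ hreal, inner_sub_right, inner_smul_right, inner_sum, inner_sum] at h0
  simp only [inner_smul_right, (htest _).1, mul_zero, Finset.sum_const_zero, sub_zero] at h0
  have h3 := Finset.sum_nonpos fun j (_ : j ∈ (Finset.univ : Finset (Fin 3))) => (htest j).2
  nlinarith

/-- The endpoint b is reached by continuity in the supremum norm. -/
lemma IsCoeffSolution.norm_synth_le (hν : 0 < ν) (h : IsCoeffSolution ν a b c)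
    (hr : IsReal (c a)) {a' t : ℝ} (ha : a < a') (ht : t ∈ Icc a' b) :
    ‖synth (c t)‖ ≤ ‖synth (c a')‖ := by
  rcases eq_or_lt_of_le ht.1 with rfl | hat
  · rfl
  · have h1 : Tendsto (fun s => ‖synth (c s)‖) (𝓝[<] t) (𝓝 ‖synth (c t)‖) := by
      refine (((h.continuousOn_synth hν ha) t ht).norm).mono_left ?_
      rw [← nhdsWithin_Ico_eq_nhdsLT hat]
      exact nhdsWithin_mono _ fun s hs => ⟨hs.1, hs.2.le.trans ht.2⟩
    refine le_of_tendsto h1 ?_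
    filter_upwards [Ico_mem_nhdsLT hat] with s hs
    exact h.norm_synth_le_of_lt hν hr ha ⟨hs.1, hs.2.trans_le ht.2⟩

end maxPrinciple

end Burgers
end

noncomputable section
namespace Burgers
open scoped ComplexConjugate

/-! ### A priori bounds -/

/-- The differential form of Grönwall's inequality is applied to the primitive of `y`, which starts
at 0 and has right derivative at most A + B times itself. -/
lemma le_gronwallBound_of_le_integral {y : ℝ → ℝ} {a b A B : ℝ} (hy : ContinuousOn y (Icc a b))
    (hy0 : ∀ t ∈ Icc a b, 0 ≤ y t) (hB : 0 ≤ B)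
    (h : ∀ t ∈ Icc a b, y t ≤ A + B * ∫ s in a..t, y s) {t : ℝ} (ht : t ∈ Icc a b) :
    y t ≤ A + B * gronwallBound 0 B A (t - a) := by
  have ha : a ∈ Icc a b := ⟨le_rfl, ht.1.trans ht.2⟩
  have hint : ∀ s ∈ Icc a b, IntervalIntegrable y volume a s := fun s hs =>
    (hy.mono (uIcc_subset_Icc ha hs)).intervalIntegrable
  have hpos : ∀ s ∈ Icc a b, 0 ≤ ∫ r in a..s, y r := fun s hs =>
    intervalIntegral.integral_nonneg hs.1 fun r hr => hy0 r ⟨hr.1, hr.2.trans hs.2⟩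
  have hg := norm_le_gronwallBound_of_norm_deriv_right_le (f := fun s => ∫ r in a..s, y r)
    (f' := y) (δ := 0) (K := B) (ε := A) (a := a) (b := b) ?_ ?_ (by simp) ?_ t ht
  · rw [Real.norm_of_nonneg (hpos t ht)] at hg
    exact (h t ht).trans (by gcongr)
  · have := intervalIntegral.continuousOn_primitive_interval' (hint b ⟨ha.2, le_rfl⟩) left_mem_uIcc
    rwa [uIcc_of_le ha.2] at this
  · intro s hs
    have hs' : s ∈ Icc a b := ⟨hs.1, hs.2.le⟩
    refine intervalIntegral.integral_hasDerivWithinAt_right (hint s hs') (t := Ioi s) ?_ ?_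
    · refine (hy.stronglyMeasurableAtFilter_nhdsWithin measurableSet_Icc s).filter_mono ?_
      rw [← nhdsWithin_Ioc_eq_nhdsGT hs.2]
      exact nhdsWithin_mono _ fun r hr => ⟨hs.1.trans hr.1.le, hr.2⟩
    · refine (hy s hs').mono_left ?_
      rw [← nhdsWithin_Ioc_eq_nhdsGT hs.2]
      exact nhdsWithin_mono _ fun r hr => ⟨hs.1.trans hr.1.le, hr.2⟩
  · intro s hs
    have hs' : s ∈ Icc a b := ⟨hs.1, hs.2.le⟩
    rw [Real.norm_of_nonneg (hy0 s hs'), Real.norm_of_nonneg (hpos s hs'), add_comm]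
    exact h s hs'

/-- The squared `L²` norm of the gradient. -/
def gradSq (c : Coeffs) : ENNReal := ∑' k, ENNReal.ofReal (sqNorm k) * ‖c k‖ₑ ^ 2

lemma sobolevSq_one_eq (c : Coeffs) : sobolevSq 1 c = sobolevSq 0 c + gradSq c := sobolevSq_zero_add c

lemma tsum_coeffD_sq (c : Coeffs) : ∑ j, ∑' k, ‖coeffD j c k‖ₑ ^ 2 = gradSq c := by
  have h : ∀ j k, ‖coeffD j c k‖ₑ ^ 2 = ENNReal.ofReal ((k j : ℝ) ^ 2) * ‖c k‖ₑ ^ 2 := fun j k => by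
    have h1 : ‖Complex.I * (k j : ℂ)‖ₑ ^ 2 = ENNReal.ofReal ((k j : ℝ) ^ 2) := by
      rw [← ofReal_norm, ← ENNReal.ofReal_pow (norm_nonneg _), norm_mul, Complex.norm_I, one_mul,
        Complex.norm_intCast, sq_abs]
    rw [coeffD, enorm_smul, mul_pow, h1]
  simp only [h]
  rw [← Summable.tsum_finsetSum fun j _ => ENNReal.summable]
  refine tsum_congr fun k => ?_
  rw [← Finset.sum_mul, ← ENNReal.ofReal_sum_of_nonneg fun j _ => sq_nonneg _]
  rfl

lemma norm_sum_smul_sq_le (w : V3) (v : Fin 3 → V3) :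
    ‖∑ j, w j • v j‖ ^ 2 ≤ ‖w‖ ^ 2 * ∑ j, ‖v j‖ ^ 2 := by
  have h1 : ‖∑ j, w j • v j‖ ≤ ∑ j, ‖w j‖ * ‖v j‖ :=
    (norm_sum_le _ _).trans_eq (Finset.sum_congr rfl fun j _ => norm_smul _ _)
  rw [EuclideanSpace.norm_sq_eq w]
  exact (pow_le_pow_left₀ (norm_nonneg _) h1 2).trans (Finset.sum_mul_sq_le_sq_mul_sq _ _ _)

lemma measureReal_univ : (volume : Measure T3).real univ = vol := by
  have h := integral_character 0
  simp only [character_zero, integral_const, if_true] at h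
  exact_mod_cast (by simpa using h : (((volume : Measure T3).real univ : ℝ) : ℂ) = (vol : ℂ))

section fixedTime

variable {m : (Fin 3 → ℤ) → ℝ} (hm : IsRapid m) {c : Coeffs} (hc : ∀ k, ‖c k‖ ≤ m k)
  (hr : IsReal c)
include hm hc hr

/-- Parseval and the pointwise bound |(u·∇)u|² ≤ |u|²|∇u|². Here the supremum bound replaces the H¹
estimates, making the right-hand side linear in the gradient energy for fixed K. -/
lemma IsRapid.tsum_nonlin_sq_le {K : ℝ} (hK : ‖synth c‖ ≤ K) :
    ∑' k, ‖nonlin c c k‖ₑ ^ 2 ≤ ENNReal.ofReal (K ^ 2) * gradSq c := by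
  have hD : ∀ j, Continuous (partialD j (synth c)) := fun j => by
    rw [hm.partialD_eq hc]
    exact (synth _).continuous
  have hcont : Continuous fun x => ∑ j, synth c x j • partialD j (synth c) x := by
    refine continuous_finsetSum _ fun j _ =>
      Continuous.smul (f := fun x => synth c x j) ?_ (hD j)
    exact (EuclideanSpace.proj (𝕜 := ℝ) j).continuous.comp (synth c).continuous
  have h1 : ∫ x, ‖∑ j, synth c x j • partialD j (synth c) x‖ ^ 2 ≤
      ∑ j, K ^ 2 * ∫ x, ‖partialD j (synth c) x‖ ^ 2 := by
    have hD2 : ∀ j, Continuous fun x => K ^ 2 * ‖partialD j (synth c) x‖ ^ 2 := fun j =>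
      continuous_const.mul ((hD j).norm.pow 2)
    simp only [← integral_const_mul]
    rw [← integral_finsetSum _ fun j _ => (hD2 j).integrable_torus]
    refine integral_mono (hcont.norm.pow 2).integrable_torus
      (continuous_finsetSum _ fun j _ => hD2 j).integrable_torus
      fun x => ?_
    refine (norm_sum_smul_sq_le _ _).trans ?_
    rw [← Finset.mul_sum]
    refine mul_le_mul_of_nonneg_right ?_ (Finset.sum_nonneg fun _ _ => sq_nonneg _)
    exact pow_le_pow_left₀ (norm_nonneg _) ((ContinuousMap.norm_coe_le_norm _ x).trans hK) 2
  have h2 : ∀ j, ∑' k, ‖coeffD j c k‖ₑ ^ 2 =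
      ENNReal.ofReal (vol⁻¹ * ∫ x, ‖partialD j (synth c) x‖ ^ 2) := fun j => by
    rw [← tsum_enorm_fourierCoeffs_sq (hD j).memLp_two, hm.partialD_eq hc,
      hm.fourierCoeffs_synth_coeffD hc hr]
  have hv := vol_pos
  rw [← hm.fourierCoeffs_transport hc hr, tsum_enorm_fourierCoeffs_sq hcont.memLp_two,
    ← tsum_coeffD_sq, Finset.sum_congr rfl fun j _ => h2 j, ← ENNReal.ofReal_sum_of_nonneg
      fun j _ => mul_nonneg (inv_nonneg.2 hv.le) (integral_nonneg fun _ => sq_nonneg _),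
    ← ENNReal.ofReal_mul (sq_nonneg _)]
  refine ENNReal.ofReal_le_ofReal ((mul_le_mul_of_nonneg_left h1 (inv_nonneg.2 hv.le)).trans_eq ?_)
  rw [← Finset.mul_sum, ← Finset.mul_sum]
  ring

lemma IsRapid.sobolevSq_zero_le {K : ℝ} (hK : ‖synth c‖ ≤ K) :
    sobolevSq 0 c ≤ ENNReal.ofReal (K ^ 2) := by
  rw [sobolevSq_zero]
  conv_lhs => rw [← hm.fourierCoeffs_synth hc hr]
  rw [tsum_enorm_fourierCoeffs_sq (synth c).continuous.memLp_two]
  refine ENNReal.ofReal_le_ofReal ?_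
  have h1 : ∫ x, ‖synth c x‖ ^ 2 ≤ ∫ _ : T3, K ^ 2 :=
    integral_mono ((synth c).continuous.norm.pow 2).integrable_torus (integrable_const _) fun x =>
      pow_le_pow_left₀ (norm_nonneg _) ((ContinuousMap.norm_coe_le_norm _ x).trans hK) 2
  rw [integral_const, measureReal_univ, smul_eq_mul] at h1
  rw [inv_mul_le_iff₀ vol_pos]
  exact h1

end fixedTime

/-- The squared `L²` norm of the gradient, as a real number. -/
def gradE (c : Coeffs) : ℝ := ∑' k, sqNorm k * ‖c k‖ ^ 2

lemma sqNorm_le_wt (k : Fin 3 → ℤ) : sqNorm k ≤ wt k := by rw [wt_eq]; linarith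

lemma gradE_nonneg (c : Coeffs) : 0 ≤ gradE c :=
  tsum_nonneg fun k => mul_nonneg (sqNorm_nonneg k) (sq_nonneg _)

lemma IsMajorant.sqNorm_mul_le {m : (Fin 3 → ℤ) → ℝ} {c : Coeffs}
    (hc : ∀ k, ‖c k‖ ≤ m k) (k : Fin 3 → ℤ) : sqNorm k * ‖c k‖ ^ 2 ≤ wt k * m k ^ 2 :=
  mul_le_mul (sqNorm_le_wt k) (pow_le_pow_left₀ (norm_nonneg _) (hc k) 2) (sq_nonneg _) (wt_pos k).le

lemma IsMajorant.gradSq_eq {m : (Fin 3 → ℤ) → ℝ} (hm : IsMajorant m) {c : Coeffs}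
    (hc : ∀ k, ‖c k‖ ≤ m k) : gradSq c = ENNReal.ofReal (gradE c) := by
  have h0 : ∀ k, 0 ≤ sqNorm k * ‖c k‖ ^ 2 := fun k => mul_nonneg (sqNorm_nonneg k) (sq_nonneg _)
  rw [gradE, ENNReal.ofReal_tsum_of_nonneg h0
    (Summable.of_nonneg_of_le h0 (IsMajorant.sqNorm_mul_le hc) hm.2)]
  refine tsum_congr fun k => ?_
  rw [ENNReal.ofReal_mul (sqNorm_nonneg k), ENNReal.ofReal_pow (norm_nonneg _), ofReal_norm]

section apriori

variable {ν a b : ℝ} {c : ℝ → Coeffs}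

lemma IsCoeffSolution.continuousOn_gradE (h : IsCoeffSolution ν a b c) :
    ContinuousOn (fun t => gradE (c t)) (Icc a b) := by
  obtain ⟨m, hm, hc⟩ := h.exists_majorant
  refine continuousOn_tsum (fun k => ((h.continuousOn k).norm.pow 2).const_mul _) hm.2
    fun k t ht => ?_
  rw [Real.norm_of_nonneg (mul_nonneg (sqNorm_nonneg k) (sq_nonneg _))]
  exact IsMajorant.sqNorm_mul_le (hc t ht) k

/-- The equation is tested with -Δu. Young's inequality with weight 2ν|k|² produces exactly the
dissipation 2ν|k|⁴|c_k|² on the right, so it cancels completely and leaves ‖(u·∇)u‖²/(2ν), which the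
maximum principle controls by the gradient. -/
lemma IsCoeffSolution.gradSq_le (hν : 0 < ν) (h : IsCoeffSolution ν a b c) (hr : IsReal (c a))
    {a' t K : ℝ} (ha : a < a') (ht : t ∈ Icc a' b) (hK : ‖synth (c a')‖ ≤ K) :
    gradSq (c t) ≤ gradSq (c a') +
      ENNReal.ofReal (K ^ 2 / (2 * ν)) * ∫⁻ s in Ioc a' t, gradSq (c s) := by
  obtain ⟨m, hm, hc⟩ := h.exists_isRapid hν ha
  have h' := h.restrict ha.le ht.1 ht.2
  have hI : ∀ s ∈ Ioc a' t, s ∈ Icc a' b := fun s hs => ⟨hs.1.le, hs.2.trans ht.2⟩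
  have he := weighted_energy_le (f := c) (N := fun s => nonlin (c s) (c s))
    (lam := fun k => ν * sqNorm k) (w := sqNorm) ht.1
    (fun k => mul_nonneg hν.le (sqNorm_nonneg k))
    (fun k => by
      refine ContinuousOn.intervalIntegrable ?_
      rw [uIcc_of_le ht.1]
      exact h'.continuousOn_nonlin k) h'.continuousOn h'.eq
  set D : ℝ → ENNReal := fun s => ∑' k, ENNReal.ofReal (sqNorm k) *
    (ENNReal.ofReal (2 * (ν * sqNorm k)) * ‖c s k‖ₑ ^ 2) with hDdef
  have hwm := (hm.mul_wt_pow 1).isMajorant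
  have hDle : ∀ s ∈ Ioc a' t, D s ≤ ENNReal.ofReal (∑' k, 2 * ν * (wt k * (wt k ^ 1 * m k) ^ 2)) := by
    intro s hs
    rw [ENNReal.ofReal_tsum_of_nonneg (fun k => mul_nonneg (by positivity)
      (mul_nonneg (wt_pos k).le (sq_nonneg _))) (hwm.2.mul_left _)]
    refine ENNReal.tsum_le_tsum fun k => ?_
    rw [← ofReal_norm, ← ENNReal.ofReal_pow (norm_nonneg _), ← ENNReal.ofReal_mul
      (mul_nonneg zero_le_two (mul_nonneg hν.le (sqNorm_nonneg k))),
      ← ENNReal.ofReal_mul (sqNorm_nonneg k)]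
    refine ENNReal.ofReal_le_ofReal ?_
    have h1 : ‖c s k‖ ^ 2 ≤ m k ^ 2 := pow_le_pow_left₀ (norm_nonneg _) (hc s (hI s hs) k) 2
    have h2 : sqNorm k * sqNorm k ≤ wt k * wt k ^ 2 := by
      have := sqNorm_le_wt k
      have := one_le_wt k
      have := sqNorm_nonneg k
      calc sqNorm k * sqNorm k ≤ wt k * wt k := by gcongr
        _ ≤ wt k * wt k ^ 2 := by
          gcongr
          exact le_self_pow₀ (one_le_wt k) two_ne_zero
    calc sqNorm k * (2 * (ν * sqNorm k) * ‖c s k‖ ^ 2)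
        = 2 * ν * ((sqNorm k * sqNorm k) * ‖c s k‖ ^ 2) := by ring
      _ ≤ 2 * ν * ((wt k * wt k ^ 2) * m k ^ 2) := by
        have := (wt_pos k).le
        gcongr
      _ = _ := by ring
  -- The dissipation can be cancelled only if its integral is finite; rapid decay on [a',t] ensures
  -- this, and is why the estimate does not start at a.
  have hDfin : ∫⁻ s in Ioc a' t, D s ≠ ⊤ := by
    refine ((setLIntegral_mono' measurableSet_Ioc hDle).trans_lt ?_).ne
    rw [setLIntegral_const]
    exact ENNReal.mul_lt_top ENNReal.ofReal_lt_top measure_Ioc_lt_top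
  have hrhs : ∀ s ∈ Ioc a' t, ∑' k, ENNReal.ofReal (sqNorm k) *
      (2 * (‖c s k‖ₑ * ‖nonlin (c s) (c s) k‖ₑ)) ≤
      ENNReal.ofReal (K ^ 2 / (2 * ν)) * gradSq (c s) + D s := by
    intro s hs
    have hsa : s ∈ Icc a b := ⟨ha.le.trans (hI s hs).1, (hI s hs).2⟩
    have hN := hm.tsum_nonlin_sq_le (hc s (hI s hs)) (h.isReal hν hr s hsa)
      ((h.norm_synth_le hν hr ha (hI s hs)).trans hK)
    have h1 : ∀ k, ENNReal.ofReal (sqNorm k) * (2 * (‖c s k‖ₑ * ‖nonlin (c s) (c s) k‖ₑ)) ≤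
        ENNReal.ofReal (sqNorm k) * (ENNReal.ofReal (2 * (ν * sqNorm k)) * ‖c s k‖ₑ ^ 2) +
          ENNReal.ofReal (2 * ν)⁻¹ * ‖nonlin (c s) (c s) k‖ₑ ^ 2 := fun k => by
      rcases (sqNorm_nonneg k).eq_or_lt with hk | hk
      · rw [← hk]
        simp
      · have hq : 0 < 2 * (ν * sqNorm k) := by positivity
        refine (mul_le_mul_right (two_mul_enorm_mul_le hq _ _) _).trans_eq ?_
        rw [mul_add, ← mul_assoc (ENNReal.ofReal (sqNorm k)) (ENNReal.ofReal (2 * (ν * sqNorm k))⁻¹),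
          ← ENNReal.ofReal_mul hk.le]
        congr 4
        field_simp
    refine (ENNReal.tsum_le_tsum h1).trans ?_
    rw [ENNReal.tsum_add, add_comm, ENNReal.tsum_mul_left]
    refine add_le_add_left ((mul_le_mul_right hN _).trans_eq ?_) _
    rw [← mul_assoc, ← ENNReal.ofReal_mul (by positivity)]
    congr 2
    field_simp
  have hmeas : AEMeasurable D (volume.restrict (Ioc a' t)) := by
    refine AEMeasurable.tsum fun k => ((AEMeasurable.pow_const ?_ 2).const_mul _).const_mul _
    exact (((h'.continuousOn k).mono Ioc_subset_Icc_self).aestronglyMeasurable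
      measurableSet_Ioc).enorm
  have hfin := he.trans (add_le_add_right (setLIntegral_mono' measurableSet_Ioc hrhs) _)
  rw [lintegral_add_right' _ hmeas, lintegral_const_mul' _ _ ENNReal.ofReal_ne_top, ← add_assoc] at hfin
  exact (ENNReal.add_le_add_iff_right hDfin).1 hfin

lemma IsCoeffSolution.gradE_le (hν : 0 < ν) (h : IsCoeffSolution ν a b c) (hr : IsReal (c a))
    {a' t K : ℝ} (ha : a < a') (ht : t ∈ Icc a' b) (hK : ‖synth (c a')‖ ≤ K) :
    gradE (c t) ≤ gradE (c a') + K ^ 2 / (2 * ν) *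
      gronwallBound 0 (K ^ 2 / (2 * ν)) (gradE (c a')) (t - a') := by
  obtain ⟨m, hm, hc⟩ := h.exists_majorant
  have hcont := h.continuousOn_gradE.mono (Icc_subset_Icc_left ha.le)
  refine le_gronwallBound_of_le_integral hcont (fun _ _ => gradE_nonneg _) (by positivity)
    (fun s hs => ?_) ht
  have h1 := h.gradSq_le hν hr ha hs hK
  have hI : ∀ r ∈ Icc a' s, gradSq (c r) = ENNReal.ofReal (gradE (c r)) := fun r hr =>
    hm.gradSq_eq (hc r ⟨ha.le.trans hr.1, hr.2.trans hs.2⟩)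
  have hpos : 0 ≤ ∫ r in a'..s, gradE (c r) :=
    intervalIntegral.integral_nonneg hs.1 fun _ _ => gradE_nonneg _
  have hii : IntegrableOn (fun r => gradE (c r)) (Ioc a' s) :=
    ((hcont.mono (Icc_subset_Icc_right hs.2)).integrableOn_Icc).mono_set Ioc_subset_Icc_self
  rw [hI s ⟨hs.1, le_rfl⟩, hI a' ⟨le_rfl, hs.1⟩,
    setLIntegral_congr_fun measurableSet_Ioc fun r hr => hI r (Ioc_subset_Icc_self hr),
    ← ofReal_integral_eq_lintegral_ofReal hii (Eventually.of_forall fun _ => gradE_nonneg _),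
    ← intervalIntegral.integral_of_le hs.1, ← ENNReal.ofReal_mul (by positivity),
    ← ENNReal.ofReal_add (gradE_nonneg _) (by positivity)] at h1
  exact (ENNReal.ofReal_le_ofReal_iff (add_nonneg (gradE_nonneg _) (by positivity))).1 h1

/-- The `H¹` norm of a solution is controlled by its value at an earlier positive time. -/
lemma IsCoeffSolution.sobolevSq_one_le (hν : 0 < ν) (h : IsCoeffSolution ν a b c)
    (hr : IsReal (c a)) {a' t T : ℝ} (ha : a < a') (ht : t ∈ Icc a' b) (hT : t - a' ≤ T) :
    sobolevSq 1 (c t) ≤ ENNReal.ofReal (‖synth (c a')‖ ^ 2 + (gradE (c a') +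
      ‖synth (c a')‖ ^ 2 / (2 * ν) *
        gronwallBound 0 (‖synth (c a')‖ ^ 2 / (2 * ν)) (gradE (c a')) T)) := by
  obtain ⟨m, hm, hc⟩ := h.exists_isRapid hν ha
  have h0 := hm.sobolevSq_zero_le (hc t ht) (h.isReal hν hr t ⟨ha.le.trans ht.1, ht.2⟩)
    (h.norm_synth_le hν hr ha ht)
  have h1 := h.gradE_le hν hr ha ht le_rfl
  rw [sobolevSq_one_eq, hm.isMajorant.gradSq_eq (hc t ht)]
  refine (add_le_add h0 (ENNReal.ofReal_le_ofReal h1)).trans ?_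
  rw [← ENNReal.ofReal_add (sq_nonneg _) ((gradE_nonneg _).trans h1)]
  refine ENNReal.ofReal_le_ofReal ?_
  have hmono := gronwallBound_mono (le_refl (0 : ℝ)) (gradE_nonneg (c a'))
    (by positivity : 0 ≤ ‖synth (c a')‖ ^ 2 / (2 * ν)) hT
  gcongr

end apriori

/-! ### Global existence -/

lemma IsCoeffSolution.exists_extend {ν a b δ : ℝ} {c d : ℝ → Coeffs} (h : IsCoeffSolution ν a b c)
    (hab : a ≤ b) (hδ : 0 < δ) (hd : IsCoeffSolution ν 0 δ d) (h0 : d 0 = c b) :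
    ∃ e, e a = c a ∧ IsCoeffSolution ν a (b + δ) e := by
  classical
  set e : ℝ → Coeffs := fun t => if t ≤ b then c t else d (t - b)
  have h1 : IsCoeffSolution ν a b e := h.congr fun t ht => (if_pos ht.2).symm
  have h2 : IsCoeffSolution ν b (b + δ) e := by
    have := hd.translate (-b)
    rw [zero_sub, neg_neg, sub_neg_eq_add, add_comm δ b] at this
    refine this.congr fun t ht => ?_
    rcases ht.1.eq_or_lt with rfl | hlt
    · simp [e, h0]
    · simp [e, not_le.2 hlt, sub_eq_add_neg]
  exact ⟨e, if_pos hab, h1.glue h2 hab (by linarith)⟩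

/-- After a first local step, every a priori bound starts from the state at a' = δ₁/2 and depends on
that state, ν and T only. Hence one radius M, and with it one step length δ, serves for all later
steps, and finitely many of them reach T. -/
lemma exists_solution_on {ν : ℝ} (hν : 0 < ν) {c₀ : Coeffs} (hc₀ : sobolevSq 1 c₀ < ⊤)
    (hr : IsReal c₀) {T : ℝ} (hT : 0 ≤ T) : ∃ c, c 0 = c₀ ∧ IsCoeffSolution ν 0 T c := by
  have start : ∀ A : ENNReal, A < ⊤ → ∃ M : ℝ, 0 < M ∧ A ≤ ENNReal.ofReal (M ^ 2) := fun A hA => by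
    refine ⟨A.toReal + 1, by positivity, ?_⟩
    rw [← ENNReal.ofReal_toReal hA.ne]
    refine ENNReal.ofReal_le_ofReal ?_
    rw [ENNReal.toReal_ofReal ENNReal.toReal_nonneg]
    nlinarith [ENNReal.toReal_nonneg (a := A)]
  obtain ⟨M₁, hM₁, hb₁⟩ := start _ hc₀
  obtain ⟨δ₁, hδ₁, hloc₁⟩ := exists_local_solution hν hM₁
  obtain ⟨c₁, hc₁0, hc₁, -⟩ := hloc₁ c₀ hb₁
  set a' := δ₁ / 2
  have ha' : 0 < a' := by positivity
  obtain ⟨M, hM, hb⟩ := start (ENNReal.ofReal (‖synth (c₁ a')‖ ^ 2 + (gradE (c₁ a') +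
      ‖synth (c₁ a')‖ ^ 2 / (2 * ν) *
        gronwallBound 0 (‖synth (c₁ a')‖ ^ 2 / (2 * ν)) (gradE (c₁ a')) T))) ENNReal.ofReal_lt_top
  obtain ⟨δ, hδ, hloc⟩ := exists_local_solution hν hM
  have step : ∀ n : ℕ, ∃ c, c 0 = c₀ ∧ IsCoeffSolution ν 0 (min T (δ₁ + n * δ)) c := by
    intro n
    induction n with
    | zero =>
      refine ⟨c₁, hc₁0, hc₁.restrict le_rfl (le_min hT (by positivity)) ?_⟩
      simp
    | succ n ih =>
      obtain ⟨c, hc0, hc⟩ := ih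
      rcases le_total T (δ₁ + n * δ) with hle | hle
      · refine ⟨c, hc0, ?_⟩
        rw [min_eq_left hle] at hc
        rwa [min_eq_left (hle.trans (by push_cast; linarith))]
      · rw [min_eq_right hle] at hc
        set s := δ₁ + n * δ
        have hδs : δ₁ ≤ s := le_add_of_nonneg_right (by positivity)
        have hs : a' ≤ s := by simp only [a']; linarith
        -- By uniqueness the extended solution has at a' the value of the first one, so the bound M
        -- fixed before the induction applies to it.
        have hagree := (hc.restrict le_rfl hδ₁.le hδs).unique hν hc₁ (by rw [hc0, hc₁0]) a'
          ⟨ha'.le, by simp only [a']; linarith⟩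
        have hM' := hc.sobolevSq_one_le hν (by rwa [hc0]) ha' ⟨hs, le_rfl⟩
          (by linarith : s - a' ≤ T)
        rw [hagree] at hM'
        obtain ⟨d, hd0, hd, -⟩ := hloc (c s) (hM'.trans hb)
        obtain ⟨e, he0, he⟩ := hc.exists_extend (by linarith) hδ hd hd0
        refine ⟨e, he0.trans hc0, he.restrict le_rfl (le_min hT (by positivity)) ?_⟩
        refine (min_le_right _ _).trans_eq ?_
        push_cast
        ring
  obtain ⟨n, hn⟩ := exists_nat_ge (T / δ)
  obtain ⟨c, hc0, hc⟩ := step n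
  refine ⟨c, hc0, ?_⟩
  rwa [min_eq_left] at hc
  rw [div_le_iff₀ hδ] at hn
  linarith

/-- The solutions on [0,n] agree on common intervals by uniqueness, so the value at t may be taken
from the one on [0,⌈t⌉]. -/
theorem exists_global_solution {ν : ℝ} (hν : 0 < ν) {c₀ : Coeffs} (hc₀ : sobolevSq 1 c₀ < ⊤)
    (hr : IsReal c₀) : ∃ c, c 0 = c₀ ∧ ∀ T, 0 ≤ T → IsCoeffSolution ν 0 T c := by
  choose c hc0 hc using fun n : ℕ => exists_solution_on hν hc₀ hr (Nat.cast_nonneg (α := ℝ) n)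
  have agree : ∀ (n : ℕ) (t : ℝ), 0 ≤ t → t ≤ n → c ⌈t⌉₊ t = c n t := fun n t ht htn => by
    have hle : ((⌈t⌉₊ : ℕ) : ℝ) ≤ n := by exact_mod_cast Nat.ceil_le.2 htn
    exact (hc ⌈t⌉₊).unique hν ((hc n).restrict le_rfl (Nat.cast_nonneg _) hle)
      (by rw [hc0, hc0]) t ⟨ht, Nat.le_ceil t⟩
  refine ⟨fun t => c ⌈t⌉₊ t, hc0 _, fun T hT => ?_⟩
  obtain ⟨n, hn⟩ := exists_nat_ge T
  exact ((hc n).restrict le_rfl hT hn).congr fun t ht => (agree n t ht.1 (ht.2.trans hn)).symm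

end Burgers
end

noncomputable section
namespace Burgers
open scoped ComplexConjugate

/-! ### Regularity of solutions up to the initial time -/

section regularity

variable {ν a b : ℝ} {c : ℝ → Coeffs}

/-- The H¹ majorant dominates the series for the squared norm uniformly in time, so modewise
continuity passes to the sum. Nothing is lost at the left endpoint. -/
lemma IsCoeffSolution.tendsto_sobolevSq_one (h : IsCoeffSolution ν a b c) {t : ℝ}
    (ht : t ∈ Icc a b) :
    Tendsto (fun r => sobolevSq 1 (c r - c t)) (𝓝[Icc a b] t) (𝓝 0) := by
  obtain ⟨m, hm, hc⟩ := h.exists_majorant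
  have hle : ∀ r ∈ Icc a b, ∀ k, wt k * ‖c r k - c t k‖ ^ 2 ≤ 4 * (wt k * m k ^ 2) := fun r hr k => by
    have h1 : ‖c r k - c t k‖ ≤ 2 * m k :=
      (norm_sub_le _ _).trans (by linarith [hc r hr k, hc t ht k])
    have h2 := pow_le_pow_left₀ (norm_nonneg _) h1 2
    calc wt k * ‖c r k - c t k‖ ^ 2 ≤ wt k * (2 * m k) ^ 2 :=
          mul_le_mul_of_nonneg_left h2 (wt_pos k).le
      _ = _ := by ring
  have h0 : ∀ r k, 0 ≤ wt k * ‖c r k - c t k‖ ^ 2 := fun r k => mul_nonneg (wt_pos k).le (sq_nonneg _)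
  have hcont : ContinuousOn (fun r => ∑' k, wt k * ‖c r k - c t k‖ ^ 2) (Icc a b) := by
    refine continuousOn_tsum (fun k => (((h.continuousOn k).sub continuousOn_const).norm.pow 2).const_mul _)
      (hm.2.mul_left 4) fun k r hr => ?_
    rw [Real.norm_of_nonneg (h0 r k)]
    exact hle r hr k
  have hlim := ENNReal.tendsto_ofReal (hcont t ht)
  simp only [sub_self, norm_zero, ne_eq, OfNat.ofNat_ne_zero, not_false_eq_true, zero_pow, mul_zero,
    tsum_zero, ENNReal.ofReal_zero] at hlim
  refine hlim.congr' ?_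
  filter_upwards [self_mem_nhdsWithin] with r hr
  rw [ENNReal.ofReal_tsum_of_nonneg (h0 r)
    (Summable.of_nonneg_of_le (h0 r) (hle r hr) (hm.2.mul_left 4)), sobolevSq_one]
  refine tsum_congr fun k => ?_
  rw [ENNReal.ofReal_mul (wt_pos k).le, ENNReal.ofReal_pow (norm_nonneg _), ofReal_norm, Pi.sub_apply]

lemma sobolevSq_two_le_of_norm_le {m : (Fin 3 → ℤ) → ℝ} (hm : IsRapid m) {c : Coeffs}
    (hc : ∀ k, ‖c k‖ ≤ m k) :
    sobolevSq 2 c ≤ ENNReal.ofReal (∑' k, wt k * (wt k ^ 1 * m k) ^ 2) := by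
  have hwm := (hm.mul_wt_pow 1).isMajorant
  rw [sobolevSq_two, ENNReal.ofReal_tsum_of_nonneg
    (fun k => mul_nonneg (wt_pos k).le (sq_nonneg _)) hwm.2]
  refine ENNReal.tsum_le_tsum fun k => ?_
  rw [← ENNReal.ofReal_pow (wt_pos k).le, ← ofReal_norm, ← ENNReal.ofReal_pow (norm_nonneg _),
    ← ENNReal.ofReal_mul (sq_nonneg _)]
  refine ENNReal.ofReal_le_ofReal ?_
  have h1 : ‖c k‖ ^ 2 ≤ m k ^ 2 := pow_le_pow_left₀ (norm_nonneg _) (hc k) 2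
  have h2 := one_le_wt k
  calc wt k ^ 2 * ‖c k‖ ^ 2 ≤ wt k ^ 2 * m k ^ 2 := by gcongr
    _ ≤ wt k * (wt k ^ 2 * m k ^ 2) := le_mul_of_one_le_left (by positivity) h2
    _ = _ := by ring

lemma sobolevSq_two_split {ν : ℝ} (hν : 0 < ν) (c : Coeffs) :
    ENNReal.ofReal (2 * ν) * sobolevSq 2 c =
      (∑' k, ENNReal.ofReal (wt k) * (ENNReal.ofReal (2 * (ν * sqNorm k)) * ‖c k‖ₑ ^ 2)) +
        ENNReal.ofReal (2 * ν) * sobolevSq 1 c := by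
  rw [sobolevSq_two, sobolevSq_one, ← ENNReal.tsum_mul_left, ← ENNReal.tsum_mul_left,
    ← ENNReal.tsum_add]
  refine tsum_congr fun k => ?_
  have hs := sqNorm_nonneg k
  have hw := (wt_pos k).le
  rw [← mul_assoc (ENNReal.ofReal (2 * ν)) (_ ^ 2), ← mul_assoc (ENNReal.ofReal (wt k)),
    ← mul_assoc (ENNReal.ofReal (2 * ν)) (ENNReal.ofReal (wt k)), ← add_mul, ← ENNReal.ofReal_pow hw,
    ← ENNReal.ofReal_mul (by positivity), ← ENNReal.ofReal_mul hw,
    ← ENNReal.ofReal_mul (by positivity), ← ENNReal.ofReal_add (by positivity) (by positivity)]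
  congr 2
  rw [wt_eq]
  ring

/-- Young's inequality with weight (ν/2)wt k costs (ν/2)‖c‖²_{H²}; condition `hRS` makes the H² part
of the nonlinear estimate cost another ν/2. In total this is half of the dissipation 2ν. -/
lemma tsum_wt_transport_le {ν R S : ℝ} (hν : 0 < ν) (_hS : 0 ≤ S) (hR : 1 ≤ R)
    (hRS : 2 / ν * (432 / R * S) ≤ ν / 2) {c : Coeffs} (hc : sobolevSq 1 c ≤ ENNReal.ofReal S) :
    ∑' k, ENNReal.ofReal (wt k) * (2 * (‖c k‖ₑ * ‖nonlin c c k‖ₑ)) ≤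
      ENNReal.ofReal ν * sobolevSq 2 c + ENNReal.ofReal (ν / 2 * (R ^ 2 * S)) := by
  have h1 : ∀ k, ENNReal.ofReal (wt k) * (2 * (‖c k‖ₑ * ‖nonlin c c k‖ₑ)) ≤
      ENNReal.ofReal (ν / 2) * (ENNReal.ofReal (wt k) ^ 2 * ‖c k‖ₑ ^ 2) +
        ENNReal.ofReal (2 / ν) * ‖nonlin c c k‖ₑ ^ 2 := fun k => by
    have hw := wt_pos k
    have hq : 0 < ν / 2 * wt k := by positivity
    refine (mul_le_mul_right (two_mul_enorm_mul_le hq _ _) _).trans_eq ?_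
    rw [mul_add, ← mul_assoc, ← mul_assoc, ← mul_assoc, ← ENNReal.ofReal_mul hw.le,
      ← ENNReal.ofReal_mul hw.le, ← ENNReal.ofReal_pow hw.le, ← ENNReal.ofReal_mul (by positivity)]
    congr 3
    · ring_nf
    · field_simp
  refine (ENNReal.tsum_le_tsum h1).trans ?_
  rw [ENNReal.tsum_add, ENNReal.tsum_mul_left, ENNReal.tsum_mul_left, ← sobolevSq_two]
  have h2 : ENNReal.ofReal (2 / ν) * ∑' k, ‖nonlin c c k‖ₑ ^ 2 ≤
      ENNReal.ofReal (ν / 2) * (ENNReal.ofReal (R ^ 2) * ENNReal.ofReal S + sobolevSq 2 c) :=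
    calc ENNReal.ofReal (2 / ν) * ∑' k, ‖nonlin c c k‖ₑ ^ 2
        ≤ ENNReal.ofReal (2 / ν) * (ENNReal.ofReal (432 / R) *
          (ENNReal.ofReal S * (ENNReal.ofReal (R ^ 2) * ENNReal.ofReal S + sobolevSq 2 c))) := by
          refine mul_le_mul_right ((tsum_nonlin_sq_le hR c c).trans ?_) _
          gcongr
      _ = ENNReal.ofReal (2 / ν * (432 / R * S)) *
          (ENNReal.ofReal (R ^ 2) * ENNReal.ofReal S + sobolevSq 2 c) := by
          rw [ENNReal.ofReal_mul (by positivity), ENNReal.ofReal_mul (by positivity)]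
          ring
      _ ≤ _ := mul_le_mul_left (ENNReal.ofReal_le_ofReal hRS) _
  refine (add_le_add_right h2 _).trans_eq ?_
  rw [← ENNReal.ofReal_mul (sq_nonneg R), mul_add, ← ENNReal.ofReal_mul (by positivity)]
  have h3 : ENNReal.ofReal ν = ENNReal.ofReal (ν / 2) + ENNReal.ofReal (ν / 2) := by
    rw [← ENNReal.ofReal_add (by positivity) (by positivity), add_halves]
  rw [h3]
  ring

/-- The `L²(H²)` bound, uniformly up to the initial time. -/
lemma IsCoeffSolution.lintegral_sobolevSq_two_le (hν : 0 < ν) (h : IsCoeffSolution ν a b c) {R S : ℝ}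
    (hS : 0 ≤ S) (hR : 1 ≤ R) (hRS : 2 / ν * (432 / R * S) ≤ ν / 2)
    (hc1 : ∀ t ∈ Icc a b, sobolevSq 1 (c t) ≤ ENNReal.ofReal S) {a' : ℝ} (ha : a < a')
    (hab : a' ≤ b) :
    ENNReal.ofReal ν * ∫⁻ s in Ioc a' b, sobolevSq 2 (c s) ≤
      ENNReal.ofReal S + ENNReal.ofReal (ν / 2 * (R ^ 2 * S) + 2 * ν * S) * ENNReal.ofReal (b - a) := by
  obtain ⟨m, hm, hc⟩ := h.exists_isRapid hν ha
  have h' := h.restrict ha.le hab le_rfl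
  have hsub : ∀ s ∈ Ioc a' b, s ∈ Icc a b := fun s hs => ⟨ha.le.trans hs.1.le, hs.2⟩
  have he := weighted_energy_le (f := c) (N := fun s => nonlin (c s) (c s))
    (lam := fun k => ν * sqNorm k) (w := wt) hab
    (fun k => mul_nonneg hν.le (sqNorm_nonneg k))
    (fun k => by
      refine ContinuousOn.intervalIntegrable ?_
      rw [uIcc_of_le hab]
      exact h'.continuousOn_nonlin k) h'.continuousOn h'.eq
  have hmeas : ∀ k, AEStronglyMeasurable (fun t => c t k) (volume.restrict (Ioc a' b)) := fun k =>
    ((h'.continuousOn k).mono Ioc_subset_Icc_self).aestronglyMeasurable measurableSet_Ioc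
  have hm2 : AEMeasurable (fun s => sobolevSq 2 (c s)) (volume.restrict (Ioc a' b)) :=
    aemeasurable_sobolevSq hmeas
  have hm1 : AEMeasurable (fun s => sobolevSq 1 (c s)) (volume.restrict (Ioc a' b)) :=
    aemeasurable_sobolevSq hmeas
  -- Finiteness for the final cancellation comes from rapid decay on [a',b]; the resulting bound no
  -- longer depends on a' or on the rapid majorant.
  have hfin : ENNReal.ofReal ν * ∫⁻ s in Ioc a' b, sobolevSq 2 (c s) ≠ ⊤ := by
    refine ENNReal.mul_ne_top ENNReal.ofReal_ne_top ((setLIntegral_mono'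
      (g := fun _ => ENNReal.ofReal (∑' k, wt k * (wt k ^ 1 * m k) ^ 2)) measurableSet_Ioc
      fun s hs => sobolevSq_two_le_of_norm_le hm (hc s ⟨hs.1.le, hs.2⟩)).trans_lt ?_).ne
    rw [setLIntegral_const]
    exact ENNReal.mul_lt_top ENNReal.ofReal_lt_top measure_Ioc_lt_top
  have hlen : volume (Ioc a' b) ≤ ENNReal.ofReal (b - a) := by
    rw [Real.volume_Ioc]
    exact ENNReal.ofReal_le_ofReal (by linarith)
  rw [← sobolevSq_one (c a')] at he
  set D : ℝ → ENNReal := fun s => ∑' k, ENNReal.ofReal (wt k) *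
    (ENNReal.ofReal (2 * (ν * sqNorm k)) * ‖c s k‖ₑ ^ 2)
  have hD : ∫⁻ s in Ioc a' b, D s ≤ ENNReal.ofReal S +
      (ENNReal.ofReal ν * (∫⁻ s in Ioc a' b, sobolevSq 2 (c s)) +
        ENNReal.ofReal (ν / 2 * (R ^ 2 * S)) * ENNReal.ofReal (b - a)) := by
    refine le_add_self.trans (he.trans (add_le_add (hc1 a' ⟨ha.le, hab⟩) ?_))
    refine (setLIntegral_mono' measurableSet_Ioc fun s hs =>
      tsum_wt_transport_le hν hS hR hRS (hc1 s (hsub s hs))).trans ?_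
    rw [lintegral_add_left' (hm2.const_mul _), lintegral_const_mul' _ _ ENNReal.ofReal_ne_top,
      setLIntegral_const]
    gcongr
  have hsplit : ENNReal.ofReal (2 * ν) * ∫⁻ s in Ioc a' b, sobolevSq 2 (c s) ≤
      (∫⁻ s in Ioc a' b, D s) + ENNReal.ofReal (2 * ν * S) * ENNReal.ofReal (b - a) := by
    rw [← lintegral_const_mul' _ _ ENNReal.ofReal_ne_top, lintegral_congr fun s =>
      sobolevSq_two_split hν (c s), lintegral_add_right' _ (hm1.const_mul _)]
    refine add_le_add_right ?_ _
    refine (setLIntegral_mono' (g := fun _ => ENNReal.ofReal (2 * ν * S)) measurableSet_Ioc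
      fun s hs => ?_).trans ?_
    · rw [ENNReal.ofReal_mul (by positivity : 0 ≤ 2 * ν)]
      exact mul_le_mul_right (hc1 s (hsub s hs)) _
    · rw [setLIntegral_const]
      gcongr
  have h2 : ENNReal.ofReal (2 * ν) = ENNReal.ofReal ν + ENNReal.ofReal ν := by
    rw [← ENNReal.ofReal_add hν.le hν.le, two_mul]
  have hfinal := hsplit.trans (add_le_add_left hD _)
  rw [h2, add_mul] at hfinal
  refine (ENNReal.add_le_add_iff_left hfin).1 (hfinal.trans_eq ?_)
  rw [ENNReal.ofReal_add (by positivity) (by positivity)]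
  ring

/-- Monotone convergence along a sequence decreasing to the left endpoint; it carries bounds uniform
in a' down to the initial time. -/
lemma lintegral_Ioo_le_of_forall {f : ℝ → ENNReal} {a b : ℝ} {B : ENNReal}
    (h : ∀ a', a < a' → a' ≤ b → ∫⁻ s in Ioc a' b, f s ≤ B) : ∫⁻ s in Ioo a b, f s ≤ B := by
  rcases le_or_gt b a with hba | hab
  · simp [Ioo_eq_empty (not_lt.2 hba)]
  obtain ⟨x, hx, hxm, hxl⟩ := exists_seq_strictAnti_tendsto' hab
  have hU : Ioo a b ⊆ ⋃ n, Ioc (x n) b := fun s hs => by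
    obtain ⟨n, hn⟩ := (hxl.eventually (gt_mem_nhds hs.1)).exists
    exact mem_iUnion.2 ⟨n, hn, hs.2.le⟩
  refine (lintegral_mono_set hU).trans ?_
  rw [setLIntegral_iUnion_of_directed _ (Monotone.directed_le fun i j hij =>
    Ioc_subset_Ioc_left (hx.antitone hij))]
  exact iSup_le fun n => h _ (hxm n).1 (hxm n).2.le

lemma IsCoeffSolution.exists_sobolevSq_one_le (h : IsCoeffSolution ν a b c) :
    ∃ S : ℝ, 0 ≤ S ∧ ∀ t ∈ Icc a b, sobolevSq 1 (c t) ≤ ENNReal.ofReal S := by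
  obtain ⟨m, hm, hc⟩ := h.exists_majorant
  exact ⟨_, tsum_nonneg fun k => mul_nonneg (wt_pos k).le (sq_nonneg _),
    fun t ht => sobolevSq_one_le_of_norm_le hm (hc t ht)⟩

lemma IsCoeffSolution.lintegral_sobolevSq_two_lt_top (hν : 0 < ν) (h : IsCoeffSolution ν a b c) :
    ∫⁻ s in Ioo a b, sobolevSq 2 (c s) < ⊤ := by
  obtain ⟨S, hS, hc1⟩ := h.exists_sobolevSq_one_le
  -- The condition (2/ν)(432/R)S ≤ ν/2 reads R ≥ 4·432·S/ν²; the added 1 ensures R ≥ 1.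
  set R := 1 + 4 / ν ^ 2 * 432 * S
  have hR : 1 ≤ R := le_add_of_nonneg_right (by positivity)
  have hRS : 2 / ν * (432 / R * S) ≤ ν / 2 := by
    have hR0 : 0 < R := by linarith
    have : 2 / ν * (432 / R * S) = (4 / ν ^ 2 * 432 * S) / R * (ν / 2) := by
      field_simp
      ring
    rw [this]
    refine mul_le_of_le_one_left (by positivity) ((div_le_one hR0).2 ?_)
    simp only [R]
    linarith
  have key : ∀ a', a < a' → a' ≤ b → ∫⁻ s in Ioc a' b, sobolevSq 2 (c s) ≤
      (ENNReal.ofReal S + ENNReal.ofReal (ν / 2 * (R ^ 2 * S) + 2 * ν * S) * ENNReal.ofReal (b - a)) /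
        ENNReal.ofReal ν := fun a' ha hab => by
    rw [ENNReal.le_div_iff_mul_le (Or.inl (by simpa using hν)) (Or.inl ENNReal.ofReal_ne_top), mul_comm]
    exact h.lintegral_sobolevSq_two_le hν hS hR hRS hc1 ha hab
  refine (lintegral_Ioo_le_of_forall key).trans_lt ?_
  exact ENNReal.div_lt_top (by finiteness) (by simpa using hν)

lemma sobolevSq_zero_rhs_le (ν : ℝ) (c : Coeffs) : sobolevSq 0 (rhs ν c) ≤
    ENNReal.ofReal (2 * ν ^ 2) * sobolevSq 2 c +
      2 * (ENNReal.ofReal 432 * (sobolevSq 1 c * (sobolevSq 1 c + sobolevSq 2 c))) := by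
  have h1 : ∀ k, ‖rhs ν c k‖ₑ ^ 2 ≤ ENNReal.ofReal (2 * ν ^ 2) *
      (ENNReal.ofReal (wt k) ^ 2 * ‖c k‖ₑ ^ 2) + 2 * ‖nonlin c c k‖ₑ ^ 2 := fun k => by
    refine (enorm_sub_sq_le _ _).trans (add_le_add_left ?_ _)
    rw [enorm_neg, enorm_smul, mul_pow, ← mul_assoc, ← mul_assoc]
    refine mul_le_mul_left ?_ _
    rw [← ofReal_norm, ← ENNReal.ofReal_pow (norm_nonneg _), Real.norm_eq_abs, sq_abs,
      ← ENNReal.ofReal_pow (wt_pos k).le, ← ENNReal.ofReal_mul (by positivity),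
      ← ENNReal.ofReal_ofNat 2, ← ENNReal.ofReal_mul (by norm_num)]
    refine ENNReal.ofReal_le_ofReal ?_
    rw [mul_pow, ← mul_assoc]
    have := pow_le_pow_left₀ (sqNorm_nonneg k) (sqNorm_le_wt k) 2
    gcongr
  rw [sobolevSq_zero]
  refine (ENNReal.tsum_le_tsum h1).trans ?_
  rw [ENNReal.tsum_add, ENNReal.tsum_mul_left, ENNReal.tsum_mul_left, ← sobolevSq_two]
  have h2 := tsum_nonlin_sq_le le_rfl c c
  rw [one_pow, ENNReal.ofReal_one, one_mul, div_one] at h2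
  gcongr

lemma IsCoeffSolution.lintegral_rhs_lt_top (hν : 0 < ν) (h : IsCoeffSolution ν a b c) :
    ∫⁻ s in Ioo a b, sobolevSq 0 (rhs ν (c s)) < ⊤ := by
  obtain ⟨S, hS, hc1⟩ := h.exists_sobolevSq_one_le
  have h2 := h.lintegral_sobolevSq_two_lt_top hν
  have hle : ∀ s ∈ Ioo a b, sobolevSq 0 (rhs ν (c s)) ≤
      (ENNReal.ofReal (2 * ν ^ 2) + 2 * (ENNReal.ofReal 432 * ENNReal.ofReal S)) * sobolevSq 2 (c s) +
        2 * (ENNReal.ofReal 432 * (ENNReal.ofReal S * ENNReal.ofReal S)) := fun s hs => by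
    have h1 := hc1 s (Ioo_subset_Icc_self hs)
    refine (sobolevSq_zero_rhs_le ν (c s)).trans ?_
    calc _ ≤ ENNReal.ofReal (2 * ν ^ 2) * sobolevSq 2 (c s) + 2 * (ENNReal.ofReal 432 *
          (ENNReal.ofReal S * (ENNReal.ofReal S + sobolevSq 2 (c s)))) := by gcongr
      _ = _ := by ring
  refine (setLIntegral_mono' measurableSet_Ioo hle).trans_lt ?_
  rw [lintegral_add_right _ measurable_const, lintegral_const_mul' _ _ (by finiteness),
    setLIntegral_const]
  have := (measure_Ioo_lt_top : volume (Ioo a b) < ⊤)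
  finiteness

end regularity

end Burgers
end

noncomputable section
namespace Burgers
open scoped ComplexConjugate

/-! ### The weak form of the equation -/

lemma dualPairing_fourierCoeffs {f φ : T3 → V3} (hf : MemLp f 2 volume) (hφ : MemLp φ 2 volume) :
    dualPairing (fourierCoeffs f) φ = ((∫ x, inner ℝ (f x) (φ x) : ℝ) : ℂ) := by
  have hv : (vol : ℂ) ≠ 0 := by exact_mod_cast vol_pos.ne'
  have h := (hasSum_fourierCoeffs_inner hf hφ).tsum_eq
  rw [dualPairing]
  refine (congrArg ((vol : ℂ) * ·) h).trans ?_
  field_simp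

lemma coeFn_toLp_synth (f : C(T3, V3)) :
    ((f.continuous.memLp_two.toLp (f : T3 → V3) : L2) : T3 → V3) =ᵐ[volume] f :=
  f.continuous.memLp_two.coeFn_toLp

lemma fourierCoeffs_toLp (f : C(T3, V3)) :
    fourierCoeffs (f.continuous.memLp_two.toLp (f : T3 → V3) : L2) = fourierCoeffs f :=
  fourierCoeffs_congr (coeFn_toLp_synth f)

/-- For a smooth field the weak form is the pointwise identity `IsRapid.synth_rhs` integrated
against φ, the viscous term being integrated by parts once through the weak second derivatives. -/
lemma IsRapid.weakEquation {m : (Fin 3 → ℤ) → ℝ} (hm : IsRapid m) {c : Coeffs}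
    (hc : ∀ k, ‖c k‖ ≤ m k) (hr : IsReal c) {ν : ℝ} (hν : 0 < ν) {u : L2} (hu : fourierCoeffs u = c)
    {φ : T3 → V3} (hφ : IsCn ∞ φ) : WeakEquation ν u (rhs ν c) φ := by
  have hm1 := hm.mul_wt_pow 1
  have hcj := fun j => norm_coeffD_le_of_le hc j
  set D : Fin 3 → C(T3, V3) := fun j => synth (coeffD j c)
  set DD : Fin 3 → C(T3, V3) := fun j => synth (coeffD j (coeffD j c))
  set G : Fin 3 → L2 := fun j => (D j).continuous.memLp_two.toLp (D j : T3 → V3)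
  set H : Fin 3 → L2 := fun j => (DD j).continuous.memLp_two.toLp (DD j : T3 → V3)
  have hGc : ∀ j, fourierCoeffs (G j) = coeffD j c := fun j =>
    (fourierCoeffs_toLp _).trans (hm.fourierCoeffs_synth_coeffD hc hr j)
  have hHc : ∀ j, fourierCoeffs (H j) = coeffD j (coeffD j c) := fun j =>
    (fourierCoeffs_toLp _).trans (hm1.fourierCoeffs_synth_coeffD (hcj j) (isReal_coeffD hr j) j)
  have hG : ∀ j, IsWeakPartial j u (G j) := fun j =>
    isWeakPartial_of_fourierCoeffs (by rw [hGc, hu])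
  have hH : ∀ j, IsWeakPartial j (G j) (H j) := fun j =>
    isWeakPartial_of_fourierCoeffs (by rw [hHc, hGc])
  have hus : (u : T3 → V3) =ᵐ[volume] synth c :=
    ae_eq_of_fourierCoeffs_eq (Lp.memLp u) (synth c).continuous.memLp_two
      (by rw [hu, hm.fourierCoeffs_synth hc hr])
  refine ⟨G, hG, ?_⟩
  have hφL : MemLp φ 2 (volume : Measure T3) := hφ.continuous.memLp_two
  have hrhs : Summable fun k => ‖rhs ν c k‖ := Summable.of_nonneg_of_le (fun _ => norm_nonneg _)
    (fun k => hm.norm_rhs_le hc hν k) (hm.summable_rhsBound ν)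
  have e1 := dualPairing_fourierCoeffs (synth (rhs ν c)).continuous.memLp_two hφL
  rw [Burgers.fourierCoeffs_synth hrhs (IsReal.rhs ν ((sobolevSq_one_le_of_norm_le hm.isMajorant hc).trans_lt
    ENNReal.ofReal_lt_top) hr)] at e1
  have e2 : ∫ x, inner ℝ (∑ j, u x j • G j x) (φ x) =
      ∫ x, inner ℝ (∑ j, synth c x j • D j x) (φ x) := by
    refine integral_congr_ae ?_
    filter_upwards [hus, ae_all_iff.2 fun j => coeFn_toLp_synth (D j)] with x hx hx2
    rw [hx]
    simp only [G, hx2]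
  have e3 : ∀ j, ∫ x, inner ℝ (G j x) (partialD j φ x) = -∫ x, inner ℝ (DD j x) (φ x) := fun j => by
    rw [hH j φ hφ]
    congr 1
    refine integral_congr_ae ?_
    filter_upwards [coeFn_toLp_synth (DD j)] with x hx
    simp only [H, hx]
  have hDD : ∀ j, partialD j (partialD j (synth c)) = DD j := fun j => by
    rw [hm.partialD_eq hc, hm1.partialD_eq (hcj j)]
  have hD : ∀ j, partialD j (synth c) = D j := fun j => hm.partialD_eq hc j
  have hφc := hφ.continuous
  have i1 : ∀ j, Integrable (fun x => inner ℝ (DD j x) (φ x)) (volume : Measure T3) := fun j =>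
    ((DD j).continuous.inner hφc).integrable_torus
  have i2 : Integrable (fun x => inner ℝ (∑ j, synth c x j • D j x) (φ x)) (volume : Measure T3) := by
    refine (Continuous.inner (continuous_finsetSum _ fun j _ =>
      Continuous.smul (f := fun x => synth c x j) ?_ (D j).continuous) hφc).integrable_torus
    exact (EuclideanSpace.proj (𝕜 := ℝ) j).continuous.comp (synth c).continuous
  have e4 : ∫ x, inner ℝ (synth (rhs ν c) x) (φ x) = ν * (∑ j, ∫ x, inner ℝ (DD j x) (φ x)) -
      ∫ x, inner ℝ (∑ j, synth c x j • D j x) (φ x) := by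
    rw [← integral_finsetSum _ fun j _ => i1 j, ← integral_const_mul, ← integral_sub
      ((integrable_finsetSum _ fun j _ => i1 j).const_mul ν) i2]
    refine integral_congr_ae (Eventually.of_forall fun x => ?_)
    beta_reduce
    rw [hm.synth_rhs hc hr, inner_sub_left, inner_smul_left, sum_inner]
    simp only [hDD]
    simp only [hD]
    rfl
  rw [e1, e2, Finset.sum_congr rfl fun j _ => e3 j, e4, Finset.sum_neg_distrib]
  push_cast
  ring

section constructed

variable {ν T : ℝ} {c : ℝ → Coeffs} {u : ℝ → L2}

lemma IsCoeffSolution.isTimeDeriv (hT : 0 ≤ T) (h : IsCoeffSolution ν 0 T c)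
    (hu : ∀ t, 0 ≤ t → fourierCoeffs (u t) = c t) : IsTimeDeriv T u fun t => rhs ν (c t) := by
  intro ψ hψ _ hsupp k
  have hd := hψ.differentiable (by simp)
  have hψ' : Continuous (deriv ψ) := hψ.continuous_deriv (by norm_cast)
  have hzero : ∀ t, t ∉ Ioo 0 T → ψ t = 0 := fun t ht =>
    image_eq_zero_of_notMem_tsupport fun h' => ht (hsupp h')
  have c1 : ContinuousOn (fun t => deriv ψ t • c t k) (Icc 0 T) :=
    hψ'.continuousOn.smul (h.continuousOn k)
  have c2 : ContinuousOn (fun t => ψ t • rhs ν (c t) k) (Icc 0 T) :=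
    hψ.continuous.continuousOn.smul (h.continuousOn_rhs k)
  have I : ∀ {f : ℝ → EuclideanSpace ℂ (Fin 3)}, ContinuousOn f (Icc 0 T) →
      IntervalIntegrable f volume 0 T := fun hf =>
    ContinuousOn.intervalIntegrable (by rwa [uIcc_of_le hT])
  have key := intervalIntegral.integral_eq_sub_of_hasDerivAt_of_le hT
    (f := fun t => ψ t • c t k) (f' := fun t => ψ t • rhs ν (c t) k + deriv ψ t • c t k)
    (hψ.continuous.continuousOn.smul (h.continuousOn k))
    (fun t ht => (hd t).hasDerivAt.smul (h.hasDerivAt ht k)) ((I c2).add (I c1))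
  rw [intervalIntegral.integral_add (I c2) (I c1), hzero T (by simp), hzero 0 (by simp), zero_smul,
    zero_smul, sub_zero, intervalIntegral.integral_of_le hT, intervalIntegral.integral_of_le hT,
    integral_Ioc_eq_integral_Ioo, integral_Ioc_eq_integral_Ioo] at key
  rw [eq_neg_iff_add_eq_zero, add_comm, ← key]
  congr 1
  refine setIntegral_congr_fun measurableSet_Ioo fun t ht => ?_
  beta_reduce
  rw [hu t ht.1.le]

lemma IsCoeffSolution.contIntoH (h : IsCoeffSolution ν 0 T c)
    (hu : ∀ t, 0 ≤ t → fourierCoeffs (u t) = c t) {s : ℝ} (hs : s ≤ 1) :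
    ContIntoH s (Icc 0 T) u := by
  refine ⟨fun t ht => ?_, fun t ht => ?_⟩
  · rw [MemH, hu t ht.1]
    exact (sobolevSq_mono hs _).trans_lt (h.sobolevSq_one_lt_top ht)
  · refine tendsto_of_tendsto_of_tendsto_of_le_of_le' tendsto_const_nhds (h.tendsto_sobolevSq_one ht)
      (Eventually.of_forall fun _ => zero_le) ?_
    filter_upwards [self_mem_nhdsWithin] with r hr
    rw [hu t ht.1, hu r hr.1]
    exact sobolevSq_mono hs _

lemma IsCoeffSolution.memL2H (hν : 0 < ν) (h : IsCoeffSolution ν 0 T c)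
    (hu : ∀ t, 0 ≤ t → fourierCoeffs (u t) = c t) {s : ℝ} (hs : s ≤ 2) :
    MemL2H s T fun t => fourierCoeffs (u t) := by
  refine ⟨fun k => ?_, ?_⟩
  · refine (((h.continuousOn k).mono Ioo_subset_Icc_self).congr fun t ht => ?_).aestronglyMeasurable
      measurableSet_Ioo
    beta_reduce
    rw [hu t ht.1.le]
  · refine (setLIntegral_mono' measurableSet_Ioo fun t ht => ?_).trans_lt
      (h.lintegral_sobolevSq_two_lt_top hν)
    beta_reduce
    rw [hu t ht.1.le]
    exact sobolevSq_mono hs _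

lemma IsCoeffSolution.isStrongSolutionOn (hν : 0 < ν) (hT : 0 ≤ T) (h : IsCoeffSolution ν 0 T c)
    (hr : IsReal (c 0)) (hu : ∀ t, 0 ≤ t → fourierCoeffs (u t) = c t) : IsStrongSolutionOn ν T u := by
  refine ⟨h.contIntoH hu (by norm_num), h.memL2H hν hu (by norm_num), fun t => rhs ν (c t),
    ⟨fun k => ?_, ?_⟩, h.isTimeDeriv hT hu, fun φ hφ => ?_⟩
  · exact ((h.continuousOn_rhs k).mono Ioo_subset_Icc_self).aestronglyMeasurable measurableSet_Ioo
  · exact (lintegral_mono fun t => sobolevSq_mono (by norm_num) _).trans_lt (h.lintegral_rhs_lt_top hν)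
  · refine (ae_restrict_iff' measurableSet_Ioo).2 (Eventually.of_forall fun t ht => ?_)
    obtain ⟨m, hm, hc⟩ := h.exists_isRapid hν ht.1
    exact hm.weakEquation (hc t ⟨le_rfl, ht.2.le⟩) (h.isReal hν hr t (Ioo_subset_Icc_self ht)) hν
      (hu t ht.1.le) hφ

end constructed

lemma contIntoH_Ici {s : ℝ} {u : ℝ → L2} (h : ∀ T, 0 ≤ T → ContIntoH s (Icc 0 T) u) :
    ContIntoH s (Ici 0) u := by
  refine ⟨fun t ht => (h t ht).1 t ⟨ht, le_rfl⟩, fun t ht => ?_⟩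
  have h0 : (0 : ℝ) ≤ t := ht
  refine ((h (t + 1) (by linarith)).2 t ⟨h0, by linarith⟩).mono_left (nhdsWithin_le_iff.2 ?_)
  filter_upwards [self_mem_nhdsWithin, mem_nhdsWithin_of_mem_nhds (Iio_mem_nhds (lt_add_one t))]
    with r hr hr' using ⟨hr, le_of_lt hr'⟩

/-! ### The classical solution -/

lemma _root_.ContinuousOn.coeffD {f : ℝ → Coeffs} {s : Set ℝ} {k : Fin 3 → ℤ}
    (hf : ContinuousOn (fun t => f t k) s) (j : Fin 3) :
    ContinuousOn (fun t => coeffD j (f t) k) s := by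
  unfold Burgers.coeffD
  exact hf.const_smul (Complex.I * (k j : ℂ))

/-- Around each t > 0 one rapid majorant is valid on [t/2, t+1]. The series for the field, its first
two spatial derivatives and its time derivative therefore converge uniformly in space and time
there. -/
lemma isClassicalSolution_synth {ν : ℝ} (hν : 0 < ν) {c : ℝ → Coeffs}
    (h : ∀ T, 0 ≤ T → IsCoeffSolution ν 0 T c) (hr : IsReal (c 0)) :
    IsClassicalSolution ν fun t => synth (c t) := by
  have hR : ∀ t, 0 < t → ∃ m, IsRapid m ∧ ∀ s ∈ Icc (t / 2) (t + 1), ∀ k, ‖c s k‖ ≤ m k :=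
    fun t ht => (h (t + 1) (by linarith)).exists_isRapid hν (half_pos ht)
  have hnhds : ∀ t : ℝ, 0 < t → Icc (t / 2) (t + 1) ∈ 𝓝 t := fun t ht =>
    Icc_mem_nhds (half_lt_self ht) (lt_add_one t)
  have hmem : ∀ t : ℝ, 0 < t → t ∈ Icc (t / 2) (t + 1) := fun t ht => mem_of_mem_nhds (hnhds t ht)
  have hsub : ∀ t : ℝ, 0 < t → Icc (t / 2) (t + 1) ⊆ Icc 0 (t + 1) := fun t ht =>
    Icc_subset_Icc_left (half_pos ht).le
  have hder : ∀ t, 0 < t → HasDerivAt (fun t => synth (c t)) (synth (rhs ν (c t))) t := fun t ht =>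
    (h (t + 1) (by linarith)).hasDerivAt_synth hν ⟨ht, lt_add_one t⟩
  have hcontD : ∀ j t, 0 < t → ContinuousAt (fun r => synth (coeffD j (c r))) t := fun j t ht => by
    obtain ⟨m, hm, hc⟩ := hR t ht
    refine (continuousOn_synth (s := Icc (t / 2) (t + 1)) (m := fun k => wt k ^ 1 * m k) (fun k => ?_)
      (hm.mul_wt_pow 1).summable fun s hs => norm_coeffD_le_of_le (hc s hs) j).continuousAt (hnhds t ht)
    exact (((h (t + 1) (by linarith)).continuousOn k).mono (hsub t ht)).coeffD j
  have hcontDD : ∀ i j t, 0 < t → ContinuousAt (fun r => synth (coeffD i (coeffD j (c r)))) t :=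
    fun i j t ht => by
    obtain ⟨m, hm, hc⟩ := hR t ht
    refine (continuousOn_synth (s := Icc (t / 2) (t + 1)) (m := fun k => wt k ^ 1 * (wt k ^ 1 * m k))
      (fun k => ?_) ((hm.mul_wt_pow 1).mul_wt_pow 1).summable fun s hs =>
        norm_coeffD_le_of_le (norm_coeffD_le_of_le (hc s hs) j) i).continuousAt (hnhds t ht)
    exact ((((h (t + 1) (by linarith)).continuousOn k).mono (hsub t ht)).coeffD j).coeffD i
  have hpD : ∀ j t, 0 < t → partialD j (synth (c t)) = synth (coeffD j (c t)) := fun j t ht => by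
    obtain ⟨m, hm, hc⟩ := hR t ht
    exact hm.partialD_eq (hc t (hmem t ht)) j
  have hpDD : ∀ i j t, 0 < t →
      partialD i (partialD j (synth (c t))) = synth (coeffD i (coeffD j (c t))) := fun i j t ht => by
    obtain ⟨m, hm, hc⟩ := hR t ht
    rw [hpD j t ht, (hm.mul_wt_pow 1).partialD_eq (norm_coeffD_le_of_le (hc t (hmem t ht)) j)]
  refine ⟨?_, ⟨fun t ht => ?_, ?_, fun j t ht => ?_, fun i j t ht => ?_⟩, fun t ht x => ?_⟩
  · rw [contDiffOn_one_iff_derivWithin (uniqueDiffOn_Ioi 0)]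
    refine ⟨fun t ht => (hder t ht).differentiableAt.differentiableWithinAt, fun t ht => ?_⟩
    have ht0 : (0 : ℝ) < t := ht
    obtain ⟨m, hm, hc⟩ := hR t ht
    have h1 : ContinuousAt (fun r => synth (rhs ν (c r))) t :=
      (continuousOn_synth (s := Icc (t / 2) (t + 1))
        (fun k => ((h (t + 1) (by linarith)).continuousOn_rhs k).mono (hsub t ht))
        (hm.summable_rhsBound ν) fun s hs => hm.norm_rhs_le (hc s hs) hν).continuousAt (hnhds t ht)
    refine h1.continuousWithinAt.congr (fun s hs => ?_) ?_
    · rw [derivWithin_of_isOpen isOpen_Ioi hs, (hder s hs).deriv]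
    · rw [derivWithin_of_isOpen isOpen_Ioi ht, (hder t ht).deriv]
  · obtain ⟨m, hm, hc⟩ := hR t ht
    exact hm.isCn (hc t (hmem t ht)) 2
  · exact fun t ht => (hder t ht).continuousAt.continuousWithinAt
  · have h1 := ContinuousMap.tendsto_iff_tendstoUniformly.1 (hcontD j t ht)
    rw [← hpD j t ht] at h1
    intro U hU
    filter_upwards [h1 U hU, lt_mem_nhds ht] with r hr1 hr2 x
    rw [hpD j r hr2]
    exact hr1 x
  · have h1 := ContinuousMap.tendsto_iff_tendstoUniformly.1 (hcontDD i j t ht)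
    rw [← hpDD i j t ht] at h1
    intro U hU
    filter_upwards [h1 U hU, lt_mem_nhds ht] with r hr1 hr2 x
    rw [hpDD i j r hr2]
    exact hr1 x
  · obtain ⟨m, hm, hc⟩ := hR t ht
    have hreal := (h t ht.le).isReal hν hr t ⟨ht.le, le_rfl⟩
    rw [(hder t ht).deriv, hm.synth_rhs (hc t (hmem t ht)) hreal]
    abel

end Burgers
end

noncomputable section
namespace Burgers
open scoped ComplexConjugate

/-! ### Strong solutions solve the equations for the Fourier coefficients -/

lemma dualPairing_of_conj_eq (d : Coeffs) {φ : T3 → V3} {m : Fin 3 → ℤ} {i : Fin 3} {z w : ℂ}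
    (h : ∀ k l, conj (fourierCoeffs φ k l) =
      if l = i then ((if m = k then z else 0) + if -m = k then w else 0) else 0) :
    dualPairing d φ = (vol : ℂ) * (d m i * z + d (-m) i * w) := by
  rw [dualPairing]
  congr 1
  refine HasSum.tsum_eq ?_
  have h1 : ∀ (n : Fin 3 → ℤ) (y : ℂ), HasSum (fun k => if n = k then d k i * y else 0) (d n i * y) :=
    fun n y => by
    have := hasSum_single (f := fun k => if n = k then d k i * y else 0) n
      fun k hk => if_neg (Ne.symm hk)
    rwa [if_pos rfl] at this
  have h2 := (h1 m z).add (h1 (-m) w)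
  convert h2 using 2 with k
  simp only [h, mul_ite, mul_zero, Finset.sum_ite_eq', Finset.mem_univ, if_true, mul_add]

lemma scalarCoeff_add {f g : T3 → ℂ} (hf : Continuous f) (hg : Continuous g) (k : Fin 3 → ℤ) :
    scalarCoeff (fun x => f x + g x) k = scalarCoeff f k + scalarCoeff g k := by
  have h1 : Continuous fun x => character (-k) x * f x := (continuous_character _).mul hf
  have h2 : Continuous fun x => character (-k) x * g x := (continuous_character _).mul hg
  simp only [scalarCoeff, mul_add]
  rw [integral_add h1.integrable_torus h2.integrable_torus, mul_add]

lemma scalarCoeff_two_characters (m k : Fin 3 → ℤ) (z w : ℂ) :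
    scalarCoeff (fun x => character m x * z + character (-m) x * w) k =
      (if m = k then z else 0) + if -m = k then w else 0 := by
  have h : ∀ (n : Fin 3 → ℤ) (y : ℂ), Continuous fun x => character n x * y := fun n y =>
    (continuous_character n).mul continuous_const
  rw [scalarCoeff_add (h m z) (h (-m) w), scalarCoeff_mul_const, scalarCoeff_mul_const]

lemma conj_fourierCoeffs_single {f : T3 → ℝ} {m : Fin 3 → ℤ} {z w : ℂ}
    (hf : ∀ x, ((f x : ℝ) : ℂ) = character m x * conj z + character (-m) x * conj w) (i : Fin 3)
    (k : Fin 3 → ℤ) (l : Fin 3) :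
    conj (fourierCoeffs (fun x => EuclideanSpace.single i (f x)) k l) =
      if l = i then ((if m = k then z else 0) + if -m = k then w else 0) else 0 := by
  rw [fourierCoeffs_apply]
  by_cases hl : l = i
  · subst hl
    simp only [PiLp.single_apply, if_true, hf, scalarCoeff_two_characters, map_add]
    congr 1 <;> split_ifs <;> simp
  · simp [hl, scalarCoeff]

lemma dualPairing_cosField (d : Coeffs) (m : Fin 3 → ℤ) (i : Fin 3) :
    dualPairing d (cosField m i) = (vol : ℂ) * (d m i * 2⁻¹ + d (-m) i * 2⁻¹) := by
  refine dualPairing_of_conj_eq d fun k l => conj_fourierCoeffs_single (fun x => ?_) i k l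
  rw [character_neg, Complex.re_eq_add_conj]
  simp only [map_inv₀, Complex.conj_ofNat]
  ring

lemma dualPairing_sinField (d : Coeffs) (m : Fin 3 → ℤ) (i : Fin 3) :
    dualPairing d (sinField m i) =
      (vol : ℂ) * (d m i * (Complex.I / 2) + d (-m) i * (-(Complex.I / 2))) := by
  refine dualPairing_of_conj_eq d fun k l => conj_fourierCoeffs_single (fun x => ?_) i k l
  rw [character_neg, Complex.im_eq_sub_conj]
  simp only [map_neg, map_div₀, Complex.conj_I, Complex.conj_ofNat]
  field_simp
  rw [Complex.I_sq]
  ring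

/-- The combination of the cosine equation and -i times the sine equation tests with e^{-im·x},
which isolates the mode m in all three terms. -/
lemma eq_rhs_of_weakEquation {ν : ℝ} {u : L2} {d : Coeffs} {m : Fin 3 → ℤ} {i : Fin 3}
    (h1 : WeakEquation ν u d (cosField m i)) (h2 : WeakEquation ν u d (sinField m i)) :
    d m i = rhs ν (fourierCoeffs u) m i := by
  obtain ⟨G, hG, e1⟩ := h1
  obtain ⟨G', hG', e2⟩ := h2
  -- Each weak equation provides its own gradient; they coincide, having the same Fourier
  -- coefficients.
  have hGG : G' = G := funext fun j => L2_ext (by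
    rw [fourierCoeffs_of_isWeakPartial (hG j), fourierCoeffs_of_isWeakPartial (hG' j)])
  subst hGG
  have hv : (vol : ℂ) ≠ 0 := by exact_mod_cast vol_pos.ne'
  have hN : Integrable (fun x => ∑ j, u x j • G' j x) (volume : Measure T3) := by
    refine integrable_finsetSum _ fun j _ => ?_
    have hu : MemLp (fun x => u x j) 2 (volume : Measure T3) :=
      (EuclideanSpace.proj (𝕜 := ℝ) j).comp_memLp' (Lp.memLp u)
    exact ((Lp.memLp (G' j)).smul (r := 1) hu).integrable le_rfl
  have n1 := fourierCoeffs_eq_integral_inner hN m i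
  rw [fourierCoeffs_sum_smul (Lp.memLp u) (fun j => Lp.memLp (G' j))
    fun j => fourierCoeffs_of_isWeakPartial (hG j)] at n1
  have g1 : ∀ j, ((∫ x, inner ℝ (G' j x) (cosField m i x) : ℝ) : ℂ) -
      Complex.I * ((∫ x, inner ℝ (G' j x) (sinField m i x) : ℝ) : ℂ) =
      (vol : ℂ) * (Complex.I * (m j : ℂ) * fourierCoeffs u m i) := fun j => by
    have := fourierCoeffs_eq_integral_inner (L2_integrable (G' j)) m i
    rw [fourierCoeffs_of_isWeakPartial (hG j), coeffD, PiLp.smul_apply, smul_eq_mul] at this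
    rw [this]
    field_simp
  rw [dualPairing_cosField] at e1
  rw [dualPairing_sinField] at e2
  simp only [partialD_cosField, partialD_sinField, inner_smul_right, integral_const_mul, neg_smul,
    inner_neg_right, integral_neg] at e1 e2
  have n2 : ((∫ x, inner ℝ (∑ j, u x j • G' j x) (cosField m i x) : ℝ) : ℂ) -
      Complex.I * ((∫ x, inner ℝ (∑ j, u x j • G' j x) (sinField m i x) : ℝ) : ℂ) =
      (vol : ℂ) * nonlin (fourierCoeffs u) (fourierCoeffs u) m i := by
    rw [n1]
    field_simp
  have g2 : (vol : ℂ) * (sqNorm m : ℂ) * fourierCoeffs u m i = ∑ j, (-Complex.I * (m j : ℂ)) *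
      (((∫ x, inner ℝ (G' j x) (cosField m i x) : ℝ) : ℂ) -
      Complex.I * ((∫ x, inner ℝ (G' j x) (sinField m i x) : ℝ) : ℂ)) := by
    simp only [g1, sqNorm]
    push_cast
    rw [Finset.mul_sum, Finset.sum_mul]
    refine Finset.sum_congr rfl fun j _ => ?_
    ring_nf
    simp
  have g3 : (∑ j, (-Complex.I * (m j : ℂ)) *
      (((∫ x, inner ℝ (G' j x) (cosField m i x) : ℝ) : ℂ) -
      Complex.I * ((∫ x, inner ℝ (G' j x) (sinField m i x) : ℝ) : ℂ))) =
      (∑ j, -((m j : ℂ) * ((∫ x, inner ℝ (G' j x) (sinField m i x) : ℝ) : ℂ))) -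
      Complex.I * ∑ j, (m j : ℂ) * ((∫ x, inner ℝ (G' j x) (cosField m i x) : ℝ) : ℂ) := by
    rw [Finset.mul_sum, ← Finset.sum_sub_distrib]
    refine Finset.sum_congr rfl fun j _ => ?_
    ring_nf
    simp
    ring
  have hr : rhs ν (fourierCoeffs u) m i = -((ν : ℂ) * (sqNorm m : ℂ) * fourierCoeffs u m i) -
      nonlin (fourierCoeffs u) (fourierCoeffs u) m i := by
    simp [rhs]
  rw [hr]
  rw [g3] at g2
  have hV : (vol : ℂ) = (2 * (Real.pi : ℂ)) ^ 3 := by push_cast; rfl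
  push_cast at e1 e2
  rw [← hV] at e1 e2
  refine mul_left_cancel₀ hv ?_
  -- In the two dual pairings the contributions of d(-m) cancel and those of d(m) add up; this uses
  -- i² = -1, which accounts for the last summand.
  linear_combination (exp := 1) e1 - Complex.I * e2 - n2 + (ν : ℂ) * g2 +
    (vol : ℂ) * (d m i - d (-m) i) / 2 * (Complex.I_sq)

end Burgers
end

noncomputable section
namespace Burgers
open scoped ComplexConjugate

/-! ### Distributional derivatives in time -/

/-- Test functions on `(0, T)`. -/
def IsTest (T : ℝ) (ψ : ℝ → ℝ) : Prop :=
  ContDiff ℝ ∞ ψ ∧ HasCompactSupport ψ ∧ tsupport ψ ⊆ Ioo 0 T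

lemma IsTest.eq_zero {T : ℝ} {ψ : ℝ → ℝ} (h : IsTest T ψ) {t : ℝ} (ht : t ∉ Ioo 0 T) : ψ t = 0 :=
  image_eq_zero_of_notMem_tsupport fun h' => ht (h.2.2 h')

lemma exists_isTest {T : ℝ} (hT : 0 < T) : ∃ η, IsTest T η ∧ 0 < ∫ t in 0..T, η t := by
  obtain ⟨η, h1, h2, h3, h4, h5⟩ := exists_contDiff_tsupport_subset (n := ⊤)
    (Ioo_mem_nhds (by linarith : (0 : ℝ) < T / 2) (by linarith : T / 2 < T))
  refine ⟨η, ⟨h3, h2, h1⟩, ?_⟩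
  refine intervalIntegral.integral_pos hT h3.continuous.continuousOn
    (fun t _ => (h4 (mem_range_self t)).1) ⟨T / 2, ⟨by linarith, by linarith⟩, by rw [h5]; norm_num⟩

/-- The primitive vanishes to the left of both supports, and to their right because the total
integral is zero. A nonzero value of `η` makes the union of the supports nonempty, so that it has a
least and a greatest point. -/
lemma IsTest.primitive {T : ℝ} {χ η : ℝ → ℝ} (hχ : IsTest T χ) (hη : IsTest T η) {r : ℝ}
    (hη0 : ∃ t, η t ≠ 0) (h0 : ∫ s in 0..T, (χ s - r * η s) = 0) :
    IsTest T fun t => ∫ s in 0..t, (χ s - r * η s) := by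
  set ρ : ℝ → ℝ := fun s => χ s - r * η s with hρ
  have hρs : ContDiff ℝ ∞ ρ := hχ.1.sub (contDiff_const.mul hη.1)
  have hd : ∀ t, HasDerivAt (fun t => ∫ s in 0..t, ρ s) (ρ t) t := fun t =>
    hρs.continuous.integral_hasStrictDerivAt 0 t |>.hasDerivAt
  have hI : ∀ s t, IntervalIntegrable ρ volume s t := fun s t => hρs.continuous.intervalIntegrable s t
  have hK : IsCompact (tsupport χ ∪ tsupport η) := hχ.2.1.isCompact.union hη.2.1.isCompact
  have hne : (tsupport χ ∪ tsupport η).Nonempty := by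
    obtain ⟨t, ht⟩ := hη0
    exact ⟨t, Or.inr (subset_tsupport _ ht)⟩
  have hKT : tsupport χ ∪ tsupport η ⊆ Ioo 0 T := union_subset hχ.2.2 hη.2.2
  obtain ⟨a, ha⟩ := hK.exists_isLeast hne
  obtain ⟨b, hb⟩ := hK.exists_isGreatest hne
  have haT := hKT ha.1
  have hbT := hKT hb.1
  have hz : ∀ s, s ∉ Icc a b → ρ s = 0 := fun s hs => by
    have hs' : s ∉ tsupport χ ∪ tsupport η := fun h => hs ⟨ha.2 h, hb.2 h⟩
    rw [mem_union, not_or] at hs'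
    simp only [hρ, image_eq_zero_of_notMem_tsupport hs'.1, image_eq_zero_of_notMem_tsupport hs'.2,
      mul_zero, sub_zero]
  have hsupp : (Function.support fun t => ∫ s in 0..t, ρ s) ⊆ Icc a b := by
    intro t ht
    by_contra hab
    apply ht
    beta_reduce
    rw [mem_Icc, not_and_or, not_le, not_le] at hab
    rcases hab with hta | hbt
    · refine intervalIntegral.integral_zero_ae (Eventually.of_forall fun s hs => hz s fun hs' => ?_)
      have := (uIoc_subset_uIcc hs).2.trans (max_le haT.1.le hta.le)
      rcases le_total 0 t with h | h
      · rw [uIoc_of_le h] at hs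
        linarith [hs.2, hs'.1]
      · rw [uIoc_of_ge h] at hs
        linarith [hs.2, hs'.1, haT.1]
    · rw [← intervalIntegral.integral_add_adjacent_intervals (hI 0 T) (hI T t), h0, zero_add]
      refine intervalIntegral.integral_zero_ae (Eventually.of_forall fun s hs => hz s fun hs' => ?_)
      rcases le_total T t with h | h
      · rw [uIoc_of_le h] at hs
        linarith [hs.1, hs'.2, hbT.2]
      · rw [uIoc_of_ge h] at hs
        linarith [hs.1, hs'.2]
  refine ⟨?_, HasCompactSupport.of_support_subset_isCompact isCompact_Icc hsupp,
    (closure_minimal hsupp isClosed_Icc).trans (Icc_subset_Ioo haT.1 hbT.2)⟩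
  rw [contDiff_infty_iff_deriv]
  refine ⟨fun t => (hd t).differentiableAt, ?_⟩
  rw [funext fun t => (hd t).deriv]
  exact hρs

/-- A continuous function with vanishing distributional derivative is constant. -/
lemma eq_const_of_integral_deriv_mul_eq_zero {g : ℝ → ℝ} {T : ℝ} (hT : 0 < T)
    (hg : ContinuousOn g (Icc 0 T)) (h : ∀ ψ, IsTest T ψ → ∫ t in 0..T, deriv ψ t * g t = 0) :
    ∀ t ∈ Icc 0 T, g t = g 0 := by
  obtain ⟨η, hη, hη1⟩ := exists_isTest hT
  have hη0 : ∃ t, η t ≠ 0 := by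
    by_contra! h0
    simp [h0] at hη1
  have I : ∀ {f : ℝ → ℝ}, ContinuousOn f (Icc 0 T) → IntervalIntegrable f volume 0 T := fun hf =>
    ContinuousOn.intervalIntegrable (by rwa [uIcc_of_le hT.le])
  have cg : ∀ {χ}, IsTest T χ → ContinuousOn (fun t => χ t * g t) (Icc 0 T) := fun hχ =>
    hχ.1.continuous.continuousOn.mul hg
  set K := (∫ t in 0..T, η t * g t) / ∫ t in 0..T, η t with hK
  -- The function χ - rη has mean zero, hence is the derivative of a test function. This gives ∫χg =
  -- r∫ηg = K∫χ, so g - K annihilates all test functions.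
  have key : ∀ χ, IsTest T χ → ∫ t in 0..T, χ t * (g t - K) = 0 := fun χ hχ => by
    set r := (∫ t in 0..T, χ t) / ∫ t in 0..T, η t with hr
    have c1 := I hχ.1.continuous.continuousOn
    have c2 := I hη.1.continuous.continuousOn
    have h0 : ∫ s in 0..T, (χ s - r * η s) = 0 := by
      rw [intervalIntegral.integral_sub c1 (c2.const_mul r), intervalIntegral.integral_const_mul, hr,
        div_mul_cancel₀ _ hη1.ne', sub_self]
    have h1 := h _ (hχ.primitive hη hη0 h0)
    have hd : ∀ t, deriv (fun t => ∫ s in 0..t, (χ s - r * η s)) t = χ t - r * η t := fun t =>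
      ((hχ.1.continuous.sub (continuous_const.mul hη.1.continuous)).integral_hasStrictDerivAt 0
        t).hasDerivAt.deriv
    simp only [hd, sub_mul, mul_assoc] at h1
    rw [intervalIntegral.integral_sub (I (cg hχ)) ((I (cg hη)).const_mul r),
      intervalIntegral.integral_const_mul] at h1
    simp only [mul_sub]
    rw [intervalIntegral.integral_sub (I (cg hχ)) (c1.mul_const K),
      intervalIntegral.integral_mul_const]
    refine Eq.trans ?_ h1
    rw [hK, hr]
    ring
  have hae := isOpen_Ioo.ae_eq_zero_of_integral_contDiff_smul_eq_zero (μ := (volume : Measure ℝ))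
    (f := fun t => g t - K) (U := Ioo 0 T)
    (((hg.mono Ioo_subset_Icc_self).sub continuousOn_const).locallyIntegrableOn measurableSet_Ioo)
    fun χ h1 h2 h3 => by
      rw [← key χ ⟨h1, h2, h3⟩, intervalIntegral.integral_of_le hT.le, integral_Ioc_eq_integral_Ioo]
      symm
      refine setIntegral_eq_integral_of_forall_compl_eq_zero fun t ht => ?_
      rw [IsTest.eq_zero ⟨h1, h2, h3⟩ ht, zero_mul]
  have hconst : EqOn g (fun _ => K) (Icc 0 T) := by
    refine Measure.eqOn_Icc_of_ae_eq volume hT.ne ?_ hg continuousOn_const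
    rw [← restrict_Ioo_eq_restrict_Icc]
    refine (ae_restrict_iff' measurableSet_Ioo).2 ?_
    filter_upwards [hae] with t ht htI using sub_eq_zero.1 (ht htI)
  intro t ht
  rw [hconst ht, hconst ⟨le_rfl, hT.le⟩]

/-- The primitive of `F` is absolutely continuous, so it too has distributional derivative `F`; its
difference from `g` is continuous with vanishing derivative, hence constant. -/
lemma real_eq_add_integral {g F : ℝ → ℝ} {T : ℝ} (hT : 0 < T) (hg : ContinuousOn g (Icc 0 T))
    (hF : IntervalIntegrable F volume 0 T)
    (h : ∀ ψ, IsTest T ψ → ∫ t in 0..T, deriv ψ t * g t = -∫ t in 0..T, ψ t * F t) :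
    ∀ t ∈ Icc 0 T, g t = g 0 + ∫ s in 0..t, F s := by
  set P : ℝ → ℝ := fun t => ∫ s in 0..t, F s
  have hP : AbsolutelyContinuousOnInterval P 0 T :=
    hF.absolutelyContinuousOnInterval_intervalIntegral left_mem_uIcc
  have hPc : ContinuousOn P (Icc 0 T) := by
    have := hP.continuousOn
    rwa [uIcc_of_le hT.le] at this
  have I : ∀ {f : ℝ → ℝ}, ContinuousOn f (Icc 0 T) → IntervalIntegrable f volume 0 T := fun hf =>
    ContinuousOn.intervalIntegrable (by rwa [uIcc_of_le hT.le])
  have key := eq_const_of_integral_deriv_mul_eq_zero hT (hg.sub hPc) fun ψ hψ => by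
    have hψ' : Continuous (deriv ψ) := hψ.1.continuous_deriv (by norm_cast)
    obtain ⟨L, hL⟩ := hψ.1.lipschitzWith_of_hasCompactSupport hψ.2.1 (by simp)
    have hAC : AbsolutelyContinuousOnInterval ψ 0 T :=
      hL.lipschitzOnWith.absolutelyContinuousOnInterval
    have h1 := hAC.integral_deriv_mul_eq_sub hP
    rw [hψ.eq_zero (t := T) (by simp), hψ.eq_zero (t := 0) (by simp), zero_mul, zero_mul,
      sub_self] at h1
    have h2 : ∫ t in 0..T, deriv ψ t * P t + ψ t * deriv P t =
        ∫ t in 0..T, deriv ψ t * P t + ψ t * F t := by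
      refine intervalIntegral.integral_congr_ae ?_
      filter_upwards [hF.ae_hasDerivAt_integral] with x hx hxm
      rw [uIoc_of_le hT.le] at hxm
      have hx' : HasDerivAt P (F x) x :=
        hx (by rw [uIcc_of_le hT.le]; exact Ioc_subset_Icc_self hxm) 0 left_mem_uIcc
      rw [hx'.deriv]
    have c1 : IntervalIntegrable (fun t => deriv ψ t * P t) volume 0 T :=
      I (hψ'.continuousOn.mul hPc)
    have c2 : IntervalIntegrable (fun t => deriv ψ t * g t) volume 0 T :=
      I (hψ'.continuousOn.mul hg)
    have c3 := hF.continuousOn_mul (g := ψ) hψ.1.continuous.continuousOn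
    rw [h2, intervalIntegral.integral_add c1 c3] at h1
    simp only [Pi.sub_apply, mul_sub]
    rw [intervalIntegral.integral_sub c2 c1, h ψ hψ]
    linarith
  intro t ht
  have h1 := key t ht
  have h2 : P 0 = 0 := intervalIntegral.integral_same
  simp only [Pi.sub_apply, h2, sub_zero] at h1
  linarith

/-- A continuous function with an integrable distributional derivative is its primitive. -/
lemma eq_add_integral_of_isTimeDeriv {g F : ℝ → EuclideanSpace ℂ (Fin 3)} {T : ℝ} (hT : 0 < T)
    (hg : ContinuousOn g (Icc 0 T)) (hF : IntervalIntegrable F volume 0 T)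
    (h : ∀ ψ, IsTest T ψ → ∫ t in Ioo 0 T, deriv ψ t • g t = -∫ t in Ioo 0 T, ψ t • F t) :
    ∀ t ∈ Icc 0 T, g t = g 0 + ∫ s in 0..t, F s := by
  intro t ht
  refine (SeparatingDual.eq_iff_forall_dual_eq (R := ℝ)).2 fun L => ?_
  have hFt : IntervalIntegrable F volume 0 t := hF.mono_set (by
    rw [uIcc_of_le ht.1, uIcc_of_le hT.le]
    exact Icc_subset_Icc_right ht.2)
  rw [map_add, ← L.intervalIntegral_comp_comm hFt]
  refine real_eq_add_integral hT (L.continuous.comp_continuousOn hg)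
    ⟨L.integrable_comp hF.1, L.integrable_comp hF.2⟩ (fun ψ hψ => ?_) t ht
  have hψ' : Continuous (deriv ψ) := hψ.1.continuous_deriv (by norm_cast)
  have c1 : IntervalIntegrable (fun t => deriv ψ t • g t) volume 0 T :=
    ContinuousOn.intervalIntegrable (by rw [uIcc_of_le hT.le]; exact hψ'.continuousOn.smul hg)
  have c2 : IntervalIntegrable (fun t => ψ t • F t) volume 0 T :=
    hF.continuousOn_smul hψ.1.continuous.continuousOn
  have h1 := h ψ hψ
  rw [← integral_Ioc_eq_integral_Ioo, ← integral_Ioc_eq_integral_Ioo,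
    ← intervalIntegral.integral_of_le hT.le, ← intervalIntegral.integral_of_le hT.le] at h1
  have h2 := congrArg L h1
  rw [map_neg, ← L.intervalIntegral_comp_comm c1, ← L.intervalIntegral_comp_comm c2] at h2
  simpa only [map_smul, smul_eq_mul, Function.comp_apply] using h2

end Burgers
end

noncomputable section
namespace Burgers
open scoped ComplexConjugate

/-! ### Uniqueness of strong solutions -/

lemma ContIntoH.continuousOn_coeff {s : ℝ} (hs : 0 ≤ s) {I : Set ℝ} {u : ℝ → L2}
    (h : ContIntoH s I u) (k : Fin 3 → ℤ) : ContinuousOn (fun t => fourierCoeffs (u t) k) I := by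
  intro t ht
  rw [ContinuousWithinAt, tendsto_iff_edist_tendsto_0]
  have h1 : Tendsto (fun r => sobolevSq s (fourierCoeffs (u r) - fourierCoeffs (u t)) ^ (2⁻¹ : ℝ))
      (𝓝[I] t) (𝓝 0) := by
    have := ((ENNReal.continuous_rpow_const (y := 2⁻¹)).tendsto 0).comp (h.2 t ht)
    rwa [ENNReal.zero_rpow_of_pos (by norm_num)] at this
  refine tendsto_of_tendsto_of_tendsto_of_le_of_le tendsto_const_nhds h1 (fun _ => zero_le)
    fun r => ?_
  have h2 : ‖fourierCoeffs (u r) k - fourierCoeffs (u t) k‖ₑ ^ 2 ≤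
      sobolevSq s (fourierCoeffs (u r) - fourierCoeffs (u t)) := by
    refine le_trans ?_ (sobolevSq_mono hs _)
    rw [sobolevSq_zero]
    exact ENNReal.le_tsum (f := fun k => ‖(fourierCoeffs (u r) - fourierCoeffs (u t)) k‖ₑ ^ 2) k
  have h3 := ENNReal.rpow_le_rpow h2 (by norm_num : (0 : ℝ) ≤ 2⁻¹)
  rw [← ENNReal.rpow_natCast, ← ENNReal.rpow_mul] at h3
  norm_num at h3
  rw [edist_eq_enorm_sub]
  simpa using h3

/-- Near each time the norm is bounded by its value there through the triangle inequality;
compactness makes the bound uniform. -/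
lemma ContIntoH.exists_bound {s : ℝ} {I : Set ℝ} (hI : IsCompact I) {u : ℝ → L2}
    (h : ContIntoH s I u) : ∃ B < (⊤ : ENNReal), ∀ t ∈ I, sobolevSq s (fourierCoeffs (u t)) ≤ B := by
  refine hI.induction_on (p := fun J => ∃ B < (⊤ : ENNReal), ∀ t ∈ J,
    sobolevSq s (fourierCoeffs (u t)) ≤ B) ⟨0, by simp, by simp⟩ ?_ ?_ fun t ht => ?_
  · rintro J J' hJ ⟨B, hB, hb⟩
    exact ⟨B, hB, fun t ht => hb t (hJ ht)⟩
  · rintro J J' ⟨B, hB, hb⟩ ⟨B', hB', hb'⟩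
    exact ⟨max B B', max_lt hB hB', fun t ht =>
      ht.elim (fun h => (hb t h).trans (le_max_left _ _)) fun h => (hb' t h).trans (le_max_right _ _)⟩
  · have h1 := (h.2 t ht).eventually (ge_mem_nhds (zero_lt_one' ENNReal))
    refine ⟨_, h1, 2 * 1 + 2 * sobolevSq s (fourierCoeffs (u t)), ?_, fun r hr => ?_⟩
    · have := h.1 t ht
      rw [MemH] at this
      finiteness
    · have h2 := sobolevSq_sub_le s (fourierCoeffs (u r) - fourierCoeffs (u t))
        (-fourierCoeffs (u t))
      have h3 : sobolevSq s (-fourierCoeffs (u t)) = sobolevSq s (fourierCoeffs (u t)) := by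
        simp only [sobolevSq, Pi.neg_apply, enorm_neg]
      rw [sub_neg_eq_add, sub_add_cancel, h3] at h2
      refine h2.trans ?_
      gcongr
      exact hr

/-- Cauchy–Schwarz after writing wt = wt^{1/4}·wt^{3/4}. This interpolation puts C⁰(H^{1/2}) ∩
L²(H^{3/2}) into L⁴(H¹), the class in which uniqueness holds. -/
lemma sobolevSq_one_sq_le (c : Coeffs) :
    sobolevSq 1 c ^ 2 ≤ sobolevSq (1 / 2) c * sobolevSq (3 / 2) c := by
  have h := tsum_mul_sq_le (fun k => ENNReal.ofReal (wt k ^ (1 / 4 : ℝ)) * ‖c k‖ₑ)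
    fun k => ENNReal.ofReal (wt k ^ (3 / 4 : ℝ)) * ‖c k‖ₑ
  have e1 : ∀ k, ENNReal.ofReal (wt k ^ (1 / 4 : ℝ)) * ‖c k‖ₑ *
      (ENNReal.ofReal (wt k ^ (3 / 4 : ℝ)) * ‖c k‖ₑ) = ENNReal.ofReal (wt k) * ‖c k‖ₑ ^ 2 := fun k => by
    have : wt k ^ (1 / 4 : ℝ) * wt k ^ (3 / 4 : ℝ) = wt k := by
      rw [← Real.rpow_add (wt_pos k)]
      norm_num
    rw [mul_mul_mul_comm, ← ENNReal.ofReal_mul (Real.rpow_nonneg (wt_pos k).le _), this, sq]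
  have e2 : ∀ (r : ℝ) k, (ENNReal.ofReal (wt k ^ r) * ‖c k‖ₑ) ^ 2 =
      ENNReal.ofReal (wt k ^ (2 * r)) * ‖c k‖ₑ ^ 2 := fun r k => by
    rw [mul_pow, ← ENNReal.ofReal_pow (Real.rpow_nonneg (wt_pos k).le _), mul_comm 2 r,
      Real.rpow_mul (wt_pos k).le, Real.rpow_two]
  simp only [e1, e2] at h
  rw [← sobolevSq_one] at h
  norm_num at h
  exact h

lemma integrableOn_coeff_of_memL2H {s T : ℝ} {c : ℝ → Coeffs} (h : MemL2H s T c) (k : Fin 3 → ℤ) :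
    IntegrableOn (fun t => c t k) (Ioo 0 T) := by
  have hw : 0 < wt k ^ s := Real.rpow_pos_of_pos (wt_pos k) s
  refine MemLp.integrable (q := 2) (by norm_num) ⟨h.1 k, ?_⟩
  rw [eLpNorm_lt_top_iff_lintegral_rpow_enorm_lt_top two_ne_zero ENNReal.ofNat_ne_top]
  simp only [ENNReal.toReal_ofNat, ENNReal.rpow_ofNat]
  have h1 : ENNReal.ofReal (wt k ^ s) * ∫⁻ t in Ioo 0 T, ‖c t k‖ₑ ^ 2 < ⊤ := by
    rw [← lintegral_const_mul' _ _ ENNReal.ofReal_ne_top]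
    exact (lintegral_mono fun t => ENNReal.le_tsum (f := fun k =>
      ENNReal.ofReal (wt k ^ s) * ‖c t k‖ₑ ^ 2) k).trans_lt h.2
  exact ENNReal.lt_top_of_mul_ne_top_right h1.ne (by simpa using hw)

/-- The weak form identifies u_t with `rhs` at almost every time, and the distributional time
derivative then turns into the integrated equation for each continuous mode. -/
lemma IsStrongSolutionOn.isWeakCoeffSolution {ν T : ℝ} (hT : 0 < T) {v : ℝ → L2}
    (h : IsStrongSolutionOn ν T v) : IsWeakCoeffSolution ν T fun t => fourierCoeffs (v t) := by
  obtain ⟨hC, hL, ut, hut, hder, hweak⟩ := h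
  have hae : ∀ᵐ t ∂(volume.restrict (Ioo 0 T)), ut t = rhs ν (fourierCoeffs (v t)) := by
    have h1 : ∀ᵐ t ∂(volume.restrict (Ioo 0 T)), ∀ (m : Fin 3 → ℤ) (i : Fin 3),
        WeakEquation ν (v t) (ut t) (cosField m i) ∧ WeakEquation ν (v t) (ut t) (sinField m i) := by
      -- The exceptional null set of the weak form depends on the test function; the trigonometric
      -- fields are countably many, so one null set suffices for them.
      refine ae_all_iff.2 fun m => ae_all_iff.2 fun i => ?_
      filter_upwards [hweak _ (isCn_cosField m i), hweak _ (isCn_sinField m i)] with t ht ht'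
        using ⟨ht, ht'⟩
    filter_upwards [h1] with t ht
    funext m
    ext i
    exact eq_rhs_of_weakEquation (ht m i).1 (ht m i).2
  have hutI : ∀ k, IntervalIntegrable (fun t => ut t k) volume 0 T := fun k => by
    rw [intervalIntegrable_iff_integrableOn_Ioo_of_le hT.le]
    exact integrableOn_coeff_of_memL2H hut k
  have hae' : ∀ᵐ t ∂(volume.restrict (Ioc 0 T)), ut t = rhs ν (fourierCoeffs (v t)) := by
    rwa [← restrict_Ioo_eq_restrict_Ioc]
  refine ⟨fun k => ?_, fun t ht k => ?_, ?_, ?_⟩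
  · refine (hutI k).congr_ae ?_
    rw [uIoc_of_le hT.le]
    filter_upwards [hae'] with t ht
    rw [ht]
  · have h1 := eq_add_integral_of_isTimeDeriv hT (hC.continuousOn_coeff (by norm_num) k) (hutI k)
      (fun ψ hψ => hder ψ hψ.1 hψ.2.1 hψ.2.2 k) t ht
    rw [h1]
    congr 1
    refine intervalIntegral.integral_congr_ae ?_
    filter_upwards [(ae_restrict_iff' measurableSet_Ioc).1 hae'] with s hs hst
    rw [uIoc_of_le ht.1] at hst
    rw [hs ⟨hst.1, hst.2.trans ht.2⟩]
  · obtain ⟨B, hB, hb⟩ := hC.exists_bound isCompact_Icc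
    exact ⟨B, hB, fun t ht => (sobolevSq_mono (by norm_num) _).trans (hb t ht)⟩
  · obtain ⟨B, hB, hb⟩ := hC.exists_bound isCompact_Icc
    rw [← restrict_Ioo_eq_restrict_Ioc]
    refine (setLIntegral_mono' (g := fun s => B * sobolevSq (3 / 2) (fourierCoeffs (v s)))
      measurableSet_Ioo fun s hs => (sobolevSq_one_sq_le _).trans
        (mul_le_mul_left (hb s (Ioo_subset_Icc_self hs)) _)).trans_lt ?_
    rw [lintegral_const_mul' _ _ hB.ne]
    exact ENNReal.mul_lt_top hB hL.2

end Burgers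
end

/-! ### Proof of the theorem -/

noncomputable section
namespace Burgers

/-- Global existence, uniqueness and regularity for the Burgers equations. -/
theorem exists_unique_globalStrongSolution (ν : ℝ) (hν : 0 < ν) (u₀ : L2) (hu₀ : MemH 1 u₀) :
    ∃ u : ℝ → L2,
      IsGlobalStrongSolution ν u₀ u ∧
      (∀ v : ℝ → L2, IsGlobalStrongSolution ν u₀ v → ∀ t, 0 ≤ t → v t = u t) ∧
      ContIntoH 1 (Set.Ici 0) u ∧
      (∀ T : ℝ, 0 < T → MemL2H 2 T (fun t => fourierCoeffs (u t))) ∧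
      ∃ w : ℝ → C(T3, V3),
        (∀ t, 0 < t → (u t : T3 → V3) =ᵐ[volume] w t) ∧
        IsClassicalSolution ν w := by
  obtain ⟨c, hc0, hc⟩ := exists_global_solution hν hu₀ (isReal_fourierCoeffs u₀)
  have hr0 : IsReal (c 0) := hc0 ▸ isReal_fourierCoeffs u₀
  have hr : ∀ t, 0 ≤ t → IsReal (c t) := fun t ht => (hc t ht).isReal hν hr0 t ⟨ht, le_rfl⟩
  -- At negative times the value 0 is arbitrary; no assertion refers to it.
  have hex : ∀ t, ∃ f : L2, 0 ≤ t → fourierCoeffs f = c t := fun t => by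
    rcases le_or_gt 0 t with ht | ht
    · have h1 : ∑' k, ‖c t k‖ₑ ^ 2 < ⊤ := by
        rw [← sobolevSq_zero]
        exact (sobolevSq_mono zero_le_one _).trans_lt ((hc t ht).sobolevSq_one_lt_top ⟨ht, le_rfl⟩)
      obtain ⟨f, hf⟩ := exists_L2_of_coeffs h1 (hr t ht)
      exact ⟨f, fun _ => hf⟩
    · exact ⟨0, fun h => absurd h (not_le.2 ht)⟩
  choose u hu using hex
  have hu0 : u 0 = u₀ := L2_ext (by rw [hu 0 le_rfl, hc0])
  refine ⟨u, ⟨hu0, fun T hT => (hc T hT.le).isStrongSolutionOn hν hT.le hr0 hu⟩,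
    fun v hv t ht => L2_ext ?_, contIntoH_Ici fun T hT => (hc T hT).contIntoH hu le_rfl,
    fun T hT => (hc T hT.le).memL2H hν hu le_rfl, fun t => synth (c t), fun t ht => ?_,
    isClassicalSolution_synth hν hc hr0⟩
  · have hT : 0 < t + 1 := by linarith
    rw [hu t ht]
    exact (hv.2 _ hT).isWeakCoeffSolution hT |>.unique hν ((hc _ hT.le).isWeakCoeffSolution hT.le)
      (by rw [hv.1, hc0]) t ⟨ht, by linarith⟩
  · obtain ⟨m, hm, hcm⟩ := (hc t ht.le).exists_isRapid hν ht
    refine ae_eq_of_fourierCoeffs_eq (Lp.memLp _) (synth (c t)).continuous.memLp_two ?_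
    rw [hu t ht.le, hm.fourierCoeffs_synth (hcm t ⟨le_rfl, le_rfl⟩) (hr t ht.le)]

end Burgers
end

theorem mainTheorem2 (ν : ℝ) (hν : 0 < ν) (u₀ : Burgers.L2) (hu₀ : Burgers.MemH 1 u₀) :
    ∃ u : ℝ → Burgers.L2,
      Burgers.IsGlobalStrongSolution ν u₀ u ∧
      (∀ v : ℝ → Burgers.L2, Burgers.IsGlobalStrongSolution ν u₀ v → ∀ t, 0 ≤ t → v t = u t) ∧
      Burgers.ContIntoH 1 (Set.Ici 0) u ∧
      (∀ T : ℝ, 0 < T → Burgers.MemL2H 2 T (fun t => Burgers.fourierCoeffs (u t))) ∧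
      ∃ w : ℝ → C(Burgers.T3, Burgers.V3),
        (∀ t, 0 < t → (u t : Burgers.T3 → Burgers.V3) =ᵐ[MeasureTheory.volume] w t) ∧
        Burgers.IsClassicalSolution ν w :=
  Burgers.exists_unique_globalStrongSolution ν hν u₀ hu₀
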